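/- Let $\mathbb{D}$ be the open unit disk, $\mathbb{T}$ its boundary circle with normalized Lebesgue measure $m$, and let $b:\mathbb{D}\to\mathbb{D}$ be an analytic function that is a non-extreme point of the unit ball of $H^\infty$, i.e. that has a Pythagorean mate: an outer function $a$ on $\mathbb{D}$ with $|a|^2+|b|^2=1$ almost everywhere on $\mathbb{T}$ (in the sense of radial boundary values). Let $\phi=b/a$, and let $\mathcal{H}(b)$ be the de Branges–Rovnyak space, that is, the Hilbert space of analytic functions on $\mathbb{D}$ with reproducing kernel $$k_b(\lambda,z)=\frac{1-\overline{b(\lambda)}\,b(z)}{1-\overline{\lambda}z}.$$ Let $H^2$ be the Hardy space of analytic functions $f$ on $\mathbb{D}$ with $\sup_{0<r<1}\int_{\mathbb{T}}|f(r\zeta)|^2\,dm(\zeta)<\infty$, $H^\infty$ the space of bounded analytic functions on $\mathbb{D}$, $\mathcal{A}$ the disk algebra of analytic functions on $\mathbb{D}$ that extend continuously to $\overline{\mathbb{D}}$, and $\mathrm{BMOA}$ (respectively $\mathrm{VMOA}$) the space of $f\in H^2$ whose boundary function on $\mathbb{T}$ has bounded (respectively vanishing) mean oscillation over arcs. Then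 the following statements are equivalent: 1. $\phi\in H^2$; 2. $H^\infty\subset\mathcal{H}(b)$; 3. $\mathcal{A}\subset\mathcal{H}(b)$; 4. $\mathrm{VMOA}\subset\mathcal{H}(b)$; 5. $\mathrm{BMOA}\subset\mathcal{H}(b)$. -/

import Mathlib

open Filter Topology MeasureTheory Metric ComplexConjugate

/-! Spaces of analytic functions on the open unit disk `ball (0 : ℂ) 1`.  A function on the disk is
represented by a function `ℂ → ℂ`; only its values on the disk matter in the definitions below.
The point `r * exp (i θ)` is `circleMap 0 r θ`, and functions on the unit circle are represented by
functions of the angle `θ : ℝ`. -/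

/-- The Hardy space `H²`: analytic functions on the unit disk with
`sup_{0 < r < 1} (1/2π) ∫ |f(r exp(iθ))|² dθ < ∞`. -/
def hardyTwo : Set (ℂ → ℂ) :=
  {f | DifferentiableOn ℂ f (ball 0 1) ∧
    ∃ C : ℝ, ∀ r : ℝ, 0 < r → r < 1 → Real.circleAverage (fun z => ‖f z‖ ^ 2) 0 r ≤ C}

/-- `H^∞`: bounded analytic functions on the unit disk. -/
def hardyInfty : Set (ℂ → ℂ) :=
  {f | DifferentiableOn ℂ f (ball 0 1) ∧ ∃ C : ℝ, ∀ z ∈ ball (0 : ℂ) 1, ‖f z‖ ≤ C}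

/-- The disk algebra: analytic functions on the unit disk that extend continuously to the closed
unit disk. -/
def diskAlgebra : Set (ℂ → ℂ) :=
  {f | DifferentiableOn ℂ f (ball 0 1) ∧
    ∃ g : ℂ → ℂ, ContinuousOn g (closedBall 0 1) ∧ Set.EqOn g f (ball 0 1)}

/-- `u` is the boundary function of `f`: for almost every `θ`, the radial limit of `f` at
`exp (i θ)` exists and equals `u θ`. -/
def HasBoundaryFunction (f : ℂ → ℂ) (u : ℝ → ℂ) : Prop :=
  ∀ᵐ θ : ℝ, Tendsto (fun r : ℝ => f (circleMap 0 r θ)) (𝓝[<] 1) (𝓝 (u θ))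

/-- The mean oscillation `(1/|I|) ∫_I |u - u_I|` of `u` over the arc `I` of angles between `α` and
`β`, where `u_I` is the mean of `u` over `I`. -/
noncomputable def meanOscillation (u : ℝ → ℂ) (α β : ℝ) : ℝ :=
  ⨍ θ in α..β, ‖u θ - ⨍ t in α..β, u t‖

/-- Bounded mean oscillation over all arcs of the circle. -/
def IsBMO (u : ℝ → ℂ) : Prop :=
  (∀ α β : ℝ, IntervalIntegrable u volume α β) ∧
    ∃ C : ℝ, ∀ α β : ℝ, α < β → β ≤ α + 2 * Real.pi → meanOscillation u α β ≤ C

/-- Vanishing mean oscillation: bounded mean oscillation, and the mean oscillation over an arc tends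
to `0` uniformly as the length of the arc tends to `0`. -/
def IsVMO (u : ℝ → ℂ) : Prop :=
  IsBMO u ∧ ∀ ε : ℝ, 0 < ε → ∃ δ : ℝ, 0 < δ ∧ ∀ α β : ℝ,
    α < β → β ≤ α + 2 * Real.pi → β - α < δ → meanOscillation u α β < ε

/-- `BMOA`: functions in `H²` whose boundary function has bounded mean oscillation. -/
def BMOA : Set (ℂ → ℂ) :=
  {f | f ∈ hardyTwo ∧ ∃ u : ℝ → ℂ, HasBoundaryFunction f u ∧ IsBMO u}

/-- `VMOA`: functions in `H²` whose boundary function has vanishing mean oscillation. -/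
def VMOA : Set (ℂ → ℂ) :=
  {f | f ∈ hardyTwo ∧ ∃ u : ℝ → ℂ, HasBoundaryFunction f u ∧ IsVMO u}

/-- Outer functions: `a(z) = c exp ((1/2π) ∫ (exp(iθ) + z)/(exp(iθ) - z) log |a(exp(iθ))| dθ)` in
the unit disk, with `|c| = 1` and `log |a|` integrable on the unit circle. -/
def IsOuter (a : ℂ → ℂ) : Prop :=
  DifferentiableOn ℂ a (ball 0 1) ∧
    ∃ u : ℝ → ℂ, HasBoundaryFunction a u ∧ (∀ᵐ θ : ℝ, u θ ≠ 0) ∧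
      IntervalIntegrable (fun θ => Real.log ‖u θ‖) volume 0 (2 * Real.pi) ∧
      ∃ c : ℂ, ‖c‖ = 1 ∧ ∀ z ∈ ball (0 : ℂ) 1,
        a z = c * Complex.exp ((2 * (Real.pi : ℂ))⁻¹ * ∫ θ in (0 : ℝ)..(2 * Real.pi),
          (circleMap 0 1 θ + z) / (circleMap 0 1 θ - z) * (Real.log ‖u θ‖ : ℂ))

/-- `a` is a Pythagorean mate of `b`: `a` is outer and `|a|² + |b|² = 1` almost everywhere on the
unit circle. -/
def IsPythagoreanMate (a b : ℂ → ℂ) : Prop :=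
  IsOuter a ∧ ∃ u v : ℝ → ℂ, HasBoundaryFunction a u ∧ HasBoundaryFunction b v ∧
    ∀ᵐ θ : ℝ, ‖u θ‖ ^ 2 + ‖v θ‖ ^ 2 = 1

/-- The kernel `(1 - conj (b w) * b z) / (1 - conj w * z)`, the value at `z` of the kernel function
at `w`; the scalar is regarded as an operator on the one-dimensional space `ℂ`. -/
noncomputable def deBrangesRovnyakKernel (b : ℂ → ℂ) :
    Matrix Complex.UnitDisc Complex.UnitDisc (ℂ →L[ℂ] ℂ) :=
  Matrix.of fun z w =>
    ((1 - conj (b (w : ℂ)) * b (z : ℂ)) / (1 - conj (w : ℂ) * (z : ℂ))) •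
      ContinuousLinearMap.id ℂ ℂ

/-- The de Branges–Rovnyak space `H(b)`: the functions in the reproducing kernel Hilbert space on
the unit disk with the kernel above.  (For analytic `b` from the disk to itself that kernel is
positive semidefinite, so that the space exists.) -/
def deBrangesRovnyak (b : ℂ → ℂ) : Set (ℂ → ℂ) :=
  {f | ∃ _ : Fact (deBrangesRovnyakKernel b).PosSemidef,
    ∃ h : RKHS.OfKernel (deBrangesRovnyakKernel b), ∀ z : Complex.UnitDisc, h z = f z}

/-! ### Circle averages -/

/-! Since `|a|² + |b|² = 1` on the circle, `H(b)` has a model inside `H² ⊕ H²`. With `k_w` the Szegő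
kernel, the vectors `(k_w - conj b(w) b k_w, conj b(w) a k_w)` have the kernel of `H(b)` as Gram
matrix (`IsOuterPair.isKernelModel`). They lie in the closed subspace of pairs `(f, g)` with
`T_{conj b} f = T_{conj a} g`, and on that subspace the inner product with the vector at `w` is
`f(w)`. Because `a` is outer, `a H^∞` is dense in `H²`, so `f` determines `g`; for a polynomial `f`
it is the polynomial `T_{conj φ} f`. Lying in `H(b)` thus becomes a matter of controlling `T_{conj
φ}`.

Necessity of `φ ∈ H²`: functions with absolutely summable Taylor coefficients lie in the disk
algebra. If they all lie in `H(b)`, the closed graph theorem bounds the norms of the monomials `z^n`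
uniformly. The second component of `z^n` has the coefficients `conj φ_n, ..., conj φ_0`, so the
partial sums of `∑ |φ_j|²` are bounded (`IsOuterPair.mem_hardyTwo_of_diskAlgebra_subset`).

Sufficiency: suppose that `|⟨p, g h⟩| ≤ C ‖g‖ ‖h‖` for polynomials `g`, `h`, and put `t = T_{conj φ}
p`. Then `‖t‖² = ⟨p, φ t⟩ ≤ C ‖φ‖ ‖t‖`, which bounds the model vector `(p, t)`. By weak compactness,
a pointwise limit of polynomials with a common `C` lies in `H(b)`
(`IsOuterPair.mem_of_hankelBound`). Polynomials close to the dilates of a function in `BMOA` or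
`H^∞` have uniformly bounded mean oscillation, so what remains is Fefferman's theorem that such
symbols define bounded Hankel forms (`hankelBound_of_meanOscillation_le`).

Fefferman's theorem is obtained from a maximum principle, `le_poissonMean`. Let `G` be the Poisson
integral of `|p|²` minus `|p|²`, with `0 ≤ G ≤ M`. For analytic `h`, the function `|h|² / (M + G)`
is subharmonic with Laplacian at least of order `|h|² |p'|² / M²`. This gain absorbs the error terms
twice: in a reverse Hölder inequality bounding `M` by the square of the `L¹` oscillation, and in the
estimate of the Hankel form.

The disk algebra is contained in `H^∞` and in `VMOA ⊆ BMOA`, so these arguments close all the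
implications. -/

theorem HasSum.of_eq {f g : ℕ → ℂ} {a : ℂ} (h : HasSum f a) (e : ∀ n, f n = g n) : HasSum g a :=
  funext e ▸ h

theorem hasSum_circleAverage_of_summable {E : Type*} [NormedAddCommGroup E] [NormedSpace ℝ E]
    {f : ℕ → ℂ → E} {F : ℂ → E} {c : ℂ} {r : ℝ} {B : ℕ → ℝ}
    (hf : ∀ n, ContinuousOn (f n) (sphere c |r|)) (hB : Summable B)
    (hfB : ∀ n, ∀ z ∈ sphere c |r|, ‖f n z‖ ≤ B n)
    (hF : ∀ z ∈ sphere c |r|, HasSum (fun n => f n z) (F z)) :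
    HasSum (fun n => Real.circleAverage (f n) c r) (Real.circleAverage F c r) := by
  unfold Real.circleAverage
  refine HasSum.const_smul _ ?_
  have hm : ∀ θ, circleMap c r θ ∈ sphere c |r| := circleMap_mem_sphere' c r
  refine intervalIntegral.hasSum_integral_of_dominated_convergence (fun n _ => B n) (fun n => ?_)
    (fun n => .of_forall fun θ _ => hfB n _ (hm θ)) (.of_forall fun _ _ => hB)
    intervalIntegrable_const (.of_forall fun θ _ => hF _ (hm θ))
  exact ((hf n).comp_continuous (continuous_circleMap c r) hm).aestronglyMeasurable

theorem circleAverage_conj {f : ℂ → ℂ} {c : ℂ} {r : ℝ} :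
    Real.circleAverage (fun z => conj (f z)) c r = conj (Real.circleAverage f c r) := by
  simp only [Real.circleAverage, Complex.real_smul, map_mul, Complex.conj_ofReal,
    intervalIntegral.integral_of_le Real.two_pi_pos.le, integral_conj]

theorem circleAverage_ofReal {f : ℂ → ℝ} {c : ℂ} {r : ℝ} :
    Real.circleAverage (fun z => (f z : ℂ)) c r = ((Real.circleAverage f c r : ℝ) : ℂ) := by
  simp only [Real.circleAverage, Complex.real_smul, intervalIntegral.integral_ofReal]
  rw [smul_eq_mul, Complex.ofReal_mul]

theorem circleAverage_pow (n : ℕ) (r : ℝ) :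
    Real.circleAverage (fun z : ℂ => z ^ n) 0 r = if n = 0 then 1 else 0 := by
  have : DiffContOnCl ℂ (fun z : ℂ => z ^ n) (ball 0 |r|) :=
    (differentiable_id.pow n).diffContOnCl
  rw [this.circleAverage]
  split_ifs with h <;> simp [h]

theorem circleAverage_pow_mul_conj_pow (n k : ℕ) (r : ℝ) :
    Real.circleAverage (fun z : ℂ => z ^ n * conj (z ^ k)) 0 r =
      if n = k then (r : ℂ) ^ (2 * k) else 0 := by
  wlog h : k ≤ n generalizing n k
  · have := congrArg conj (this k n (by omega))
    rw [← circleAverage_conj] at this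
    simp only [map_mul, Complex.conj_conj, mul_comm (conj _)] at this
    rw [this]
    split_ifs with h1 h2 h2
    · simp [h1]
    · omega
    · omega
    · simp
  obtain ⟨m, rfl⟩ := Nat.exists_eq_add_of_le h
  have e : Set.EqOn (fun z : ℂ => z ^ (k + m) * conj (z ^ k))
      (fun z => ((r : ℂ) ^ (2 * k)) • z ^ m) (sphere 0 |r|) := by
    intro z hz
    have hz : ‖z‖ = |r| := by simpa using hz
    have : z * conj z = (r : ℂ) ^ 2 := by
      rw [Complex.mul_conj, Complex.normSq_eq_norm_sq, hz, sq_abs]; norm_cast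
    simp only [smul_eq_mul, map_pow]
    rw [pow_mul, ← this]; ring
  rw [Real.circleAverage_congr_sphere e, Real.circleAverage_fun_smul, circleAverage_pow]
  split_ifs with h1 h2 h2 <;> first | omega | simp

/-! ### Taylor coefficients on the unit disk -/

/-- `F` is the sum of the power series with coefficients `c` on the open unit disk. -/
def HasTaylor (F : ℂ → ℂ) (c : ℕ → ℂ) : Prop :=
  ∀ z ∈ ball (0 : ℂ) 1, HasSum (fun n => c n * z ^ n) (F z)

theorem exists_hasTaylor {F : ℂ → ℂ} (hF : DifferentiableOn ℂ F (ball 0 1)) :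
    ∃ c, HasTaylor F c := by
  refine ⟨fun n => (n.factorial : ℂ)⁻¹ * iteratedDeriv n F 0, fun z hz => ?_⟩
  have h := Complex.hasSum_taylorSeries_on_ball (r := 1) (c := 0) (f := F) hF hz
  refine h.of_eq fun n => ?_
  simp only [sub_zero, smul_eq_mul]
  ring

namespace HasTaylor

variable {F G : ℂ → ℂ} {c d : ℕ → ℂ}

theorem summable_norm (h : HasTaylor F c) {r : ℝ} (h0 : 0 ≤ r) (h1 : r < 1) :
    Summable (fun n => ‖c n‖ * r ^ n) := by
  have := (h (r : ℂ) (by simpa [abs_of_nonneg h0] using h1)).summable.norm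
  simpa [abs_of_nonneg h0] using this

theorem congr (h : HasTaylor F c) (hG : Set.EqOn F G (ball 0 1)) : HasTaylor G c :=
  fun z hz => hG hz ▸ h z hz

theorem add (h : HasTaylor F c) (h' : HasTaylor G d) :
    HasTaylor (fun z => F z + G z) (fun n => c n + d n) := fun z hz => by
  simpa [add_mul] using (h z hz).add (h' z hz)

theorem sub (h : HasTaylor F c) (h' : HasTaylor G d) :
    HasTaylor (fun z => F z - G z) (fun n => c n - d n) := fun z hz => by
  simpa [sub_mul] using (h z hz).sub (h' z hz)

theorem const_mul (h : HasTaylor F c) (a : ℂ) :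
    HasTaylor (fun z => a * F z) (fun n => a * c n) := fun z hz => by
  simpa [mul_assoc] using (h z hz).mul_left a

theorem mul (h : HasTaylor F c) (h' : HasTaylor G d) :
    HasTaylor (fun z => F z * G z) (fun n => ∑ k ∈ Finset.range (n + 1), c k * d (n - k)) := by
  intro z hz
  have hz' : ‖z‖ < 1 := by simpa using hz
  have s1 : Summable (fun n => ‖c n * z ^ n‖) := by
    simpa using h.summable_norm (norm_nonneg z) hz'
  have s2 : Summable (fun n => ‖d n * z ^ n‖) := by
    simpa using h'.summable_norm (norm_nonneg z) hz'
  have := hasSum_sum_range_mul_of_summable_norm s1 s2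
  rw [(h z hz).tsum_eq, (h' z hz).tsum_eq] at this
  refine this.of_eq fun n => ?_
  rw [Finset.sum_mul]
  refine Finset.sum_congr rfl fun k hk => ?_
  have : z ^ n = z ^ k * z ^ (n - k) := by
    rw [← pow_add]; congr 1; have := Finset.mem_range.1 hk; omega
  rw [this]
  ring

theorem differentiableOn (h : HasTaylor F c) : DifferentiableOn ℂ F (ball 0 1) := by
  intro z hz
  have hz' : ‖z‖ < 1 := by simpa using hz
  obtain ⟨r, hr, hr1⟩ := exists_between hz'
  have h0 : 0 ≤ r := (norm_nonneg z).trans hr.le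
  have key : DifferentiableOn ℂ (fun w => ∑' n, c n * w ^ n) (ball 0 r) := by
    refine Complex.differentiableOn_tsum_of_summable_norm (h.summable_norm h0 hr1)
      (fun n => by fun_prop) isOpen_ball fun n w hw => ?_
    have : ‖w‖ ≤ r := by simpa using (mem_ball_zero_iff.1 hw).le
    rw [norm_mul, norm_pow]
    gcongr
  have hzr : z ∈ ball (0 : ℂ) r := by simpa using hr
  have e : Set.EqOn F (fun w => ∑' n, c n * w ^ n) (ball 0 r) := fun w hw =>
    (h w (ball_subset_ball hr1.le hw)).tsum_eq.symm
  exact ((key.congr e).differentiableAt (isOpen_ball.mem_nhds hzr)).differentiableWithinAt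

theorem continuousOn_sphere (h : HasTaylor F c) {r : ℝ} (h0 : 0 < r) (h1 : r < 1) :
    ContinuousOn F (sphere 0 |r|) :=
  h.differentiableOn.continuousOn.mono fun z hz => by
    rw [abs_of_pos h0] at hz
    rw [mem_sphere_zero_iff_norm] at hz
    simpa [hz] using h1

theorem circleAverage_mul_conj_pow (h : HasTaylor F c) {r : ℝ} (h0 : 0 < r) (h1 : r < 1) (k : ℕ) :
    Real.circleAverage (fun z => F z * conj (z ^ k)) 0 r = c k * (r : ℂ) ^ (2 * k) := by
  have key := hasSum_circleAverage_of_summable (c := 0) (r := r)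
    (f := fun n z => c n * z ^ n * conj (z ^ k)) (F := fun z => F z * conj (z ^ k))
    (B := fun n => ‖c n‖ * r ^ n * r ^ k) (fun n => by fun_prop)
    ((h.summable_norm h0.le h1).mul_right _) (fun n z hz => by
      have hz : ‖z‖ = r := by simpa [abs_of_pos h0] using hz
      simp [hz]) (fun z hz => by
      have hz : ‖z‖ = r := by simpa [abs_of_pos h0] using hz
      exact (h z (by simpa [hz] using h1)).mul_right _)
  refine key.unique ?_
  have e : (fun n => Real.circleAverage (fun z => c n * z ^ n * conj (z ^ k)) 0 r) =
      fun n => if n = k then c k * (r : ℂ) ^ (2 * k) else 0 := by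
    ext n
    have := circleAverage_pow_mul_conj_pow n k r
    simp only [mul_assoc]
    have e2 := Real.circleAverage_fun_smul (a := c n) (f := fun z : ℂ => z ^ n * conj (z ^ k))
      (c := 0) (R := r)
    simp only [smul_eq_mul] at e2
    rw [e2, this]
    split_ifs with h
    · rw [h]
    · simp
  rw [e]
  exact hasSum_ite_eq k _

theorem unique (h : HasTaylor F c) (h' : HasTaylor F d) : c = d := by
  ext k
  have := (h.circleAverage_mul_conj_pow (r := 1 / 2) (by norm_num) (by norm_num) k).symm.trans
    (h'.circleAverage_mul_conj_pow (r := 1 / 2) (by norm_num) (by norm_num) k)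
  exact mul_right_cancel₀ (by norm_num) this

theorem hasSum_circleAverage (h : HasTaylor F c) (h' : HasTaylor G d) {r : ℝ} (h0 : 0 < r)
    (h1 : r < 1) : HasSum (fun n => c n * conj (d n) * (r : ℂ) ^ (2 * n))
      (Real.circleAverage (fun z => F z * conj (G z)) 0 r) := by
  obtain ⟨C, hC⟩ := (isCompact_sphere (0 : ℂ) |r|).exists_bound_of_continuousOn
    (h.continuousOn_sphere h0 h1)
  have key := hasSum_circleAverage_of_summable (c := 0) (r := r)
    (f := fun n z => F z * conj (d n * z ^ n)) (F := fun z => F z * conj (G z))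
    (B := fun n => C * (‖d n‖ * r ^ n))
    (fun n => (h.continuousOn_sphere h0 h1).mul (by fun_prop))
    ((h'.summable_norm h0.le h1).mul_left _) (fun n z hz => by
      have hz' : ‖z‖ = r := by simpa [abs_of_pos h0] using hz
      rw [norm_mul, Complex.norm_conj, norm_mul, norm_pow, hz']
      have := hC z hz
      have : 0 ≤ r := h0.le
      gcongr) (fun z hz => by
      have hz : ‖z‖ = r := by simpa [abs_of_pos h0] using hz
      refine HasSum.mul_left _ ?_
      exact (h' z (by simpa [hz] using h1)).star)
  refine key.of_eq fun n => ?_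
  have e2 := Real.circleAverage_fun_smul (a := conj (d n)) (f := fun z : ℂ => F z * conj (z ^ n))
      (c := 0) (R := r)
  simp only [smul_eq_mul] at e2
  rw [h.circleAverage_mul_conj_pow h0 h1] at e2
  rw [mul_assoc, mul_left_comm, ← e2]
  congr 1
  ext z
  simp only [map_mul]
  ring

theorem hasSum_circleAverage_norm_sq (h : HasTaylor F c) {r : ℝ} (h0 : 0 < r)
    (h1 : r < 1) : HasSum (fun n => ‖c n‖ ^ 2 * r ^ (2 * n))
      (Real.circleAverage (fun z => ‖F z‖ ^ 2) 0 r) := by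
  have := h.hasSum_circleAverage h h0 h1
  simp only [Complex.mul_conj, Complex.normSq_eq_norm_sq] at this
  rw [circleAverage_ofReal] at this
  exact_mod_cast this

/-- A bound for the square means bounds the `ℓ²` norm of the Taylor coefficients. -/
theorem summable_sq (h : HasTaylor F c) {C : ℝ}
    (hC : ∀ r : ℝ, 0 < r → r < 1 → Real.circleAverage (fun z => ‖F z‖ ^ 2) 0 r ≤ C) :
    Summable (fun n => ‖c n‖ ^ 2) ∧ ∑' n, ‖c n‖ ^ 2 ≤ C := by
  -- Over a finite set of indices the factors `r ^ (2 * n)` can be sent to `1`, which avoids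
  -- exchanging a limit with an infinite sum.
  have key : ∀ s : Finset ℕ, ∑ n ∈ s, ‖c n‖ ^ 2 ≤ C := by
    intro s
    have ht : Tendsto (fun r : ℝ => ∑ n ∈ s, ‖c n‖ ^ 2 * r ^ (2 * n)) (𝓝[<] 1)
        (𝓝 (∑ n ∈ s, ‖c n‖ ^ 2)) := by
      have : Continuous (fun r : ℝ => ∑ n ∈ s, ‖c n‖ ^ 2 * r ^ (2 * n)) := by fun_prop
      have := this.tendsto 1
      simp only [one_pow, mul_one] at this
      exact this.mono_left nhdsWithin_le_nhds
    refine le_of_tendsto ht ?_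
    filter_upwards [Ioo_mem_nhdsLT (show (0 : ℝ) < 1 by norm_num)] with r hr
    exact (sum_le_hasSum s (fun n _ => by have := hr.1; positivity)
      (h.hasSum_circleAverage_norm_sq hr.1 hr.2)).trans (hC r hr.1 hr.2)
  have hs := summable_of_sum_le (f := fun n => ‖c n‖ ^ 2) (fun n => by positivity) key
  exact ⟨hs, hs.tsum_le_of_sum_le key⟩

theorem mem_hardyTwo_iff (h : HasTaylor F c) : F ∈ hardyTwo ↔ Summable (fun n => ‖c n‖ ^ 2) := by
  refine ⟨fun ⟨_, C, hC⟩ => (h.summable_sq hC).1, fun hs => ⟨h.differentiableOn, ∑' n, ‖c n‖ ^ 2,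
    fun r h0 h1 => ?_⟩⟩
  rw [← (h.hasSum_circleAverage_norm_sq h0 h1).tsum_eq]
  refine (h.hasSum_circleAverage_norm_sq h0 h1).summable.tsum_le_tsum (fun n => ?_) hs
  exact mul_le_of_le_one_right (by positivity) (pow_le_one₀ h0.le h1.le)

end HasTaylor

theorem hardyInfty_subset_hardyTwo : hardyInfty ⊆ hardyTwo := by
  rintro f ⟨hf, C, hC⟩
  refine ⟨hf, C ^ 2, fun r h0 h1 => ?_⟩
  have hs : ∀ z ∈ sphere (0 : ℂ) |r|, z ∈ ball (0 : ℂ) 1 := fun z hz => by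
    rw [mem_sphere_zero_iff_norm, abs_of_pos h0] at hz
    simpa [hz] using h1
  refine Real.circleAverage_mono_on_of_le_circle ?_ fun z hz => ?_
  · refine ContinuousOn.circleIntegrable' (((hf.continuousOn.mono hs).norm).pow 2)
  · have := hC z (hs z hz)
    gcongr

/-! ### The sequence space model of the Hardy space -/

/-- Square summable sequences of Taylor coefficients. -/
noncomputable abbrev HardySeq := lp (fun _ : ℕ => ℂ) 2

theorem memℓp_two_iff {c : ℕ → ℂ} : Memℓp c 2 ↔ Summable (fun n => ‖c n‖ ^ 2) := by
  rw [memℓp_gen_iff (by norm_num)]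
  norm_num

open Classical in
/-- The sequence of Taylor coefficients of a function in `H²`. -/
noncomputable def hardyVec (F : ℂ → ℂ) : HardySeq :=
  if h : ∃ x : HardySeq, HasTaylor F x then h.choose else 0

theorem HasTaylor.hardyVec_eq {F : ℂ → ℂ} {x : HardySeq} (h : HasTaylor F x) : hardyVec F = x := by
  have h' : ∃ x : HardySeq, HasTaylor F x := ⟨x, h⟩
  rw [hardyVec, dif_pos h']
  exact lp.ext (h'.choose_spec.unique h)

theorem hasTaylor_hardyVec {F : ℂ → ℂ} (h : F ∈ hardyTwo) : HasTaylor F (hardyVec F) := by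
  obtain ⟨c, hc⟩ := exists_hasTaylor h.1
  have := memℓp_two_iff.2 (hc.mem_hardyTwo_iff.1 h)
  have h2 : HasTaylor F (⟨c, this⟩ : HardySeq) := hc
  rw [h2.hardyVec_eq]
  exact hc

/-- The inner product of Taylor coefficients is the limit of integrals over circles. -/
theorem tendsto_circleAverage_inner {F G : ℂ → ℂ} (hF : F ∈ hardyTwo) (hG : G ∈ hardyTwo) :
    Tendsto (fun r : ℝ => Real.circleAverage (fun z => F z * conj (G z)) 0 r) (𝓝[<] 1)
      (𝓝 (inner ℂ (hardyVec G) (hardyVec F))) := by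
  have hs : Summable fun n => ‖hardyVec F n * conj (hardyVec G n)‖ := by
    have := (lp.summable_inner (𝕜 := ℂ) (hardyVec G) (hardyVec F)).norm
    simpa using this
  have key := tendsto_tsum_of_dominated_convergence (𝓕 := 𝓝[<] (1 : ℝ))
    (f := fun (r : ℝ) n => hardyVec F n * conj (hardyVec G n) * (r : ℂ) ^ (2 * n))
    (g := fun n => hardyVec F n * conj (hardyVec G n)) hs (fun n => by
      have : Continuous (fun r : ℝ => hardyVec F n * conj (hardyVec G n) * (r : ℂ) ^ (2 * n)) := by
        fun_prop
      have := this.tendsto 1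
      simp only [Complex.ofReal_one, one_pow, mul_one] at this
      exact this.mono_left nhdsWithin_le_nhds) (by
      filter_upwards [Ioo_mem_nhdsLT (show (0 : ℝ) < 1 by norm_num)] with r hr n
      rw [norm_mul _ ((r : ℂ) ^ _)]
      refine mul_le_of_le_one_right (norm_nonneg _) ?_
      rw [norm_pow, Complex.norm_real, Real.norm_of_nonneg hr.1.le]
      exact pow_le_one₀ hr.1.le hr.2.le)
  rw [lp.inner_eq_tsum]
  refine (key.congr' ?_)
  filter_upwards [Ioo_mem_nhdsLT (show (0 : ℝ) < 1 by norm_num)] with r hr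
  exact ((hasTaylor_hardyVec hF).hasSum_circleAverage (hasTaylor_hardyVec hG) hr.1 hr.2).tsum_eq

/-! ### Hilbert spaces with given Gram matrix -/

section Gram

variable {ι E F : Type*} [NormedAddCommGroup E] [InnerProductSpace ℂ E] [NormedAddCommGroup F]
  [InnerProductSpace ℂ F]

theorem inner_linearCombination_eq {u : ι → E} {v : ι → F}
    (h : ∀ i j, inner ℂ (u i) (u j) = inner ℂ (v i) (v j)) (c d : ι →₀ ℂ) :
    inner ℂ (Finsupp.linearCombination ℂ u c) (Finsupp.linearCombination ℂ u d) =
      inner ℂ (Finsupp.linearCombination ℂ v c) (Finsupp.linearCombination ℂ v d) := by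
  simp only [Finsupp.linearCombination_apply, Finsupp.sum_inner, Finsupp.inner_sum, h,
    inner_smul_left, inner_smul_right]

/-- Families with the same Gram matrix are related by an isometry. -/
theorem exists_linearIsometry_of_inner_eq [CompleteSpace F] {u : ι → E} {v : ι → F}
    (h : ∀ i j, inner ℂ (u i) (u j) = inner ℂ (v i) (v j))
    (hu : Dense (Submodule.span ℂ (Set.range u) : Set E)) :
    ∃ T : E →ₗᵢ[ℂ] F, (∀ i, T (u i) = v i) ∧
      ∀ x, T x ∈ (Submodule.span ℂ (Set.range v)).topologicalClosure := by
  set e := Finsupp.linearCombination ℂ u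
  set f := Finsupp.linearCombination ℂ v
  have hd : DenseRange e := by
    rw [DenseRange, ← LinearMap.coe_range, Finsupp.range_linearCombination]
    exact hu
  -- Equality of the norms makes `e c ↦ f c` well defined and isometric on a dense subspace, and
  -- `extendOfNorm` extends it.
  have hn : ∀ x, ‖f x‖ = ‖e x‖ := fun x => by
    rw [@norm_eq_sqrt_re_inner ℂ, @norm_eq_sqrt_re_inner ℂ, inner_linearCombination_eq h]
  have hb : ∃ C : ℝ, ∀ x, ‖f x‖ ≤ C * ‖e x‖ := ⟨1, fun x => by rw [hn, one_mul]⟩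
  have he := LinearMap.extendOfNorm_eq hd hb
  refine ⟨⟨(f.extendOfNorm e).toLinearMap, ?_⟩, fun i => ?_, fun x => ?_⟩
  · refine fun x => hd.induction_on (p := fun x => ‖f.extendOfNorm e x‖ = ‖x‖) x
      (isClosed_eq (by fun_prop) (by fun_prop)) fun a => ?_
    rw [he, hn]
  · have := he (Finsupp.single i 1)
    simpa [e, f] using this
  · refine hd.induction_on
      (p := fun x => f.extendOfNorm e x ∈ (Submodule.span ℂ (Set.range v)).topologicalClosure) x
      ?_ fun a => ?_
    · exact (Submodule.isClosed_topologicalClosure _).preimage (by fun_prop)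
    · rw [he]
      refine Submodule.le_topologicalClosure _ ?_
      rw [← Finsupp.range_linearCombination]
      exact LinearMap.mem_range_self _ _

/-- Weak sequential compactness of balls in a Hilbert space, with an ultrafilter as limit. -/
theorem exists_ultrafilter_tendsto_inner [CompleteSpace E] {x : ℕ → E} {C : ℝ}
    (hx : ∀ n, ‖x n‖ ≤ C) : ∃ (y : E) (U : Ultrafilter ℕ), (U : Filter ℕ) ≤ atTop ∧
      ∀ z : E, Tendsto (fun n => inner ℂ (x n) z) U (𝓝 (inner ℂ y z)) := by
  -- Banach–Alaoglu combined with the Riesz identification; an ultrafilter in place of a subsequence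
  -- removes any need for separability.
  let D : E → WeakDual ℂ E := fun w => StrongDual.toWeakDual (InnerProductSpace.toDual ℂ E w)
  obtain ⟨U, hU⟩ := Ultrafilter.exists_le (atTop : Filter ℕ)
  have hK := WeakDual.isCompact_closedBall (𝕜 := ℂ) (E := E) 0 C
  obtain ⟨y, -, hy⟩ := hK.ultrafilter_le_nhds (U.map fun n => D (x n)) (by
    rw [Ultrafilter.coe_map, Filter.le_principal_iff, Filter.mem_map]
    refine Filter.univ_mem' fun n => ?_
    simpa [D] using hx n)
  refine ⟨(InnerProductSpace.toDual ℂ E).symm (WeakDual.toStrongDual y), U, hU, fun z => ?_⟩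
  have hc : Continuous fun w : WeakDual ℂ E => w z := WeakDual.eval_continuous z
  have := (hc.tendsto y).comp (show Tendsto (fun n => D (x n)) U (𝓝 y) from hy)
  simpa [Function.comp_def, D] using this

end Gram

/-! ### Models of the de Branges–Rovnyak space -/

/-- `v` is a family of vectors whose Gram matrix is the de Branges–Rovnyak kernel of `b`. -/
def IsKernelModel {E : Type*} [NormedAddCommGroup E] [InnerProductSpace ℂ E] (b : ℂ → ℂ)
    (v : Complex.UnitDisc → E) : Prop :=
  ∀ z w : Complex.UnitDisc, inner ℂ (v z) (v w) =
    (1 - conj (b (w : ℂ)) * b (z : ℂ)) / (1 - conj (w : ℂ) * (z : ℂ))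

namespace IsKernelModel

variable {E : Type*} [NormedAddCommGroup E] [InnerProductSpace ℂ E] {b : ℂ → ℂ}
  {v : Complex.UnitDisc → E}

/-- The quadratic form of a Gram matrix at `c` is the squared norm of the combination of the `v z`
with coefficients `c`. -/
theorem posSemidef (h : IsKernelModel b v) : (deBrangesRovnyakKernel b).PosSemidef := by
  have hK : ∀ z w, deBrangesRovnyakKernel b z w =
      inner ℂ (v z) (v w) • ContinuousLinearMap.id ℂ ℂ := fun z w => by
    rw [h z w]; rfl
  have ht := (RKHS.posSemidef_tfae (K := deBrangesRovnyakKernel b)).out 0 2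
  refine ht.2 ⟨?_, fun c => ?_⟩
  · ext z w
    rw [Matrix.conjTranspose_apply, hK, hK, star_smul]
    rw [← ContinuousLinearMap.one_def, star_one]
    simp
  · have : (c.sum fun x w => c.sum fun x' w' =>
        inner ℂ (deBrangesRovnyakKernel b x' x w) w') =
        inner ℂ (Finsupp.linearCombination ℂ v c) (Finsupp.linearCombination ℂ v c) := by
      simp only [Finsupp.linearCombination_apply, Finsupp.sum_inner, Finsupp.inner_sum,
        inner_smul_left, inner_smul_right, hK]
      rw [Finsupp.sum_comm]
      refine Finsupp.sum_congr fun x _ => ?_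
      rw [Finsupp.mul_sum]
      refine Finsupp.sum_congr fun y _ => ?_
      simp only [_root_.smul_apply, ContinuousLinearMap.id_apply, smul_eq_mul,
        RCLike.inner_apply, map_mul, inner_conj_symm]
      ring
    rw [this]
    exact inner_self_nonneg

theorem exists_linearIsometry [CompleteSpace E] (h : IsKernelModel b v)
    [Fact (deBrangesRovnyakKernel b).PosSemidef] :
    ∃ T : RKHS.OfKernel (deBrangesRovnyakKernel b) →ₗᵢ[ℂ] E,
      (∀ z, T (RKHS.kerFun _ z 1) = v z) ∧
      ∀ x, T x ∈ (Submodule.span ℂ (Set.range v)).topologicalClosure := by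
  set H := RKHS.OfKernel (deBrangesRovnyakKernel b)
  let k : Complex.UnitDisc → H := fun z => RKHS.kerFun H z 1
  have hk : ∀ z w, inner ℂ (k z) (k w) = inner ℂ (v z) (v w) := fun z w => by
    rw [RKHS.kerFun_inner, RKHS.kerFun_apply, RKHS.OfKernel.kernel_ofKernel, h z w]
    simp [deBrangesRovnyakKernel]
  refine exists_linearIsometry_of_inner_eq hk ?_
  rw [Submodule.dense_iff_topologicalClosure_eq_top, eq_top_iff, ← RKHS.kerFun_dense H]
  refine Submodule.topologicalClosure_mono (Submodule.span_le.2 ?_)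
  rintro _ ⟨z, c, rfl⟩
  have : RKHS.kerFun H z c = c • k z := by
    rw [← map_smul, smul_eq_mul, mul_one]
  rw [this]
  exact Submodule.smul_mem _ _ (Submodule.subset_span ⟨z, rfl⟩)

theorem exists_inner_eq_of_mem [CompleteSpace E] (h : IsKernelModel b v) {f : ℂ → ℂ}
    (hf : f ∈ deBrangesRovnyak b) : ∃ F ∈ (Submodule.span ℂ (Set.range v)).topologicalClosure,
      ∀ z : Complex.UnitDisc, inner ℂ (v z) F = f z := by
  obtain ⟨_, g, hg⟩ := hf
  obtain ⟨T, hT, hT'⟩ := h.exists_linearIsometry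
  refine ⟨T g, hT' g, fun z => ?_⟩
  rw [← hT, T.inner_map_map, ← hg]
  simp

/-- `F` may lie outside the closed span of `v`: the adjoint of the isometry discards the orthogonal
part, which does not affect the products with `v z`. -/
theorem mem_of_inner_eq [CompleteSpace E] (h : IsKernelModel b v) {f : ℂ → ℂ} {F : E}
    (hF : ∀ z : Complex.UnitDisc, inner ℂ (v z) F = f z) : f ∈ deBrangesRovnyak b := by
  have hp : Fact (deBrangesRovnyakKernel b).PosSemidef := ⟨h.posSemidef⟩
  obtain ⟨T, hT, -⟩ := h.exists_linearIsometry
  refine ⟨hp, ContinuousLinearMap.adjoint T.toContinuousLinearMap F, fun z => ?_⟩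
  have := RKHS.kerFun_inner z (1 : ℂ) (ContinuousLinearMap.adjoint T.toContinuousLinearMap F)
  rw [ContinuousLinearMap.adjoint_inner_right, LinearIsometry.coe_toContinuousLinearMap, hT,
    hF] at this
  simpa using this.symm

/-- Evaluations are weakly continuous, so a weak cluster point of the `F n` represents `f`. Limits
of polynomials enter `H(b)` in this way. -/
theorem mem_of_tendsto [CompleteSpace E] (h : IsKernelModel b v) {f : ℂ → ℂ} {F : ℕ → E} {C : ℝ}
    (hC : ∀ n, ‖F n‖ ≤ C)
    (hF : ∀ z : Complex.UnitDisc, Tendsto (fun n => inner ℂ (v z) (F n)) atTop (𝓝 (f z))) :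
    f ∈ deBrangesRovnyak b := by
  obtain ⟨y, U, hU, hy⟩ := exists_ultrafilter_tendsto_inner hC
  refine h.mem_of_inner_eq (F := y) fun z => ?_
  refine tendsto_nhds_unique ?_ ((hF z).mono_left hU)
  have := (Complex.continuous_conj.tendsto _).comp (hy (v z))
  simpa [Function.comp_def] using this

end IsKernelModel

/-! ### Bounded analytic functions and the Szegő kernel -/

theorem mem_hardyInfty_mul {F G : ℂ → ℂ} (hF : F ∈ hardyInfty) (hG : G ∈ hardyInfty) :
    (fun z => F z * G z) ∈ hardyInfty := by
  obtain ⟨hF, C, hC⟩ := hF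
  obtain ⟨hG, D, hD⟩ := hG
  refine ⟨hF.mul hG, C * D, fun z hz => ?_⟩
  rw [norm_mul]
  exact mul_le_mul (hC z hz) (hD z hz) (norm_nonneg _) ((norm_nonneg _).trans (hC z hz))

theorem pow_mem_hardyInfty (n : ℕ) : (fun z : ℂ => z ^ n) ∈ hardyInfty := by
  refine ⟨by fun_prop, 1, fun z hz => ?_⟩
  rw [norm_pow]
  exact pow_le_one₀ (norm_nonneg _) (by simpa using (mem_ball_zero_iff.1 hz).le)

theorem norm_hardyVec_le {F : ℂ → ℂ} (hF : DifferentiableOn ℂ F (ball 0 1)) {C : ℝ}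
    (hC : ∀ z ∈ ball (0 : ℂ) 1, ‖F z‖ ≤ C) : ‖hardyVec F‖ ≤ C := by
  have h2 : F ∈ hardyTwo := hardyInfty_subset_hardyTwo ⟨hF, C, hC⟩
  have hC0 : 0 ≤ C := (norm_nonneg _).trans (hC 0 (by simp))
  have := ((hasTaylor_hardyVec h2).summable_sq (C := C ^ 2) fun r h0 h1 => ?_).2
  · have e : ‖hardyVec F‖ ^ 2 = ∑' n, ‖hardyVec F n‖ ^ 2 := by
      have := lp.norm_rpow_eq_tsum (p := 2) (by norm_num) (hardyVec F)
      simpa using this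
    rw [← e] at this
    exact (sq_le_sq₀ (norm_nonneg _) hC0).1 this
  · have hs : ∀ z ∈ sphere (0 : ℂ) |r|, z ∈ ball (0 : ℂ) 1 := fun z hz => by
      rw [mem_sphere_zero_iff_norm, abs_of_pos h0] at hz
      simpa [hz] using h1
    refine Real.circleAverage_mono_on_of_le_circle ?_ fun z hz => ?_
    · exact ContinuousOn.circleIntegrable' (((hF.continuousOn.mono hs).norm).pow 2)
    · have := hC z (hs z hz)
      gcongr

/-- The Szegő kernel function at `w`. -/
noncomputable def szego (w z : ℂ) : ℂ := (1 - conj w * z)⁻¹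

theorem hasTaylor_szego {w : ℂ} (hw : w ∈ ball (0 : ℂ) 1) :
    HasTaylor (szego w) (fun n => conj w ^ n) := fun z hz => by
  have : ‖conj w * z‖ < 1 := by
    rw [norm_mul, Complex.norm_conj]
    exact mul_lt_one_of_nonneg_of_lt_one_left (norm_nonneg _) (mem_ball_zero_iff.1 hw)
      (mem_ball_zero_iff.1 hz).le
  simpa [mul_pow, szego] using hasSum_geometric_of_norm_lt_one this

theorem szego_mem_hardyInfty {w : ℂ} (hw : w ∈ ball (0 : ℂ) 1) : szego w ∈ hardyInfty := by
  refine ⟨(hasTaylor_szego hw).differentiableOn, (1 - ‖w‖)⁻¹, fun z hz => ?_⟩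
  have hw' : ‖w‖ < 1 := mem_ball_zero_iff.1 hw
  have hz' : ‖z‖ < 1 := mem_ball_zero_iff.1 hz
  rw [szego, norm_inv]
  refine inv_anti₀ (by linarith) ?_
  have h1 := norm_sub_norm_le (1 : ℂ) (conj w * z)
  rw [norm_one, norm_mul, Complex.norm_conj] at h1
  nlinarith [norm_nonneg w, norm_nonneg z]

theorem hasTaylor_inner_szego (x : HardySeq) :
    HasTaylor (fun w => inner ℂ (hardyVec (szego w)) x) x := fun w hw => by
  have h := lp.hasSum_inner (𝕜 := ℂ) (hardyVec (szego w)) x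
  refine h.of_eq fun n => ?_
  have := (hasTaylor_hardyVec (hardyInfty_subset_hardyTwo (szego_mem_hardyInfty hw))).unique
    (hasTaylor_szego hw)
  rw [this]
  simp

theorem inner_szego {F : ℂ → ℂ} (hF : F ∈ hardyTwo) {w : ℂ} (hw : w ∈ ball (0 : ℂ) 1) :
    inner ℂ (hardyVec (szego w)) (hardyVec F) = F w :=
  (hasTaylor_inner_szego _ w hw).unique (hasTaylor_hardyVec hF w hw)

/-! ### Isometric pairs -/

/-- A pair of bounded analytic functions `a`, `b` with `|a|² + |b|² = 1` on the unit circle in the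
weak sense, such that `a` has no zeros in the disk and `a H^∞` is dense in `H²`. -/
structure IsOuterPair (a b : ℂ → ℂ) : Prop where
  left_mem : a ∈ hardyInfty
  right_mem : b ∈ hardyInfty
  ne_zero : ∀ z ∈ ball (0 : ℂ) 1, a z ≠ 0
  inner_add : ∀ p ∈ hardyInfty, ∀ q ∈ hardyInfty,
    inner ℂ (hardyVec fun z => a z * p z) (hardyVec fun z => a z * q z) +
      inner ℂ (hardyVec fun z => b z * p z) (hardyVec fun z => b z * q z) =
      inner ℂ (hardyVec p) (hardyVec q)
  eq_zero : ∀ x : HardySeq, (∀ q ∈ hardyInfty, inner ℂ (hardyVec fun z => a z * q z) x = 0) → x = 0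

theorem circleMap_mem_ball {r θ : ℝ} (hr : r ∈ Set.Ioo (0 : ℝ) 1) :
    circleMap 0 r θ ∈ ball (0 : ℂ) 1 := by
  simp [abs_of_pos hr.1, hr.2]

theorem continuous_comp_circleMap {F : ℂ → ℂ} (hF : ContinuousOn F (ball 0 1)) {r : ℝ}
    (hr : r ∈ Set.Ioo (0 : ℝ) 1) : Continuous fun θ => F (circleMap 0 r θ) :=
  hF.comp_continuous (continuous_circleMap 0 r) fun _ => circleMap_mem_ball hr

/-- On a circle of radius `r < 1`, the two sides differ by the mean of `(|a|² + |b|² - 1) q conj p`,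
which tends to `0` by dominated convergence. Boundary values are needed only for `a` and `b`; for
`p` and `q` boundedness is enough. -/
theorem inner_add_inner_of_boundary {a b : ℂ → ℂ} (ha : a ∈ hardyInfty) (hb : b ∈ hardyInfty)
    {u v : ℝ → ℂ} (hu : HasBoundaryFunction a u) (hv : HasBoundaryFunction b v)
    (huv : ∀ᵐ θ : ℝ, ‖u θ‖ ^ 2 + ‖v θ‖ ^ 2 = 1) {p q : ℂ → ℂ} (hp : p ∈ hardyInfty)
    (hq : q ∈ hardyInfty) :
    inner ℂ (hardyVec fun z => a z * p z) (hardyVec fun z => a z * q z) +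
      inner ℂ (hardyVec fun z => b z * p z) (hardyVec fun z => b z * q z) =
      inner ℂ (hardyVec p) (hardyVec q) := by
  have H2 := hardyInfty_subset_hardyTwo
  have h1 := ((tendsto_circleAverage_inner (H2 (mem_hardyInfty_mul ha hq))
    (H2 (mem_hardyInfty_mul ha hp))).add (tendsto_circleAverage_inner
      (H2 (mem_hardyInfty_mul hb hq)) (H2 (mem_hardyInfty_mul hb hp)))).sub
      (tendsto_circleAverage_inner (H2 hq) (H2 hp))
  rw [← sub_eq_zero]
  refine tendsto_nhds_unique h1 ?_
  obtain ⟨ha, A, hA⟩ := ha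
  obtain ⟨hb, B, hB⟩ := hb
  obtain ⟨hp, P, hP⟩ := hp
  obtain ⟨hq, Q, hQ⟩ := hq
  have key : Tendsto (fun r : ℝ => ∫ θ in (0 : ℝ)..2 * Real.pi,
      ((‖a (circleMap 0 r θ)‖ ^ 2 + ‖b (circleMap 0 r θ)‖ ^ 2 - 1 : ℝ) : ℂ) *
        (q (circleMap 0 r θ) * conj (p (circleMap 0 r θ)))) (𝓝[<] 1)
      (𝓝 (∫ θ in (0 : ℝ)..2 * Real.pi, 0)) := by
    refine intervalIntegral.tendsto_integral_filter_of_dominated_convergence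
      (fun _ => (A ^ 2 + B ^ 2 + 1) * (Q * P)) ?_ ?_ intervalIntegrable_const ?_
    · filter_upwards [Ioo_mem_nhdsLT (show (0 : ℝ) < 1 by norm_num)] with r hr
      have ha := continuous_comp_circleMap ha.continuousOn hr
      have hb := continuous_comp_circleMap hb.continuousOn hr
      have hp := continuous_comp_circleMap hp.continuousOn hr
      have hq := continuous_comp_circleMap hq.continuousOn hr
      exact ((Complex.continuous_ofReal.comp (((ha.norm.pow 2).add (hb.norm.pow 2)).sub
        continuous_const)).mul (hq.mul (Complex.continuous_conj.comp hp))).aestronglyMeasurable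
    · filter_upwards [Ioo_mem_nhdsLT (show (0 : ℝ) < 1 by norm_num)] with r hr
      refine .of_forall fun θ _ => ?_
      have hz := circleMap_mem_ball (θ := θ) hr
      have h1 := hA _ hz
      have h2 := hB _ hz
      have h3 := hP _ hz
      have h4 := hQ _ hz
      rw [norm_mul, norm_mul, Complex.norm_conj, Complex.norm_real]
      have h5 : ‖‖a (circleMap 0 r θ)‖ ^ 2 + ‖b (circleMap 0 r θ)‖ ^ 2 - 1‖ ≤ A ^ 2 + B ^ 2 + 1 := by
        rw [Real.norm_eq_abs, abs_le]
        have := pow_le_pow_left₀ (norm_nonneg _) h1 2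
        have := pow_le_pow_left₀ (norm_nonneg _) h2 2
        constructor <;> nlinarith [sq_nonneg ‖a (circleMap 0 r θ)‖, sq_nonneg ‖b (circleMap 0 r θ)‖]
      have : 0 ≤ Q := (norm_nonneg _).trans h4
      gcongr
    · filter_upwards [hu, hv, huv] with θ h1 h2 h3 _
      have hab : Tendsto (fun r : ℝ => ‖a (circleMap 0 r θ)‖ ^ 2 + ‖b (circleMap 0 r θ)‖ ^ 2 - 1)
          (𝓝[<] 1) (𝓝 0) := by
        have := ((h1.norm.pow 2).add (h2.norm.pow 2)).sub_const 1
        rwa [h3, sub_self] at this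
      refine squeeze_zero_norm' (a := fun r : ℝ =>
        ‖‖a (circleMap 0 r θ)‖ ^ 2 + ‖b (circleMap 0 r θ)‖ ^ 2 - 1‖ * (Q * P)) ?_ ?_
      · filter_upwards [Ioo_mem_nhdsLT (show (0 : ℝ) < 1 by norm_num)] with r hr
        have hz := circleMap_mem_ball (θ := θ) hr
        have h3 := hP _ hz
        have h4 := hQ _ hz
        have : 0 ≤ Q := (norm_nonneg _).trans h4
        rw [norm_mul, norm_mul, Complex.norm_conj, Complex.norm_real]
        gcongr
      · simpa using hab.norm.mul_const (Q * P)
  have key2 := key.const_smul ((2 * Real.pi)⁻¹)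
  simp only [intervalIntegral.integral_zero, smul_zero] at key2
  refine key2.congr' ?_
  filter_upwards [Ioo_mem_nhdsLT (show (0 : ℝ) < 1 by norm_num)] with r hr
  have ha := continuous_comp_circleMap ha.continuousOn hr
  have hb := continuous_comp_circleMap hb.continuousOn hr
  have hp := continuous_comp_circleMap hp.continuousOn hr
  have hq := continuous_comp_circleMap hq.continuousOn hr
  simp only [Real.circleAverage]
  have ca := (ha.mul hq).mul (Complex.continuous_conj.comp (ha.mul hp))
  have cb := (hb.mul hq).mul (Complex.continuous_conj.comp (hb.mul hp))
  rw [← smul_add, ← smul_sub, ← intervalIntegral.integral_add, ← intervalIntegral.integral_sub]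
  rotate_left
  · exact (ca.add cb).intervalIntegrable _ _
  · exact (hq.mul (Complex.continuous_conj.comp hp)).intervalIntegrable _ _
  · exact ca.intervalIntegrable _ _
  · exact cb.intervalIntegrable _ _
  congr 1
  refine intervalIntegral.integral_congr fun θ _ => ?_
  have e1 := Complex.mul_conj (a (circleMap 0 r θ))
  have e2 := Complex.mul_conj (b (circleMap 0 r θ))
  rw [Complex.normSq_eq_norm_sq] at e1 e2
  simp only [map_mul]
  push_cast at e1 e2 ⊢
  rw [← e1, ← e2]
  ring

/-! ### Herglotz integrals and outer functions -/

theorem IntervalIntegrable.complex_ofReal {L : ℝ → ℝ} {α β : ℝ}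
    (hL : IntervalIntegrable L volume α β) :
    IntervalIntegrable (fun θ => (L θ : ℂ)) volume α β := by
  rw [intervalIntegrable_iff] at hL ⊢
  exact hL.ofReal

/-- The Herglotz integral of a function of the angle. -/
noncomputable def herglotz (L : ℝ → ℝ) (z : ℂ) : ℂ :=
  (2 * (Real.pi : ℂ))⁻¹ * ∫ θ in (0 : ℝ)..(2 * Real.pi),
    (circleMap 0 1 θ + z) / (circleMap 0 1 θ - z) * (L θ : ℂ)

/-- The function on the unit circle with the given values on the angles in `[0, 2π)`. -/
noncomputable def ofAngle (L : ℝ → ℝ) (ζ : ℂ) : ℝ :=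
  L (toIcoMod Real.two_pi_pos 0 ζ.arg)

theorem ofAngle_circleMap (L : ℝ → ℝ) {θ : ℝ} (hθ : θ ∈ Set.Ico 0 (2 * Real.pi)) :
    ofAngle L (circleMap 0 1 θ) = L θ := by
  rw [ofAngle, circleMap]
  congr 1
  simp only [Complex.ofReal_one, one_mul, zero_add]
  rw [Complex.arg_exp_mul_I, toIcoMod_toIocMod]
  rw [toIcoMod_eq_self]
  simpa using hθ

/-- Interval integrals run over `(0, 2π]`, while `ofAngle` normalises angles to `[0, 2π)`; the
endpoint is a null set. -/
theorem ae_mem_Ico : ∀ᵐ θ : ℝ, θ ∈ Set.uIoc 0 (2 * Real.pi) → θ ∈ Set.Ico 0 (2 * Real.pi) := by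
  have : ∀ᵐ θ : ℝ, θ ≠ 2 * Real.pi := by simp [ae_iff]
  filter_upwards [this] with θ h1 h2
  rw [Set.uIoc_of_le Real.two_pi_pos.le] at h2
  exact ⟨h2.1.le, lt_of_le_of_ne h2.2 h1⟩

theorem intervalIntegrable_ofAngle {L : ℝ → ℝ} (hL : IntervalIntegrable L volume 0 (2 * Real.pi)) :
    CircleIntegrable (fun ζ => (ofAngle L ζ : ℂ)) 0 1 := by
  have : IntervalIntegrable (fun θ => (L θ : ℂ)) volume 0 (2 * Real.pi) := hL.complex_ofReal
  refine this.congr_ae ?_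
  rw [EventuallyEq, ae_restrict_iff' measurableSet_uIoc]
  filter_upwards [ae_mem_Ico] with θ h1 h2
  rw [ofAngle_circleMap L (h1 h2)]

theorem herglotz_eq_circleAverage (L : ℝ → ℝ) (z : ℂ) :
    herglotz L z =
      Real.circleAverage (fun ζ => herglotzRieszKernel 0 z ζ • (ofAngle L ζ : ℂ)) 0 1 := by
  rw [herglotz, Real.circleAverage, Complex.real_smul]
  push_cast
  congr 1
  refine intervalIntegral.integral_congr_ae ?_
  filter_upwards [ae_mem_Ico] with θ h1 h2
  rw [ofAngle_circleMap L (h1 h2)]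
  simp [herglotzRieszKernel]

theorem differentiableOn_herglotz {L : ℝ → ℝ}
    (hL : IntervalIntegrable L volume 0 (2 * Real.pi)) :
    DifferentiableOn ℂ (herglotz L) (ball 0 1) := by
  rw [show herglotz L = _ from funext (herglotz_eq_circleAverage L)]
  exact differentiableOn_circleAverage_herglotzRieszKernel_smul (intervalIntegrable_ofAngle hL)

theorem continuous_herglotzKernel {z : ℂ} (hz : z ∈ ball (0 : ℂ) 1) :
    Continuous fun θ : ℝ => (circleMap 0 1 θ + z) / (circleMap 0 1 θ - z) := by
  refine Continuous.div (by fun_prop) (by fun_prop) fun θ h => ?_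
  rw [sub_eq_zero] at h
  rw [← h] at hz
  simp at hz

theorem intervalIntegrable_herglotzKernel_mul {z : ℂ} (hz : z ∈ ball (0 : ℂ) 1) {L : ℝ → ℝ}
    (hL : IntervalIntegrable L volume 0 (2 * Real.pi)) :
    IntervalIntegrable (fun θ => (circleMap 0 1 θ + z) / (circleMap 0 1 θ - z) * (L θ : ℂ)) volume
      0 (2 * Real.pi) :=
  IntervalIntegrable.continuousOn_mul hL.complex_ofReal (continuous_herglotzKernel hz).continuousOn

theorem herglotz_add {L M : ℝ → ℝ} (hL : IntervalIntegrable L volume 0 (2 * Real.pi))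
    (hM : IntervalIntegrable M volume 0 (2 * Real.pi)) {z : ℂ} (hz : z ∈ ball (0 : ℂ) 1) :
    herglotz (fun θ => L θ + M θ) z = herglotz L z + herglotz M z := by
  rw [herglotz, herglotz, herglotz, ← mul_add, ← intervalIntegral.integral_add
    (intervalIntegrable_herglotzKernel_mul hz hL) (intervalIntegrable_herglotzKernel_mul hz hM)]
  congr 2
  ext θ
  push_cast
  ring

theorem re_herglotz {L : ℝ → ℝ} (hL : IntervalIntegrable L volume 0 (2 * Real.pi)) {z : ℂ}
    (hz : z ∈ ball (0 : ℂ) 1) : (herglotz L z).re = (2 * Real.pi)⁻¹ *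
      ∫ θ in (0 : ℝ)..(2 * Real.pi), poissonKernel 0 z (circleMap 0 1 θ) * L θ := by
  have h1 := Complex.reCLM.intervalIntegral_comp_comm (intervalIntegrable_herglotzKernel_mul hz hL)
  have e : (2 * (Real.pi : ℂ))⁻¹ = (((2 * Real.pi)⁻¹ : ℝ) : ℂ) := by push_cast; rfl
  rw [herglotz, e, Complex.re_ofReal_mul, ← Complex.reCLM_apply, ← h1]
  congr 2
  ext θ
  rw [poissonKernel_eq_re_herglotzRieszKernel]
  simp [herglotzRieszKernel]

theorem poissonKernel_pos {z : ℂ} (hz : z ∈ ball (0 : ℂ) 1) (θ : ℝ) :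
    0 < poissonKernel 0 z (circleMap 0 1 θ) := by
  have hz' : ‖z‖ < 1 := by simpa using hz
  rw [poissonKernel]
  refine div_pos ?_ ?_
  · simp only [sub_zero, norm_circleMap_zero, abs_one, one_pow]
    nlinarith [norm_nonneg z]
  · have : circleMap 0 1 θ - z ≠ 0 := fun h => by
      rw [sub_eq_zero] at h
      rw [← h] at hz'
      simp at hz'
    have := norm_pos_iff.2 this
    simp only [sub_zero]
    positivity

theorem continuous_poissonKernel {z : ℂ} (hz : z ∈ ball (0 : ℂ) 1) :
    Continuous fun θ : ℝ => poissonKernel 0 z (circleMap 0 1 θ) := by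
  rw [poissonKernel_eq_re_herglotzRieszKernel]
  simpa [Function.comp_def, herglotzRieszKernel] using
    Complex.continuous_re.comp (continuous_herglotzKernel hz)

theorem integral_poissonKernel {z : ℂ} (hz : z ∈ ball (0 : ℂ) 1) :
    (2 * Real.pi)⁻¹ * ∫ θ in (0 : ℝ)..(2 * Real.pi), poissonKernel 0 z (circleMap 0 1 θ) = 1 := by
  have h := (differentiable_const (1 : ℂ) : Differentiable ℂ fun _ : ℂ => (1 : ℂ)).diffContOnCl
    (s := ball 0 1) |>.circleAverage_poissonKernel_smul hz
  have e : (poissonKernel 0 z • fun _ : ℂ => (1 : ℂ)) =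
      fun ζ => ((poissonKernel 0 z ζ : ℝ) : ℂ) := by ext; simp
  rw [e, circleAverage_ofReal] at h
  rw [Real.circleAverage, smul_eq_mul] at h
  exact_mod_cast h

/-- The real part is a Poisson integral, that is, an average with positive weights of total mass
one. -/
theorem re_herglotz_le {L : ℝ → ℝ} (hL : IntervalIntegrable L volume 0 (2 * Real.pi)) {m : ℝ}
    (hm : ∀ᵐ θ : ℝ, L θ ≤ m) {z : ℂ} (hz : z ∈ ball (0 : ℂ) 1) : (herglotz L z).re ≤ m := by
  rw [re_herglotz hL hz]
  have hc := (continuous_poissonKernel hz)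
  calc _ ≤ (2 * Real.pi)⁻¹ *
      ∫ θ in (0 : ℝ)..(2 * Real.pi), poissonKernel 0 z (circleMap 0 1 θ) * m := by
        refine mul_le_mul_of_nonneg_left ?_ (by positivity)
        refine intervalIntegral.integral_mono_ae Real.two_pi_pos.le
          (hL.continuousOn_mul hc.continuousOn) ((hc.mul continuous_const).intervalIntegrable _ _)
          ?_
        filter_upwards [hm] with θ h
        exact mul_le_mul_of_nonneg_left h (poissonKernel_pos hz θ).le
    _ = m := by
        rw [intervalIntegral.integral_mul_const, ← mul_assoc, integral_poissonKernel hz, one_mul]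

theorem tendsto_herglotz {L : ℕ → ℝ → ℝ} {M : ℝ → ℝ}
    (hM : IntervalIntegrable M volume 0 (2 * Real.pi))
    (hLm : ∀ n, IntervalIntegrable (L n) volume 0 (2 * Real.pi))
    (hL : ∀ n θ, |L n θ| ≤ |M θ|) (hL0 : ∀ θ, Tendsto (fun n => L n θ) atTop (𝓝 0)) {z : ℂ}
    (hz : z ∈ ball (0 : ℂ) 1) : Tendsto (fun n => herglotz (L n) z) atTop (𝓝 0) := by
  have key : Tendsto (fun n => ∫ θ in (0 : ℝ)..(2 * Real.pi),
      (circleMap 0 1 θ + z) / (circleMap 0 1 θ - z) * (L n θ : ℂ)) atTop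
      (𝓝 (∫ θ in (0 : ℝ)..(2 * Real.pi), 0)) := by
    refine intervalIntegral.tendsto_integral_filter_of_dominated_convergence
      (fun θ => ‖(circleMap 0 1 θ + z) / (circleMap 0 1 θ - z) * (M θ : ℂ)‖) ?_ ?_
      (intervalIntegrable_herglotzKernel_mul hz hM).norm ?_
    · exact .of_forall fun n =>
        (intervalIntegrable_iff.1 (intervalIntegrable_herglotzKernel_mul hz (hLm n))).1
    · refine .of_forall fun n => .of_forall fun θ _ => ?_
      rw [norm_mul, norm_mul, Complex.norm_real, Complex.norm_real]
      exact mul_le_mul_of_nonneg_left (hL n θ) (norm_nonneg _)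
    · refine .of_forall fun θ _ => ?_
      have := ((Complex.continuous_ofReal.tendsto _).comp (hL0 θ)).const_mul
        ((circleMap 0 1 θ + z) / (circleMap 0 1 θ - z))
      simpa [Function.comp_def] using this
  have := key.const_mul (2 * (Real.pi : ℂ))⁻¹
  simpa [herglotz] using this

theorem hasTaylor_monomial (j : ℕ) (c : ℂ) :
    HasTaylor (fun z => c * z ^ j) (Pi.single j c : ℕ → ℂ) := fun z _ => by
  have := hasSum_single (f := fun n => (Pi.single j c : ℕ → ℂ) n * z ^ n) j (fun n hn => by
    simp [hn])
  simpa using this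

/-- For a bounded analytic function `a` such that some functions `a g_n` are bounded by `1` and
converge to a nonzero constant, `a H^∞` is dense in `H²`. -/
theorem eq_zero_of_inner_eq_zero {a : ℂ → ℂ} {g : ℕ → ℂ → ℂ} {c : ℂ} (hc : c ≠ 0)
    (ha : DifferentiableOn ℂ a (ball 0 1)) (hg : ∀ n, g n ∈ hardyInfty)
    (hag : ∀ n, ∀ z ∈ ball (0 : ℂ) 1, ‖a z * g n z‖ ≤ 1)
    (hlim : ∀ z ∈ ball (0 : ℂ) 1, Tendsto (fun n => a z * g n z) atTop (𝓝 c)) {x : HardySeq}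
    (hx : ∀ q ∈ hardyInfty, inner ℂ (hardyVec fun z => a z * q z) x = 0) : x = 0 := by
  ext j
  -- These functions are bounded in `H²`. Pairing with Szegő kernels identifies their weak limit as
  -- `c z^j`; it is orthogonal to `x`, so the coefficient of index `j` of `x` vanishes.
  let F : ℕ → ℂ → ℂ := fun n z => a z * (g n z * z ^ j)
  have hFd : ∀ n, DifferentiableOn ℂ (F n) (ball 0 1) := fun n =>
    ha.mul ((hg n).1.mul (by fun_prop))
  have hFb : ∀ n, ∀ z ∈ ball (0 : ℂ) 1, ‖F n z‖ ≤ 1 := fun n z hz => by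
    simp only [F]
    rw [← mul_assoc, norm_mul]
    refine mul_le_one₀ (hag n z hz) (norm_nonneg _) ?_
    rw [norm_pow]
    exact pow_le_one₀ (norm_nonneg _) (mem_ball_zero_iff.1 hz).le
  have hF2 : ∀ n, F n ∈ hardyTwo := fun n => hardyInfty_subset_hardyTwo ⟨hFd n, 1, hFb n⟩
  obtain ⟨y, U, hU, hy⟩ := exists_ultrafilter_tendsto_inner (x := fun n => hardyVec (F n))
    (fun n => norm_hardyVec_le (hFd n) (hFb n))
  have hyT : HasTaylor (fun z => c * z ^ j) y := by
    refine (hasTaylor_inner_szego y).congr fun w hw => ?_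
    have h1 := (Complex.continuous_conj.tendsto _).comp (hy (hardyVec (szego w)))
    simp only [Function.comp_def, inner_conj_symm] at h1
    refine tendsto_nhds_unique h1 ?_
    simp only [inner_szego (hF2 _) hw]
    simp only [F, ← mul_assoc]
    exact ((hlim w hw).mul_const _).mono_left hU
  have hyx : inner ℂ y x = 0 := by
    refine tendsto_nhds_unique (hy x) ?_
    have : ∀ n, inner ℂ (hardyVec (F n)) x = 0 := fun n =>
      hx _ (mem_hardyInfty_mul (hg n) (pow_mem_hardyInfty j))
    simp only [this]
    exact tendsto_const_nhds
  have hyj := hyT.unique (hasTaylor_monomial j c)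
  have := lp.hasSum_inner (𝕜 := ℂ) y x
  rw [hyx, hyj] at this
  have h2 := this.unique (hasSum_single j fun n hn => by simp [hn])
  simpa [hc] using h2.symm

theorem HasBoundaryFunction.unique {f : ℂ → ℂ} {u v : ℝ → ℂ} (hu : HasBoundaryFunction f u)
    (hv : HasBoundaryFunction f v) : u =ᵐ[volume] v := by
  filter_upwards [hu, hv] with θ h1 h2
  exact tendsto_nhds_unique h1 h2

theorem IsPythagoreanMate.isOuterPair {a b : ℂ → ℂ} (hb : DifferentiableOn ℂ b (ball 0 1))
    (hbD : Set.MapsTo b (ball 0 1) (ball 0 1)) (hab : IsPythagoreanMate a b) :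
    IsOuterPair a b := by
  obtain ⟨⟨ha, u, hu, hu0, hL, c, hc, hac⟩, u', v, hu', hv, huv⟩ := hab
  set L : ℝ → ℝ := fun θ => Real.log ‖u θ‖ with hLdef
  have hc0 : c ≠ 0 := by rintro rfl; simp at hc
  have hac : ∀ z ∈ ball (0 : ℂ) 1, a z = c * Complex.exp (herglotz L z) := hac
  have huv : ∀ᵐ θ : ℝ, ‖u θ‖ ^ 2 + ‖v θ‖ ^ 2 = 1 := by
    filter_upwards [huv, hu.unique hu'] with θ h1 h2
    rw [h2, h1]
  have hL0 : ∀ᵐ θ : ℝ, L θ ≤ 0 := by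
    filter_upwards [huv] with θ h
    refine Real.log_nonpos (norm_nonneg _) ?_
    nlinarith [sq_nonneg ‖v θ‖, norm_nonneg (u θ)]
  have ha1 : a ∈ hardyInfty := by
    refine ⟨ha, 1, fun z hz => ?_⟩
    rw [hac z hz, norm_mul, hc, one_mul, Complex.norm_exp, Real.exp_le_one_iff]
    exact re_herglotz_le hL hL0 hz
  have hb1 : b ∈ hardyInfty := ⟨hb, 1, fun z hz => (mem_ball_zero_iff.1 (hbD hz)).le⟩
  refine ⟨ha1, hb1, fun z hz => ?_, fun p hp q hq =>
    inner_add_inner_of_boundary ha1 hb1 hu hv huv hp hq, ?_⟩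
  · rw [hac z hz]
    exact mul_ne_zero hc0 (Complex.exp_ne_zero _)
  -- `W n` is minus `log |a|` truncated below at `-n`, so the exponential of its Herglotz integral
  -- is bounded by `exp n`. The sum `L + W n = min 0 (L + n)` is nonpositive, dominated by `|L|` and
  -- tends to `0`; hence the products with `a` are bounded by `1` and converge to `c`.
  let W : ℕ → ℝ → ℝ := fun n θ => -max (L θ) (-n)
  have hW : ∀ n, IntervalIntegrable (W n) volume 0 (2 * Real.pi) := fun n => by
    rw [intervalIntegrable_iff] at hL ⊢
    refine (Integrable.sup hL ?_).neg
    exact integrableOn_const (by simp [Set.uIoc])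
  have hLW : ∀ n, IntervalIntegrable (fun θ => L θ + W n θ) volume 0 (2 * Real.pi) :=
    fun n => hL.add (hW n)
  have hag : ∀ n, ∀ z ∈ ball (0 : ℂ) 1, a z * Complex.exp (herglotz (W n) z) =
      c * Complex.exp (herglotz (fun θ => L θ + W n θ) z) := fun n z hz => by
    rw [hac z hz, herglotz_add hL (hW n) hz, Complex.exp_add, mul_assoc]
  intro x hx
  refine eq_zero_of_inner_eq_zero (g := fun n z => Complex.exp (herglotz (W n) z)) hc0 ha
    (fun n => ?_) (fun n z hz => ?_) (fun z hz => ?_) hx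
  · refine ⟨(differentiableOn_herglotz (hW n)).cexp, Real.exp n, fun z hz => ?_⟩
    rw [Complex.norm_exp, Real.exp_le_exp]
    refine re_herglotz_le (hW n) (.of_forall fun θ => ?_) hz
    have := le_max_right (L θ) (-n)
    simp only [W]; linarith
  · rw [hag n z hz, norm_mul, hc, one_mul, Complex.norm_exp, Real.exp_le_one_iff]
    refine re_herglotz_le (hLW n) (.of_forall fun θ => ?_) hz
    have := le_max_left (L θ) (-n)
    simp only [W]; linarith
  · simp only [hag _ z hz]
    have h0 := tendsto_herglotz (L := fun n θ => L θ + W n θ) hL hLW (fun n θ => ?_)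
      (fun θ => ?_) hz
    · have := ((Complex.continuous_exp.tendsto _).comp h0).const_mul c
      simpa [Function.comp_def] using this
    · simp only [W]
      rcases le_total (L θ) (-n) with h | h
      · rw [max_eq_right h]
        have : (0 : ℝ) ≤ n := Nat.cast_nonneg n
        rw [abs_of_nonpos (by linarith), abs_of_nonpos (by linarith)]
        linarith
      · rw [max_eq_left h]
        simp
    · refine tendsto_const_nhds.congr' ?_
      filter_upwards [eventually_ge_atTop ⌈-L θ⌉₊] with n hn
      have : -L θ ≤ n := (Nat.le_ceil _).trans (by exact_mod_cast hn)
      simp only [W]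
      rw [max_eq_left (by linarith)]
      ring

/-! ### The model of `H(b)` attached to a Pythagorean pair -/

/-- The vector representing the kernel function at `w`. -/
noncomputable def modelVec (a b : ℂ → ℂ) (w : Complex.UnitDisc) :
    WithLp 2 (HardySeq × HardySeq) :=
  WithLp.toLp 2 (hardyVec (szego w) - conj (b w) • hardyVec fun z => b z * szego w z,
    conj (b w) • hardyVec fun z => a z * szego w z)

theorem modelVec_fst (a b : ℂ → ℂ) (w : Complex.UnitDisc) : (modelVec a b w).fst =
    hardyVec (szego w) - conj (b w) • hardyVec fun z => b z * szego w z := rfl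

theorem modelVec_snd (a b : ℂ → ℂ) (w : Complex.UnitDisc) : (modelVec a b w).snd =
    conj (b w) • hardyVec fun z => a z * szego w z := rfl

theorem unitDisc_mem_ball (w : Complex.UnitDisc) : (w : ℂ) ∈ ball (0 : ℂ) 1 := by
  simpa using w.norm_lt_one

/-! ### Polynomials and the co-analytic Toeplitz operator. -/

/-- The vector of coefficients of a polynomial. -/
noncomputable def polyVec (p : Polynomial ℂ) : HardySeq := hardyVec fun z => p.eval z

theorem hasTaylor_eval (p : Polynomial ℂ) : HasTaylor (fun z => p.eval z) p.coeff := fun z _ => by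
  simp only [Polynomial.eval_eq_sum, Polynomial.sum]
  refine hasSum_sum_of_ne_finset_zero fun n hn => ?_
  simp [Polynomial.notMem_support_iff.1 hn]

theorem eval_mem_hardyInfty (p : Polynomial ℂ) : (fun z => p.eval z) ∈ hardyInfty := by
  refine ⟨p.differentiable.differentiableOn, ?_⟩
  obtain ⟨C, hC⟩ := (isCompact_closedBall (0 : ℂ) 1).exists_bound_of_continuousOn
    p.continuous.continuousOn
  exact ⟨C, fun z hz => hC z (ball_subset_closedBall hz)⟩

theorem polyVec_apply (p : Polynomial ℂ) (n : ℕ) : polyVec p n = p.coeff n := by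
  have := (hasTaylor_hardyVec (hardyInfty_subset_hardyTwo (eval_mem_hardyInfty p))).unique
    (hasTaylor_eval p)
  exact congrFun this n

theorem polyVec_add (p q : Polynomial ℂ) : polyVec (p + q) = polyVec p + polyVec q := by
  ext n
  simp [polyVec_apply]

theorem polyVec_smul (c : ℂ) (p : Polynomial ℂ) : polyVec (c • p) = c • polyVec p := by
  ext n
  simp [polyVec_apply]

theorem inner_polyVec_monomial (x : HardySeq) (n : ℕ) (c : ℂ) :
    inner ℂ x (polyVec (Polynomial.monomial n c)) = c * conj (x n) := by
  have h := lp.hasSum_inner (𝕜 := ℂ) x (polyVec (Polynomial.monomial n c))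
  refine h.unique ?_
  have h2 := hasSum_single (f := fun m => inner ℂ (x m) (polyVec (Polynomial.monomial n c) m)) n
    fun m hm => by simp [polyVec_apply, Polynomial.coeff_monomial, hm.symm]
  simpa [polyVec_apply] using h2

/-- The polynomial `T_{conj φ} p`, where `φ` has Taylor coefficients `d`. -/
noncomputable def coanalyticToeplitz (d : ℕ → ℂ) : Polynomial ℂ →ₗ[ℂ] Polynomial ℂ :=
  Polynomial.lsum fun k => ∑ j ∈ Finset.range (k + 1),
    (Polynomial.monomial (k - j)).comp (LinearMap.lsmul ℂ ℂ (conj (d j)))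

theorem coanalyticToeplitz_monomial (d : ℕ → ℂ) (k : ℕ) (c : ℂ) :
    coanalyticToeplitz d (Polynomial.monomial k c) =
      ∑ j ∈ Finset.range (k + 1), Polynomial.monomial (k - j) (conj (d j) * c) := by
  simp [coanalyticToeplitz, Polynomial.lsum_apply, Polynomial.sum_monomial_index,
    LinearMap.sum_apply]

/-- `polyVec` as a linear map. -/
noncomputable def polyVecLin : Polynomial ℂ →ₗ[ℂ] HardySeq where
  toFun := polyVec
  map_add' := polyVec_add
  map_smul' := polyVec_smul

namespace IsOuterPair

variable {a b : ℂ → ℂ} {d : ℕ → ℂ}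

theorem smul_inner_szego {F : ℂ → ℂ} (hF : F ∈ hardyInfty) {w : ℂ} (hw : w ∈ ball (0 : ℂ) 1) :
    inner ℂ (hardyVec F) (hardyVec (szego w)) = conj (F w) := by
  rw [← inner_conj_symm, inner_szego (hardyInfty_subset_hardyTwo hF) hw]

/-- When `T_{conj b} F.fst = T_{conj a} F.snd`, the two terms carrying `b w` cancel and only the
reproducing property of the Szegő kernel remains. -/
theorem inner_modelVec_eq_of_intertwine {F : WithLp 2 (HardySeq × HardySeq)}
    (hF : ∀ q ∈ hardyInfty, inner ℂ (hardyVec fun z => b z * q z) F.fst =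
      inner ℂ (hardyVec fun z => a z * q z) F.snd) (w : Complex.UnitDisc) :
    inner ℂ (modelVec a b w) F = inner ℂ (hardyVec (szego w)) F.fst := by
  rw [WithLp.prod_inner_apply]
  simp only [modelVec, inner_sub_left, inner_smul_left]
  have := hF _ (szego_mem_hardyInfty (unitDisc_mem_ball w))
  rw [show (WithLp.ofLp F).1 = F.fst from rfl, show (WithLp.ofLp F).2 = F.snd from rfl, this]
  ring

/-- This is `|a|² + |b|² = 1` in its weak form `inner_add`, tested against `szego w`. -/
theorem intertwine_modelVec (h : IsOuterPair a b) (w : Complex.UnitDisc) {q : ℂ → ℂ}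
    (hq : q ∈ hardyInfty) : inner ℂ (hardyVec fun z => b z * q z) (modelVec a b w).fst =
      inner ℂ (hardyVec fun z => a z * q z) (modelVec a b w).snd := by
  have hw := unitDisc_mem_ball w
  have h1 := h.inner_add q hq _ (szego_mem_hardyInfty hw)
  simp only [modelVec_fst, modelVec_snd, inner_sub_right, inner_smul_right]
  rw [smul_inner_szego hq hw] at h1
  rw [smul_inner_szego (mem_hardyInfty_mul h.right_mem hq) hw, map_mul, ← h1]
  ring

/-- The relation is the vanishing of a continuous linear functional, so it passes from the kernel
vectors to their closed span. -/
theorem intertwine_of_mem (h : IsOuterPair a b) {F : WithLp 2 (HardySeq × HardySeq)}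
    (hF : F ∈ (Submodule.span ℂ (Set.range (modelVec a b))).topologicalClosure) {q : ℂ → ℂ}
    (hq : q ∈ hardyInfty) : inner ℂ (hardyVec fun z => b z * q z) F.fst =
      inner ℂ (hardyVec fun z => a z * q z) F.snd := by
  let ℓ : WithLp 2 (HardySeq × HardySeq) →L[ℂ] ℂ :=
    innerSL ℂ (WithLp.toLp 2 (hardyVec fun z => b z * q z, - hardyVec fun z => a z * q z))
  have hℓ : ∀ G, ℓ G = inner ℂ (hardyVec fun z => b z * q z) G.fst -
      inner ℂ (hardyVec fun z => a z * q z) G.snd := fun G => by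
    simp only [ℓ, innerSL_apply_apply, WithLp.prod_inner_apply, inner_neg_left]
    rfl
  rw [← sub_eq_zero, ← hℓ]
  have hle : (Submodule.span ℂ (Set.range (modelVec a b))).topologicalClosure ≤
      LinearMap.ker ℓ.toLinearMap := by
    refine Submodule.topologicalClosure_minimal _ (Submodule.span_le.2 ?_) ?_
    · rintro _ ⟨w, rfl⟩
      rw [SetLike.mem_coe, LinearMap.mem_ker]
      change ℓ _ = 0
      rw [hℓ, h.intertwine_modelVec w hq, sub_self]
    · exact ℓ.isClosed_ker
  exact hle hF

/-- As `modelVec a b w` satisfies the intertwining relation, its product with `modelVec a b z` is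
the value at `z` of its first component. -/
theorem isKernelModel (h : IsOuterPair a b) : IsKernelModel b (modelVec a b) := fun z w => by
  have hz := unitDisc_mem_ball z
  have hw := unitDisc_mem_ball w
  rw [inner_modelVec_eq_of_intertwine (fun q hq => h.intertwine_modelVec w hq)]
  simp only [modelVec_fst, inner_sub_right, inner_smul_right]
  rw [inner_szego (hardyInfty_subset_hardyTwo (szego_mem_hardyInfty hw)) hz,
    inner_szego (hardyInfty_subset_hardyTwo
      (mem_hardyInfty_mul h.right_mem (szego_mem_hardyInfty hw))) hz, szego]
  rw [div_eq_mul_inv]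
  ring

theorem hardyVec_mul_apply (h : IsOuterPair a b) (hd : HasTaylor (fun z => b z / a z) d)
    {q : ℂ → ℂ} (hq : q ∈ hardyInfty) (n : ℕ) : hardyVec (fun z => b z * q z) n =
      ∑ j ∈ Finset.range (n + 1), d j * hardyVec (fun z => a z * q z) (n - j) := by
  have h1 := hasTaylor_hardyVec (hardyInfty_subset_hardyTwo (mem_hardyInfty_mul h.right_mem hq))
  have h2 := hasTaylor_hardyVec (hardyInfty_subset_hardyTwo (mem_hardyInfty_mul h.left_mem hq))
  refine congrFun (h1.unique ((hd.mul h2).congr fun z hz => ?_)) n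
  have := h.ne_zero z hz
  simp only
  field_simp

/-- The identity `T_{conj b} p = T_{conj a} T_{conj φ} p` in weak form, read off from `b q = φ (a
q)`. It does not require `φ ∈ H²`, because a polynomial meets only finitely many coefficients of
`φ`; the necessity argument depends on this. -/
theorem intertwine_coanalyticToeplitz (h : IsOuterPair a b)
    (hd : HasTaylor (fun z => b z / a z) d) (p : Polynomial ℂ) {q : ℂ → ℂ}
    (hq : q ∈ hardyInfty) : inner ℂ (hardyVec fun z => b z * q z) (polyVec p) =
      inner ℂ (hardyVec fun z => a z * q z) (polyVec (coanalyticToeplitz d p)) := by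
  induction p using Polynomial.induction_on' with
  | add p q h1 h2 => rw [polyVec_add, inner_add_right, h1, h2, map_add, polyVec_add,
      inner_add_right]
  | monomial k c =>
    have e : polyVec (coanalyticToeplitz d (Polynomial.monomial k c)) =
        ∑ j ∈ Finset.range (k + 1), polyVec (Polynomial.monomial (k - j) (conj (d j) * c)) := by
      rw [coanalyticToeplitz_monomial]
      exact map_sum polyVecLin _ _
    rw [e, inner_sum, inner_polyVec_monomial, h.hardyVec_mul_apply hd hq, map_sum, Finset.mul_sum]
    refine Finset.sum_congr rfl fun j _ => ?_
    rw [inner_polyVec_monomial, map_mul]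
    ring

theorem inner_modelVec_polyVec (h : IsOuterPair a b) (hd : HasTaylor (fun z => b z / a z) d)
    (p : Polynomial ℂ) (w : Complex.UnitDisc) :
    inner ℂ (modelVec a b w) (WithLp.toLp 2 (polyVec p, polyVec (coanalyticToeplitz d p))) =
      p.eval (w : ℂ) := by
  rw [inner_modelVec_eq_of_intertwine fun q hq => h.intertwine_coanalyticToeplitz hd p hq]
  exact inner_szego (hardyInfty_subset_hardyTwo (eval_mem_hardyInfty p)) (unitDisc_mem_ball w)

end IsOuterPair

/-! ### Bounded Hankel forms -/

theorem inner_polyVec_monomial_left (x : HardySeq) (n : ℕ) (c : ℂ) :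
    inner ℂ (polyVec (Polynomial.monomial n c)) x = conj c * x n := by
  rw [← inner_conj_symm, inner_polyVec_monomial]
  simp

theorem inner_polyVec (p s : Polynomial ℂ) : inner ℂ (polyVec p) (polyVec s) =
    Real.circleAverage (fun z => conj (p.eval z) * s.eval z) 0 1 := by
  have h := tendsto_circleAverage_inner (hardyInfty_subset_hardyTwo (eval_mem_hardyInfty s))
    (hardyInfty_subset_hardyTwo (eval_mem_hardyInfty p))
  have hc : Continuous fun z : ℂ => s.eval z * conj (p.eval z) := by fun_prop
  have h2 := ((Real.Continuous.circleAverage (c := 0) hc).tendsto 1).mono_left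
    (nhdsWithin_le_nhds (s := Set.Iio (1 : ℝ)))
  refine (tendsto_nhds_unique h h2).trans ?_
  simp only [mul_comm]

theorem norm_polyVec_sq (p : Polynomial ℂ) : ‖polyVec p‖ ^ 2 =
    Real.circleAverage (fun z => ‖p.eval z‖ ^ 2) 0 1 := by
  have h := inner_polyVec p p
  simp only [Complex.conj_mul'] at h
  rw [inner_self_eq_norm_sq_to_K] at h
  simp only [← Complex.ofReal_pow] at h
  rw [circleAverage_ofReal] at h
  refine Complex.ofReal_injective ?_
  rw [← h]
  simp

/-- The Hankel form with symbol `p` is bounded by `C` on pairs of polynomials. -/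
def HankelBound (p : Polynomial ℂ) (C : ℝ) : Prop :=
  ∀ g h : Polynomial ℂ, ‖inner ℂ (polyVec p) (polyVec (g * h))‖ ≤ C * ‖polyVec g‖ * ‖polyVec h‖

theorem norm_polyVec_one : ‖polyVec 1‖ = 1 := by
  have := norm_polyVec_sq 1
  simp only [Polynomial.eval_one, norm_one, one_pow, Real.circleAverage_const] at this
  nlinarith [norm_nonneg (polyVec 1)]

theorem le_of_sq_le_mul {x C : ℝ} (hx : 0 ≤ x) (hC : 0 ≤ C) (h : x ^ 2 ≤ C * x) : x ≤ C := by
  rcases hx.eq_or_lt with h0 | h0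
  · rwa [← h0]
  · nlinarith

theorem HankelBound.nonneg {p : Polynomial ℂ} {C : ℝ} (h : HankelBound p C) : 0 ≤ C := by
  have := (norm_nonneg _).trans (h 1 1)
  simpa [norm_polyVec_one] using this

theorem HankelBound.norm_le {p : Polynomial ℂ} {C : ℝ} (h : HankelBound p C) :
    ‖polyVec p‖ ≤ C := by
  have h1 := h p 1
  rw [mul_one, norm_polyVec_one, mul_one, inner_self_eq_norm_sq_to_K] at h1
  refine le_of_sq_le_mul (norm_nonneg _) h.nonneg ?_
  simpa using h1

/-- The truncation of a power series to a polynomial. -/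
noncomputable def truncPoly (d : ℕ → ℂ) (N : ℕ) : Polynomial ℂ :=
  ∑ j ∈ Finset.range (N + 1), Polynomial.monomial j (d j)

theorem coeff_truncPoly (d : ℕ → ℂ) (N k : ℕ) :
    (truncPoly d N).coeff k = if k ≤ N then d k else 0 := by
  simp [truncPoly, Polynomial.coeff_monomial]

/-- The adjoint of `T_{conj φ}` is multiplication by `φ`. Coefficients of `φ` beyond the degree of
`p` are invisible to `p`, so the truncation is exact and the pair stays polynomial, as `HankelBound`
demands. -/
theorem inner_coanalyticToeplitz (d : ℕ → ℂ) (p s : Polynomial ℂ) :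
    inner ℂ (polyVec (coanalyticToeplitz d p)) (polyVec s) =
      inner ℂ (polyVec p) (polyVec (truncPoly d p.natDegree * s)) := by
  -- A truncation order `N` independent of the monomial is needed in order to sum over the monomials
  -- of `p`.
  suffices H : ∀ N k c, k ≤ N →
      inner ℂ (polyVec (coanalyticToeplitz d (Polynomial.monomial k c))) (polyVec s) =
        inner ℂ (polyVec (Polynomial.monomial k c)) (polyVec (truncPoly d N * s)) by
    have e1 : polyVec p = ∑ k ∈ p.support, polyVec (Polynomial.monomial k (p.coeff k)) := by
      conv_lhs => rw [p.as_sum_support]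
      exact map_sum polyVecLin _ _
    have e2 : polyVec (coanalyticToeplitz d p) = ∑ k ∈ p.support,
        polyVec (coanalyticToeplitz d (Polynomial.monomial k (p.coeff k))) := by
      conv_lhs => rw [p.as_sum_support]
      exact map_sum (polyVecLin.comp (coanalyticToeplitz d)) _ _
    rw [e1, e2, sum_inner, sum_inner]
    exact Finset.sum_congr rfl fun k hk =>
      H _ _ _ (Polynomial.le_natDegree_of_mem_supp k hk)
  intro N k c hk
  have e : polyVec (coanalyticToeplitz d (Polynomial.monomial k c)) =
      ∑ j ∈ Finset.range (k + 1), polyVec (Polynomial.monomial (k - j) (conj (d j) * c)) := by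
    rw [coanalyticToeplitz_monomial]
    exact map_sum polyVecLin _ _
  rw [e, sum_inner, inner_polyVec_monomial_left, polyVec_apply, Polynomial.coeff_mul,
    Finset.Nat.sum_antidiagonal_eq_sum_range_succ_mk, Finset.mul_sum]
  refine Finset.sum_congr rfl fun j hj => ?_
  have hj' : j ≤ N := by have := Finset.mem_range.1 hj; omega
  rw [inner_polyVec_monomial_left, polyVec_apply, coeff_truncPoly, if_pos hj']
  simp
  ring

theorem norm_polyVec_truncPoly_le {d : ℕ → ℂ} (hd : Summable fun n => ‖d n‖ ^ 2) (N : ℕ) :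
    ‖polyVec (truncPoly d N)‖ ≤ √(∑' n, ‖d n‖ ^ 2) := by
  refine Real.le_sqrt_of_sq_le ?_
  have e : ‖polyVec (truncPoly d N)‖ ^ 2 = ∑' n, ‖polyVec (truncPoly d N) n‖ ^ 2 := by
    have := lp.norm_rpow_eq_tsum (p := 2) (by norm_num) (polyVec (truncPoly d N))
    simpa using this
  rw [e]
  refine (memℓp_two_iff.1 (lp.memℓp _)).tsum_le_tsum (fun n => ?_) hd
  rw [polyVec_apply, coeff_truncPoly]
  split_ifs
  · rfl
  · simp

/-- With `t = T_{conj φ} p` and `φ_N` the truncation, the form at the pair `(φ_N, t)` equals `‖t‖²`,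
whence `‖t‖² ≤ C ‖φ_N‖ ‖t‖`. -/
theorem HankelBound.norm_coanalyticToeplitz_le {p : Polynomial ℂ} {C : ℝ} (h : HankelBound p C)
    {d : ℕ → ℂ} (hd : Summable fun n => ‖d n‖ ^ 2) :
    ‖polyVec (coanalyticToeplitz d p)‖ ≤ C * √(∑' n, ‖d n‖ ^ 2) := by
  have hC := h.nonneg
  refine le_of_sq_le_mul (norm_nonneg _) (by positivity) ?_
  have h1 := h (truncPoly d p.natDegree) (coanalyticToeplitz d p)
  rw [← inner_coanalyticToeplitz, inner_self_eq_norm_sq_to_K] at h1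
  have h2 : ‖polyVec (coanalyticToeplitz d p)‖ ^ 2 ≤ C * ‖polyVec (truncPoly d p.natDegree)‖ *
      ‖polyVec (coanalyticToeplitz d p)‖ := by simpa using h1
  refine h2.trans ?_
  gcongr
  exact norm_polyVec_truncPoly_le hd _

namespace IsOuterPair

variable {a b : ℂ → ℂ}

/-- A function approximated by polynomials with uniformly bounded Hankel forms lies in `H(b)` when
`b / a` is in `H²`. -/
theorem mem_of_hankelBound (h : IsOuterPair a b) (hφ : (fun z => b z / a z) ∈ hardyTwo)
    {f : ℂ → ℂ} {p : ℕ → Polynomial ℂ} {C : ℝ} (hp : ∀ n, HankelBound (p n) C)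
    (hf : ∀ z ∈ ball (0 : ℂ) 1, Tendsto (fun n => (p n).eval z) atTop (𝓝 (f z))) :
    f ∈ deBrangesRovnyak b := by
  obtain ⟨d, hd⟩ := exists_hasTaylor hφ.1
  have hs := hd.mem_hardyTwo_iff.1 hφ
  refine h.isKernelModel.mem_of_tendsto (F := fun n =>
    WithLp.toLp 2 (polyVec (p n), polyVec (coanalyticToeplitz d (p n))))
    (C := C + C * √(∑' n, ‖d n‖ ^ 2)) (fun n => ?_) fun z => ?_
  · have h1 := (hp n).norm_le
    have h2 := (hp n).norm_coanalyticToeplitz_le hs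
    have h3 := WithLp.prod_norm_sq_eq_of_L2
      (WithLp.toLp 2 (polyVec (p n), polyVec (coanalyticToeplitz d (p n))))
    have h4 := norm_nonneg (polyVec (p n))
    have h5 := norm_nonneg (polyVec (coanalyticToeplitz d (p n)))
    refine (sq_le_sq₀ (norm_nonneg _) (by linarith)).1 ?_
    rw [h3]
    change ‖polyVec (p n)‖ ^ 2 + ‖polyVec (coanalyticToeplitz d (p n))‖ ^ 2 ≤ _
    nlinarith
  · simp only [h.inner_modelVec_polyVec hd]
    exact hf z (unitDisc_mem_ball z)

/-! ### Necessity: consequences of the disk algebra lying in `H(b)`. -/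

theorem eq_of_inner_modelVec_eq {F G : WithLp 2 (HardySeq × HardySeq)}
    (hF : F ∈ (Submodule.span ℂ (Set.range (modelVec a b))).topologicalClosure)
    (hG : G ∈ (Submodule.span ℂ (Set.range (modelVec a b))).topologicalClosure)
    (h : ∀ w, inner ℂ (modelVec a b w) F = inner ℂ (modelVec a b w) G) : F = G := by
  set N := (Submodule.span ℂ (Set.range (modelVec a b))).topologicalClosure with hN
  rw [← sub_eq_zero]
  have h1 : F - G ∈ N := N.sub_mem hF hG
  have h2 : F - G ∈ Nᗮ := by
    rw [hN, Submodule.orthogonal_closure]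
    refine (Submodule.mem_orthogonal _ _).2 fun x hx => ?_
    induction hx using Submodule.span_induction with
    | mem x hx =>
      obtain ⟨w, rfl⟩ := hx
      rw [inner_sub_right, h, sub_self]
    | zero => simp
    | add x y _ _ hx hy => rw [inner_add_left, hx, hy, add_zero]
    | smul c x _ hx => rw [inner_smul_left, hx, mul_zero]
  exact inner_self_eq_zero.1 ((Submodule.mem_orthogonal _ _).1 h2 _ h1)

/-- The Wiener algebra `ℓ¹` stands in for the disk algebra in the closed graph argument: it is
visibly a Banach space, and its monomials have norm one. -/
theorem wiener_mem_diskAlgebra (x : lp (fun _ : ℕ => ℂ) 1) :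
    (fun z => ∑' n, x n * z ^ n) ∈ diskAlgebra ∧
      HasTaylor (fun z => ∑' n, x n * z ^ n) x := by
  have hx : Summable fun n => ‖x n‖ := by
    have := (memℓp_gen_iff (p := 1) (by norm_num)).1 (lp.memℓp x)
    simpa using this
  have hb : ∀ n, ∀ z ∈ closedBall (0 : ℂ) 1, ‖x n * z ^ n‖ ≤ ‖x n‖ := fun n z hz => by
    rw [norm_mul, norm_pow]
    exact mul_le_of_le_one_right (norm_nonneg _)
      (pow_le_one₀ (norm_nonneg _) (mem_closedBall_zero_iff.1 hz))
  have hT : HasTaylor (fun z => ∑' n, x n * z ^ n) x := fun z hz =>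
    (hx.of_norm_bounded fun n => hb n z (ball_subset_closedBall hz)).hasSum
  refine ⟨⟨hT.differentiableOn, _, ?_, fun _ _ => rfl⟩, hT⟩
  exact continuousOn_tsum (fun n => by fun_prop) hx hb

theorem norm_tsum_le (x : lp (fun _ : ℕ => ℂ) 1) {z : ℂ} (hz : z ∈ ball (0 : ℂ) 1) :
    ‖∑' n, x n * z ^ n‖ ≤ ‖x‖ := by
  have hx := lp.hasSum_norm (p := 1) (by norm_num) x
  simp only [ENNReal.toReal_one, Real.rpow_one] at hx
  refine tsum_of_norm_bounded hx fun n => ?_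
  rw [norm_mul, norm_pow]
  exact mul_le_of_le_one_right (norm_nonneg _)
      (pow_le_one₀ (norm_nonneg _) (mem_ball_zero_iff.1 hz).le)

/-- If the disk algebra is contained in `H(b)`, the monomials are bounded in the model. -/
theorem exists_bound_of_diskAlgebra_subset (h : IsOuterPair a b)
    (hA : diskAlgebra ⊆ deBrangesRovnyak b) : ∃ C : ℝ, ∀ n : ℕ, ∃ F ∈
      (Submodule.span ℂ (Set.range (modelVec a b))).topologicalClosure, ‖F‖ ≤ C ∧
      ∀ w : Complex.UnitDisc, inner ℂ (modelVec a b w) F = (w : ℂ) ^ n := by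
  set N := (Submodule.span ℂ (Set.range (modelVec a b))).topologicalClosure with hN
  have hex : ∀ x : lp (fun _ : ℕ => ℂ) 1, ∃ F : N, ∀ w : Complex.UnitDisc,
      inner ℂ (modelVec a b w) (F : WithLp 2 (HardySeq × HardySeq)) = ∑' n, x n * (w : ℂ) ^ n :=
    fun x => by
      obtain ⟨F, hF, hFw⟩ := h.isKernelModel.exists_inner_eq_of_mem
        (hA (wiener_mem_diskAlgebra x).1)
      exact ⟨⟨F, hF⟩, hFw⟩
  choose A hAw using hex
  have hT := fun x => (wiener_mem_diskAlgebra x).2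
  have hext : ∀ F G : N, (∀ w, inner ℂ (modelVec a b w) (F : WithLp 2 (HardySeq × HardySeq)) =
      inner ℂ (modelVec a b w) (G : WithLp 2 (HardySeq × HardySeq))) → F = G :=
    fun F G hFG => Subtype.ext (eq_of_inner_modelVec_eq F.2 G.2 hFG)
  -- A vector of `N` is determined by its products with the kernel vectors; this yields linearity
  -- here and closedness of the graph below.
  let T : lp (fun _ : ℕ => ℂ) 1 →ₗ[ℂ] N :=
    { toFun := A
      map_add' := fun x y => hext _ _ fun w => by
        rw [Submodule.coe_add, inner_add_right, hAw, hAw, hAw]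
        have := ((hT x).add (hT y)) w (unitDisc_mem_ball w)
        exact this.tsum_eq
      map_smul' := fun c x => hext _ _ fun w => by
        rw [RingHom.id_apply, Submodule.coe_smul, inner_smul_right, hAw, hAw]
        have := ((hT x).const_mul c) w (unitDisc_mem_ball w)
        exact this.tsum_eq }
  have : CompleteSpace N := (Submodule.isClosed_topologicalClosure _).completeSpace_coe
  have hTc : Continuous T := by
    refine T.continuous_of_seq_closed_graph fun u x y hu hy => hext _ _ fun w => ?_
    have h1 : Tendsto (fun n => inner ℂ (modelVec a b w)
        ((T (u n) : N) : WithLp 2 (HardySeq × HardySeq))) atTop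
        (𝓝 (inner ℂ (modelVec a b w) (y : WithLp 2 (HardySeq × HardySeq)))) := by
      have hc : Continuous fun F : N =>
        inner ℂ (modelVec a b w) (F : WithLp 2 (HardySeq × HardySeq)) := by fun_prop
      exact (hc.tendsto y).comp hy
    refine tendsto_nhds_unique h1 ?_
    rw [tendsto_iff_norm_sub_tendsto_zero]
    refine squeeze_zero (fun _ => norm_nonneg _) (fun n => ?_)
      (tendsto_iff_norm_sub_tendsto_zero.1 hu)
    rw [← inner_sub_right, ← Submodule.coe_sub, ← map_sub]
    change ‖inner ℂ (modelVec a b w) (A (u n - x) : WithLp 2 (HardySeq × HardySeq))‖ ≤ _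
    rw [hAw]
    exact norm_tsum_le _ (unitDisc_mem_ball w)
  let S : lp (fun _ : ℕ => ℂ) 1 →L[ℂ] N := ⟨T, hTc⟩
  refine ⟨‖S‖, fun n => ⟨A (lp.single 1 n 1), (A _).2, ?_, fun w => ?_⟩⟩
  · have h1 := S.le_opNorm (lp.single 1 n 1)
    rw [lp.norm_single (by norm_num), norm_one, mul_one] at h1
    exact h1
  · rw [hAw]
    refine (tsum_eq_single n fun m hm => ?_).trans ?_
    · simp [hm]
    · simp

/-- Density of `a H^∞` forces the model vector of `z^n` to be `(z^n, T_{conj φ} z^n)`. The squared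
norm of its second component is `∑ |φ_j|²` over `j ≤ n`, and it is bounded independently of `n`. -/
theorem mem_hardyTwo_of_diskAlgebra_subset (h : IsOuterPair a b)
    (hA : diskAlgebra ⊆ deBrangesRovnyak b) : (fun z => b z / a z) ∈ hardyTwo := by
  have hd0 : DifferentiableOn ℂ (fun z => b z / a z) (ball 0 1) :=
    h.right_mem.1.div h.left_mem.1 h.ne_zero
  obtain ⟨d, hd⟩ := exists_hasTaylor hd0
  obtain ⟨C, hC⟩ := h.exists_bound_of_diskAlgebra_subset hA
  rw [hd.mem_hardyTwo_iff]
  refine summable_of_sum_range_le (c := C ^ 2) (fun n => by positivity) fun n => ?_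
  obtain ⟨F, hF, hFC, hFw⟩ := hC n
  have hint : ∀ q ∈ hardyInfty, _ := fun q hq => h.intertwine_of_mem hF hq
  have h1 : F.fst = polyVec (Polynomial.monomial n 1) := by
    have hT1 : HasTaylor (fun w => w ^ n) F.fst := by
      refine (hasTaylor_inner_szego F.fst).congr fun w hw => ?_
      have := hFw (Complex.UnitDisc.mk w (by simpa using hw))
      rw [inner_modelVec_eq_of_intertwine hint] at this
      exact this
    have hT2 := hasTaylor_eval (Polynomial.monomial n 1)
    simp only [Polynomial.eval_monomial, one_mul] at hT2
    ext m
    rw [polyVec_apply, hT1.unique hT2]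
  set t := coanalyticToeplitz d (Polynomial.monomial n 1) with ht
  have h2 : F.snd = polyVec t := by
    rw [← sub_eq_zero]
    refine h.eq_zero _ fun q hq => ?_
    rw [inner_sub_right, ← hint q hq, h1, ht, h.intertwine_coanalyticToeplitz hd _ hq, sub_self]
  have h3 : ‖polyVec t‖ ^ 2 ≤ C ^ 2 := by
    have h4 := WithLp.prod_norm_sq_eq_of_L2 F
    rw [← h2]
    have := pow_le_pow_left₀ (norm_nonneg _) hFC 2
    change ‖F‖ ^ 2 = ‖F.fst‖ ^ 2 + ‖F.snd‖ ^ 2 at h4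
    nlinarith [sq_nonneg ‖F.fst‖]
  refine le_trans ?_ h3
  have e : HasSum (fun m => ‖polyVec t m‖ ^ 2) (‖polyVec t‖ ^ 2) := by
    have := lp.hasSum_norm (p := 2) (by norm_num) (polyVec t)
    simpa using this
  have hcoef : ∀ m ≤ n, t.coeff m = conj (d (n - m)) := fun m hm => by
    rw [ht, coanalyticToeplitz_monomial, Polynomial.finsetSum_coeff]
    rw [Finset.sum_eq_single (n - m)]
    · rw [Polynomial.coeff_monomial, if_pos (by omega), mul_one]
    · intro j hj hjm
      have := Finset.mem_range.1 hj
      rw [Polynomial.coeff_monomial, if_neg (by omega)]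
    · intro hj
      exact absurd (Finset.mem_range.2 (by omega)) hj
  calc ∑ j ∈ Finset.range n, ‖d j‖ ^ 2 ≤ ∑ j ∈ Finset.range (n + 1), ‖d j‖ ^ 2 :=
        Finset.sum_le_sum_of_subset_of_nonneg (Finset.range_mono (by omega))
          fun _ _ _ => by positivity
    _ = ∑ j ∈ Finset.range (n + 1), ‖polyVec t j‖ ^ 2 := by
        rw [← Finset.sum_range_reflect]
        refine Finset.sum_congr rfl fun j hj => ?_
        have := Finset.mem_range.1 hj
        rw [polyVec_apply, hcoef j (by omega), Complex.norm_conj]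
        congr 3
    _ ≤ _ := sum_le_hasSum _ (fun _ _ => by positivity) e

end IsOuterPair

/-! ### Mean values over circles of expressions in analytic functions -/

section MeanValues

variable {P F : ℂ → ℂ} {z : ℂ} {ρ : ℝ}

theorem Continuous.circleIntegrable' {E : Type*} [NormedAddCommGroup E] {f : ℂ → E}
    (hf : Continuous f) : CircleIntegrable f z ρ :=
  ContinuousOn.circleIntegrable' hf.continuousOn

theorem circleAverage_of_differentiable (hF : Differentiable ℂ F) :
    Real.circleAverage F z ρ = F z :=
  hF.diffContOnCl.circleAverage

theorem circleAverage_re {f : ℂ → ℂ} (hf : CircleIntegrable f z ρ) :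
    Real.circleAverage (fun w => (f w).re) z ρ = (Real.circleAverage f z ρ).re :=
  Complex.reCLM.circleAverage_comp_comm hf

theorem circleAverage_re_of_differentiable (hF : Differentiable ℂ F) :
    Real.circleAverage (fun w => (F w).re) z ρ = (F z).re := by
  rw [circleAverage_re hF.continuous.circleIntegrable', circleAverage_of_differentiable hF]

/-- In the expansion around `z` the terms linear in the increments are harmonic, so only the product
of increments survives. Such increments play the role of derivatives and Laplacians in the maximum
principle arguments. -/
theorem circleAverage_re_conj_mul (hP : Differentiable ℂ P) (hF : Differentiable ℂ F) :
    Real.circleAverage (fun w => (conj (P w) * F w).re) z ρ = (conj (P z) * F z).re +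
      Real.circleAverage (fun w => (conj (P w - P z) * (F w - F z)).re) z ρ := by
  have hPc := hP.continuous
  have hFc := hF.continuous
  have hG : Differentiable ℂ fun w => conj (P z) * F w + conj (F z) * P w - conj (P z) * F z := by
    fun_prop
  have e : (fun w => (conj (P w) * F w).re) = fun w =>
      (conj (P z) * F w + conj (F z) * P w - conj (P z) * F z).re +
        (conj (P w - P z) * (F w - F z)).re := by
    ext w
    simp [Complex.mul_re]
    ring
  rw [e, Real.circleAverage_fun_add (Continuous.circleIntegrable' (by fun_prop))
    (Continuous.circleIntegrable' (by fun_prop)), circleAverage_re_of_differentiable hG]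
  congr 1
  simp [Complex.mul_re]
  ring

theorem re_conj_mul_self (w : ℂ) : (conj w * w).re = ‖w‖ ^ 2 := by
  rw [Complex.conj_mul', ← Complex.ofReal_pow, Complex.ofReal_re]

theorem circleAverage_norm_sq (hP : Differentiable ℂ P) :
    Real.circleAverage (fun w => ‖P w‖ ^ 2) z ρ = ‖P z‖ ^ 2 +
      Real.circleAverage (fun w => ‖P w - P z‖ ^ 2) z ρ := by
  simpa only [re_conj_mul_self] using circleAverage_re_conj_mul (ρ := ρ) (z := z) hP hP

end MeanValues

/-! ### A maximum principle for Poisson integrals -/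

/-- The Poisson integral at `lam` of a function on the unit circle. -/
noncomputable def poissonMean (lam : ℂ) (v : ℂ → ℝ) : ℝ :=
  Real.circleAverage (fun ζ => poissonKernel 0 lam ζ * v ζ) 0 1

section PoissonMean

variable {lam : ℂ} {v w : ℂ → ℝ}

theorem continuousOn_poissonKernel_sphere (hl : lam ∈ ball (0 : ℂ) 1) :
    ContinuousOn (poissonKernel 0 lam) (sphere 0 |1|) := by
  rw [poissonKernel_eq_re_herglotzRieszKernel]
  exact Complex.continuous_re.comp_continuousOn (continuousOn_herglotzRieszKernel_sphere hl)

theorem circleIntegrable_poissonKernel_mul (hl : lam ∈ ball (0 : ℂ) 1)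
    (hv : ContinuousOn v (sphere 0 1)) :
    CircleIntegrable (fun ζ => poissonKernel 0 lam ζ * v ζ) 0 1 :=
  ContinuousOn.circleIntegrable' ((continuousOn_poissonKernel_sphere hl).mul (by simpa using hv))

theorem poissonKernel_nonneg_of_mem_sphere (hl : lam ∈ ball (0 : ℂ) 1) {ζ : ℂ}
    (hζ : ζ ∈ sphere (0 : ℂ) |1|) : 0 ≤ poissonKernel 0 lam ζ := by
  have h1 : ‖ζ‖ = 1 := by simpa using hζ
  have h2 : ‖lam‖ < 1 := by simpa using hl
  rw [poissonKernel]
  refine div_nonneg ?_ (by positivity)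
  simp only [sub_zero, h1]
  nlinarith [norm_nonneg lam]

theorem poissonMean_mono (hl : lam ∈ ball (0 : ℂ) 1) (hv : ContinuousOn v (sphere 0 1))
    (hw : ContinuousOn w (sphere 0 1)) (h : ∀ ζ ∈ sphere (0 : ℂ) 1, v ζ ≤ w ζ) :
    poissonMean lam v ≤ poissonMean lam w :=
  Real.circleAverage_mono (circleIntegrable_poissonKernel_mul hl hv)
    (circleIntegrable_poissonKernel_mul hl hw) fun ζ hζ =>
      mul_le_mul_of_nonneg_left (h ζ (by simpa using hζ)) (poissonKernel_nonneg_of_mem_sphere hl hζ)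

theorem poissonMean_congr (h : ∀ ζ ∈ sphere (0 : ℂ) 1, v ζ = w ζ) :
    poissonMean lam v = poissonMean lam w :=
  Real.circleAverage_congr_sphere fun ζ hζ => by rw [h ζ (by simpa using hζ)]

theorem poissonMean_add (hl : lam ∈ ball (0 : ℂ) 1) (hv : ContinuousOn v (sphere 0 1))
    (hw : ContinuousOn w (sphere 0 1)) :
    poissonMean lam (fun ζ => v ζ + w ζ) = poissonMean lam v + poissonMean lam w := by
  simp only [poissonMean, mul_add]
  exact Real.circleAverage_fun_add (circleIntegrable_poissonKernel_mul hl hv)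
    (circleIntegrable_poissonKernel_mul hl hw)

theorem poissonMean_const_mul (c : ℝ) :
    poissonMean lam (fun ζ => c * v ζ) = c * poissonMean lam v := by
  have := Real.circleAverage_fun_smul (a := c) (f := fun ζ => poissonKernel 0 lam ζ * v ζ)
    (c := 0) (R := 1)
  simp only [smul_eq_mul] at this
  rw [poissonMean, poissonMean, ← this]
  simp only [mul_left_comm]

theorem poissonMean_re (hl : lam ∈ ball (0 : ℂ) 1) {F : ℂ → ℂ} (hF : Differentiable ℂ F) :
    poissonMean lam (fun ζ => (F ζ).re) = (F lam).re := by
  have h := (hF.diffContOnCl (s := ball 0 1)).circleAverage_poissonKernel_smul hl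
  have hi : CircleIntegrable (poissonKernel 0 lam • F) 0 1 :=
    ContinuousOn.circleIntegrable' ((continuousOn_poissonKernel_sphere hl).smul
      hF.continuous.continuousOn)
  rw [← h, ← circleAverage_re hi]
  simp [poissonMean]

theorem poissonMean_const (hl : lam ∈ ball (0 : ℂ) 1) (c : ℝ) :
    poissonMean lam (fun _ => c) = c := by
  simpa using poissonMean_re hl (differentiable_const (c : ℂ))

theorem poissonMean_nonneg (hl : lam ∈ ball (0 : ℂ) 1) (h : ∀ ζ ∈ sphere (0 : ℂ) 1, 0 ≤ v ζ) :
    0 ≤ poissonMean lam v :=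
  Real.circleAverage_nonneg_of_nonneg fun ζ hζ =>
    mul_nonneg (poissonKernel_nonneg_of_mem_sphere hl hζ) (h ζ (by simpa using hζ))

end PoissonMean

/-- Trigonometric polynomials are dense and have the form `q + conj r` on the circle. As `v` is real
only real parts matter, and `q + conj r` has the same real part as `q + r`. -/
theorem exists_polynomial_near {v : ℂ → ℝ} (hv : ContinuousOn v (sphere 0 1)) {ε : ℝ}
    (hε : 0 < ε) : ∃ q : Polynomial ℂ, ∀ ζ ∈ sphere (0 : ℂ) 1, |v ζ - (q.eval ζ).re| < ε := by
  have : Fact (0 < 2 * Real.pi) := ⟨Real.two_pi_pos⟩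
  let V : C(AddCircle (2 * Real.pi), ℂ) := ⟨fun x => (v (x.toCircle : ℂ) : ℂ),
    Complex.continuous_ofReal.comp (hv.comp_continuous
      (continuous_subtype_val.comp AddCircle.continuous_toCircle) fun x =>
        mem_sphere_zero_iff_norm.2 (Circle.norm_coe _))⟩
  have hmem : V ∈ (Submodule.span ℂ (Set.range (@fourier (2 * Real.pi)))).topologicalClosure := by
    rw [span_fourier_closure_eq_top]; trivial
  have hq : ∀ g ∈ Submodule.span ℂ (Set.range (@fourier (2 * Real.pi))),
      ∃ q r : Polynomial ℂ, ∀ x : AddCircle (2 * Real.pi),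
      g x = q.eval (x.toCircle : ℂ) + conj (r.eval (x.toCircle : ℂ)) := by
    intro g hg
    induction hg using Submodule.span_induction with
    | mem x hx =>
      obtain ⟨n, rfl⟩ := hx
      rcases Int.eq_nat_or_neg n with ⟨m, rfl | rfl⟩
      · refine ⟨Polynomial.X ^ m, 0, fun x => ?_⟩
        simp [fourier_apply, AddCircle.toCircle_nsmul]
      · refine ⟨0, Polynomial.X ^ m, fun x => ?_⟩
        rw [fourier_neg, fourier_apply]
        simp [AddCircle.toCircle_nsmul]
    | zero => exact ⟨0, 0, by simp⟩
    | add x y _ _ hx hy =>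
      obtain ⟨q1, r1, h1⟩ := hx
      obtain ⟨q2, r2, h2⟩ := hy
      refine ⟨q1 + q2, r1 + r2, fun x => ?_⟩
      simp [h1, h2]
      ring
    | smul c x _ hx =>
      obtain ⟨q1, r1, h1⟩ := hx
      refine ⟨c • q1, conj c • r1, fun x => ?_⟩
      simp [h1]
      ring
  obtain ⟨g, hg, hVg⟩ := Metric.mem_closure_iff.1 hmem ε hε
  obtain ⟨q, r, hqr⟩ := hq g hg
  refine ⟨q + r, fun ζ hζ => ?_⟩
  obtain ⟨x, hx⟩ : ∃ x : AddCircle (2 * Real.pi), (x.toCircle : ℂ) = ζ := by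
    refine ⟨((ζ.arg : ℝ) : AddCircle (2 * Real.pi)), ?_⟩
    have hζ' : ‖ζ‖ = 1 := by simpa using hζ
    have := Complex.norm_mul_exp_arg_mul_I ζ
    rw [hζ'] at this
    rw [AddCircle.toCircle_apply_mk, Circle.coe_exp]
    simpa using this
  have h1 := (ContinuousMap.dist_apply_le_dist (f := V) (g := g) x).trans_lt hVg
  rw [dist_eq_norm] at h1
  refine lt_of_le_of_lt ?_ h1
  have h2 := Complex.abs_re_le_norm (V x - g x)
  refine le_trans (le_of_eq ?_) h2
  rw [hqr]
  simp [V, hx]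

/-- A continuous function satisfying the sub-mean value inequality asymptotically on small circles
is dominated by its Poisson integral. -/
theorem le_poissonMean {v : ℂ → ℝ} (hv : ContinuousOn v (closedBall 0 1))
    (hloc : ∀ z ∈ ball (0 : ℂ) 1, ∃ C δ : ℝ, 0 < δ ∧ ∀ ρ, 0 < ρ → ρ < δ →
      v z ≤ Real.circleAverage v z ρ + C * ρ ^ 3) {lam : ℂ} (hl : lam ∈ ball (0 : ℂ) 1) :
    v lam ≤ poissonMean lam v := by
  have hvs : ContinuousOn v (sphere 0 1) := hv.mono sphere_subset_closedBall
  refine le_of_forall_pos_le_add fun η' hη' => ?_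
  obtain ⟨η, hη, rfl⟩ : ∃ η, 0 < η ∧ η' = 3 * η := ⟨η' / 3, by positivity, by ring⟩
  obtain ⟨q, hq⟩ := exists_polynomial_near hvs hη
  -- `Re q` is harmonic and nearly equals `v` on the circle. The term `η |z|²` gains exactly `η ρ²`
  -- on a circle of radius `ρ`, which beats `C ρ³` for small `ρ`, so the maximum of `G` cannot be
  -- interior.
  let G : ℂ → ℝ := fun z => v z + (-(q.eval z)).re + η * ‖z‖ ^ 2
  have hqd : Differentiable ℂ fun z => -(q.eval z) := q.differentiable.neg
  have hG : ContinuousOn G (closedBall 0 1) :=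
    (hv.add (Complex.continuous_re.comp hqd.continuous).continuousOn).add (by fun_prop)
  obtain ⟨z0, hz0, hmax⟩ := (isCompact_closedBall (0 : ℂ) 1).exists_isMaxOn ⟨0, by simp⟩ hG
  have hz0s : ‖z0‖ = 1 := by
    by_contra hne
    have hz0b : z0 ∈ ball (0 : ℂ) 1 := by
      rw [mem_ball_zero_iff]
      exact lt_of_le_of_ne (mem_closedBall_zero_iff.1 hz0) hne
    obtain ⟨C, δ, hδ, hC⟩ := hloc z0 hz0b
    have hr : 0 < 1 - ‖z0‖ := by have := mem_ball_zero_iff.1 hz0b; linarith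
    obtain ⟨ρ, hρ0, hρ⟩ := exists_between (show 0 < min (min δ (1 - ‖z0‖)) (η / (|C| + 1)) by
      have : 0 < |C| + 1 := by positivity
      positivity)
    have hρ1 : ρ < δ := hρ.trans_le ((min_le_left _ _).trans (min_le_left _ _))
    have hρ2 : ρ < 1 - ‖z0‖ := hρ.trans_le ((min_le_left _ _).trans (min_le_right _ _))
    have hρ3 : |C| * ρ < η := by
      have h1 : ρ < η / (|C| + 1) := hρ.trans_le (min_le_right _ _)
      rw [lt_div_iff₀ (by positivity)] at h1
      nlinarith
    have hsub : sphere z0 |ρ| ⊆ closedBall 0 1 := fun w hw => by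
      rw [abs_of_pos hρ0, mem_sphere_iff_norm] at hw
      rw [mem_closedBall_zero_iff]
      have := norm_le_norm_add_norm_sub' w z0
      linarith
    have hvi : CircleIntegrable v z0 ρ := ContinuousOn.circleIntegrable' (hv.mono hsub)
    have hqi : CircleIntegrable (fun w => (-(q.eval w)).re) z0 ρ :=
      (Complex.continuous_re.comp hqd.continuous).circleIntegrable'
    have hni : CircleIntegrable (fun w : ℂ => η * ‖w‖ ^ 2) z0 ρ :=
      Continuous.circleIntegrable' (by fun_prop)
    have hvq : CircleIntegrable (fun w => v w + (-(q.eval w)).re) z0 ρ := hvi.add hqi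
    have hle : Real.circleAverage G z0 ρ ≤ G z0 :=
      Real.circleAverage_mono_on_of_le_circle (hvq.add hni)
        fun w hw => hmax (hsub hw)
    have hn : Real.circleAverage (fun w : ℂ => η * ‖w‖ ^ 2) z0 ρ = η * (‖z0‖ ^ 2 + ρ ^ 2) := by
      have h1 := Real.circleAverage_fun_smul (a := η) (f := fun w : ℂ => ‖w‖ ^ 2) (c := z0) (R := ρ)
      simp only [smul_eq_mul] at h1
      rw [h1, circleAverage_norm_sq (P := fun w => w) differentiable_fun_id]
      congr 2
      refine Real.circleAverage_const_on_circle fun w hw => ?_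
      rw [mem_sphere_iff_norm] at hw
      rw [hw, sq_abs]
    have hGe : Real.circleAverage G z0 ρ = Real.circleAverage v z0 ρ + (-(q.eval z0)).re +
        η * (‖z0‖ ^ 2 + ρ ^ 2) := by
      rw [← hn, ← circleAverage_re_of_differentiable hqd,
        ← Real.circleAverage_fun_add hvi hqi, ← Real.circleAverage_fun_add hvq hni]
    have h2 := hC ρ hρ0 hρ1
    rw [hGe] at hle
    have h3 : C * ρ ^ 3 < η * ρ ^ 2 := by
      have : C * ρ ≤ |C| * ρ := by gcongr; exact le_abs_self C
      nlinarith [pow_pos hρ0 2]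
    simp only [G] at hle
    nlinarith
  have hG0 : G z0 ≤ 2 * η := by
    have := (abs_lt.1 (hq z0 (by simpa using hz0s))).2
    simp only [G, hz0s, Complex.neg_re]
    linarith
  have h1 : G lam ≤ 2 * η := (hmax (ball_subset_closedBall hl)).trans hG0
  have h2 : (q.eval lam).re ≤ poissonMean lam v + η := by
    rw [← poissonMean_re hl q.differentiable, ← poissonMean_const hl η,
      ← poissonMean_add hl hvs continuousOn_const]
    refine poissonMean_mono hl (Complex.continuous_re.comp q.continuous).continuousOn
      (hvs.add continuousOn_const) fun ζ hζ => ?_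
    have := (abs_lt.1 (hq ζ hζ)).1
    linarith
  simp only [G, Complex.neg_re] at h1
  nlinarith [mul_nonneg hη.le (sq_nonneg ‖lam‖)]

/-! ### Polynomials with bounded mean oscillation define bounded Hankel forms -/

theorem Polynomial.exists_lipschitz_closedBall (p : Polynomial ℂ) :
    ∃ L : ℝ, 0 ≤ L ∧ ∀ z ∈ closedBall (0 : ℂ) 1, ∀ w ∈ closedBall (0 : ℂ) 1,
      ‖p.eval w - p.eval z‖ ≤ L * ‖w - z‖ := by
  obtain ⟨L, hL⟩ := (isCompact_closedBall (0 : ℂ) 1).exists_bound_of_continuousOn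
    p.derivative.continuous.continuousOn
  refine ⟨L, (norm_nonneg _).trans (hL 0 (by simp)), fun z hz w hw => ?_⟩
  exact (convex_closedBall (0 : ℂ) 1).norm_image_sub_le_of_norm_hasDerivWithin_le
    (fun x _ => (p.hasDerivAt x).hasDerivWithinAt) hL hz hw

theorem sphere_subset_closedBall_zero {z : ℂ} {ρ : ℝ} (hρ : 0 < ρ) (h : ρ < 1 - ‖z‖) :
    sphere z |ρ| ⊆ closedBall (0 : ℂ) 1 := fun w hw => by
  rw [abs_of_pos hρ, mem_sphere_iff_norm] at hw
  rw [mem_closedBall_zero_iff]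
  have := norm_le_norm_add_norm_sub' w z
  linarith

/-- On the circle `z^j conj(z)^k` is `z^(j-k)` or the conjugate of `z^(k-j)`. The Poisson integral
of `|p|²` thereby becomes the explicit harmonic function `Re U`. -/
theorem exists_polynomial_re_eq_norm_sq (p : Polynomial ℂ) :
    ∃ U : Polynomial ℂ, ∀ ζ ∈ sphere (0 : ℂ) 1, (U.eval ζ).re = ‖p.eval ζ‖ ^ 2 := by
  classical
  refine ⟨∑ j ∈ p.support, ∑ k ∈ p.support, if k ≤ j then
    Polynomial.monomial (j - k) (p.coeff j * conj (p.coeff k)) else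
    Polynomial.monomial (k - j) (p.coeff k * conj (p.coeff j)), fun ζ hζ => ?_⟩
  have h1 : ζ * conj ζ = 1 := by
    rw [Complex.mul_conj', mem_sphere_zero_iff_norm.1 hζ]; simp
  have hm : ∀ j k : ℕ, k ≤ j → ζ ^ (j - k) = ζ ^ j * conj ζ ^ k := fun j k hkj => by
    obtain ⟨i, rfl⟩ := Nat.exists_eq_add_of_le hkj
    rw [Nat.add_sub_cancel_left, pow_add, mul_right_comm, ← mul_pow, h1]
    simp
  have hp : p.eval ζ = ∑ j ∈ p.support, p.coeff j * ζ ^ j := Polynomial.eval_eq_sum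
  rw [← re_conj_mul_self, hp, map_sum, Finset.sum_mul_sum]
  simp only [Polynomial.eval_finsetSum, Complex.re_sum]
  refine Finset.sum_congr rfl fun j _ => Finset.sum_congr rfl fun k _ => ?_
  split_ifs with h
  · rw [Polynomial.eval_monomial, hm j k h, ← Complex.conj_re (conj (p.coeff j * ζ ^ j) * _)]
    simp only [map_mul, map_pow, Complex.conj_conj]
    ring_nf
  · rw [Polynomial.eval_monomial, hm k j (not_le.1 h).le]
    simp only [map_mul, map_pow]
    ring_nf

/-- The difference between the harmonic function `Re U` and the subharmonic function `|p|²`. -/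
noncomputable def subharmonicDefect (U p : Polynomial ℂ) (z : ℂ) : ℝ :=
  (U.eval z).re - ‖p.eval z‖ ^ 2

section Defect

variable {U p : Polynomial ℂ}

theorem continuous_subharmonicDefect : Continuous (subharmonicDefect U p) := by
  unfold subharmonicDefect
  exact (Complex.continuous_re.comp U.continuous).sub (p.continuous.norm.pow 2)

theorem subharmonicDefect_of_mem_sphere
    (hU : ∀ ζ ∈ sphere (0 : ℂ) 1, (U.eval ζ).re = ‖p.eval ζ‖ ^ 2) {ζ : ℂ}
    (hζ : ζ ∈ sphere (0 : ℂ) 1) : subharmonicDefect U p ζ = 0 := by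
  rw [subharmonicDefect, hU ζ hζ, sub_self]

/-- The variance identity for the probability measure given by the Poisson kernel; the supremum of
the defect is the square of the Garsia norm of `p`. -/
theorem subharmonicDefect_eq_poissonMean
    (hU : ∀ ζ ∈ sphere (0 : ℂ) 1, (U.eval ζ).re = ‖p.eval ζ‖ ^ 2) {lam : ℂ}
    (hl : lam ∈ ball (0 : ℂ) 1) :
    subharmonicDefect U p lam = poissonMean lam fun ζ => ‖p.eval ζ - p.eval lam‖ ^ 2 := by
  have h : poissonMean lam (fun ζ => ‖p.eval ζ - p.eval lam‖ ^ 2) = poissonMean lam fun ζ =>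
      (U.eval ζ - 2 * conj (p.eval lam) * p.eval ζ + conj (p.eval lam) * p.eval lam).re :=
    poissonMean_congr fun ζ hζ => by
      rw [Complex.add_re, Complex.sub_re, hU ζ hζ, re_conj_mul_self, ← re_conj_mul_self,
        ← re_conj_mul_self (p.eval ζ), ← re_conj_mul_self (p.eval lam)]
      simp only [Complex.mul_re, Complex.sub_re, Complex.sub_im, Complex.conj_re, Complex.conj_im,
        Complex.mul_im, map_sub, Complex.re_ofNat, Complex.im_ofNat]
      ring
  have hd : Differentiable ℂ fun ζ =>
      U.eval ζ - 2 * conj (p.eval lam) * p.eval ζ + conj (p.eval lam) * p.eval lam :=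
    (U.differentiable.sub (p.differentiable.const_mul _)).add_const _
  rw [h, poissonMean_re hl hd, subharmonicDefect, ← re_conj_mul_self]
  simp [Complex.mul_re]
  ring

theorem subharmonicDefect_nonneg
    (hU : ∀ ζ ∈ sphere (0 : ℂ) 1, (U.eval ζ).re = ‖p.eval ζ‖ ^ 2) {z : ℂ}
    (hz : z ∈ closedBall (0 : ℂ) 1) : 0 ≤ subharmonicDefect U p z := by
  rw [← ball_union_sphere] at hz
  rcases hz with hz | hz
  · rw [subharmonicDefect_eq_poissonMean hU hz]
    exact poissonMean_nonneg hz fun _ _ => by positivity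
  · rw [subharmonicDefect_of_mem_sphere hU hz]

theorem circleAverage_const_add_subharmonicDefect {M : ℝ} {z : ℂ} {ρ : ℝ} :
    Real.circleAverage (fun w => M + subharmonicDefect U p w) z ρ = M + subharmonicDefect U p z -
      Real.circleAverage (fun w => ‖p.eval w - p.eval z‖ ^ 2) z ρ := by
  have e : (fun w => M + subharmonicDefect U p w) = fun w =>
      ((M : ℂ) + U.eval w).re - ‖p.eval w‖ ^ 2 := by
    ext w
    simp [subharmonicDefect]
    ring
  have hd : Differentiable ℂ fun w => (M : ℂ) + U.eval w := U.differentiable.const_add _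
  have hi1 : CircleIntegrable (fun w => ((M : ℂ) + U.eval w).re) z ρ :=
    (Complex.continuous_re.comp hd.continuous).circleIntegrable'
  have hi2 : CircleIntegrable (fun w => ‖p.eval w‖ ^ 2) z ρ :=
    (p.continuous.norm.pow 2).circleIntegrable'
  rw [e, Real.circleAverage_fun_sub hi1 hi2, circleAverage_re_of_differentiable hd,
    circleAverage_norm_sq p.differentiable]
  simp [subharmonicDefect]
  ring

variable {M : ℝ}

theorem continuousOn_norm_sq_div (hM : 0 < M)
    (h0 : ∀ z ∈ closedBall (0 : ℂ) 1, 0 ≤ subharmonicDefect U p z) {h : ℂ → ℂ} (hh : Continuous h) :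
    ContinuousOn (fun w => ‖h w‖ ^ 2 / (M + subharmonicDefect U p w)) (closedBall 0 1) :=
  ContinuousOn.div (hh.norm.pow 2).continuousOn
    (continuous_const.add continuous_subharmonicDefect).continuousOn
    fun z hz => (add_pos_of_pos_of_nonneg hM (h0 z hz)).ne'

/-- The function `(x, s) ↦ |x|² / s` is convex, so it lies above its tangent at `(h z, s0)`; this is
`hpt`. On averaging the tangent, `h` reproduces its value and `M + G` drops by `D`, which produces
the gain `‖h z‖² D / s0²`; finally `s0 ≤ 2 M`. -/
theorem add_le_circleAverage_norm_sq_div (hM : 0 < M)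
    (h0 : ∀ z ∈ closedBall (0 : ℂ) 1, 0 ≤ subharmonicDefect U p z)
    (h1 : ∀ z ∈ closedBall (0 : ℂ) 1, subharmonicDefect U p z ≤ M) {h : ℂ → ℂ}
    (hh : Differentiable ℂ h) {z : ℂ} (hz : z ∈ closedBall (0 : ℂ) 1) {ρ : ℝ}
    (hρ : sphere z |ρ| ⊆ closedBall (0 : ℂ) 1) :
    ‖h z‖ ^ 2 / (M + subharmonicDefect U p z) + ‖h z‖ ^ 2 / (4 * M ^ 2) *
        Real.circleAverage (fun w => ‖p.eval w - p.eval z‖ ^ 2) z ρ ≤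
      Real.circleAverage (fun w => ‖h w‖ ^ 2 / (M + subharmonicDefect U p w)) z ρ := by
  set D := Real.circleAverage (fun w => ‖p.eval w - p.eval z‖ ^ 2) z ρ with hD
  have hD0 : 0 ≤ D := Real.circleAverage_nonneg_of_nonneg fun _ _ => by positivity
  set s0 := M + subharmonicDefect U p z with hs0
  have hs0p : 0 < s0 := add_pos_of_pos_of_nonneg hM (h0 z hz)
  have hs02 : s0 ≤ 2 * M := by have := h1 z hz; linarith
  have hpt : ∀ w ∈ sphere z |ρ|, 2 / s0 * (conj (h z) * h w).re -
      ‖h z‖ ^ 2 / s0 ^ 2 * (M + subharmonicDefect U p w) ≤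
        ‖h w‖ ^ 2 / (M + subharmonicDefect U p w) := fun w hw => by
    have hs : 0 < M + subharmonicDefect U p w := add_pos_of_pos_of_nonneg hM (h0 w (hρ hw))
    set s := M + subharmonicDefect U p w
    have hre : (conj (h z) * h w).re ≤ ‖h z‖ * ‖h w‖ := by
      refine (Complex.re_le_norm _).trans ?_
      rw [norm_mul, RCLike.norm_conj]
    have hsq : 0 ≤ s * (‖h w‖ / s - ‖h z‖ / s0) ^ 2 := by positivity
    have e : s * (‖h w‖ / s - ‖h z‖ / s0) ^ 2 =
        ‖h w‖ ^ 2 / s - 2 / s0 * (‖h z‖ * ‖h w‖) + ‖h z‖ ^ 2 / s0 ^ 2 * s := by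
      field_simp
      ring
    have := mul_le_mul_of_nonneg_left hre (show 0 ≤ 2 / s0 by positivity)
    linarith
  have hfi : CircleIntegrable (fun w => 2 / s0 * (conj (h z) * h w).re) z ρ :=
    Continuous.circleIntegrable' (continuous_const.mul (Complex.continuous_re.comp
      (continuous_const.mul hh.continuous)))
  have hgi : CircleIntegrable (fun w => ‖h z‖ ^ 2 / s0 ^ 2 * (M + subharmonicDefect U p w)) z ρ :=
    Continuous.circleIntegrable' (continuous_const.mul
      (continuous_const.add continuous_subharmonicDefect))
  have hle := Real.circleAverage_mono (f₁ := fun w => 2 / s0 * (conj (h z) * h w).re -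
      ‖h z‖ ^ 2 / s0 ^ 2 * (M + subharmonicDefect U p w)) (hfi.sub hgi)
    (ContinuousOn.circleIntegrable' ((continuousOn_norm_sq_div hM h0 hh.continuous).mono hρ)) hpt
  refine le_trans (le_of_le_of_eq (b := ‖h z‖ ^ 2 / s0 + ‖h z‖ ^ 2 / s0 ^ 2 * D) ?_ ?_) hle
  · gcongr
    nlinarith
  · rw [Real.circleAverage_fun_sub hfi hgi]
    have e1 := Real.circleAverage_fun_smul (a := 2 / s0) (f := fun w => (conj (h z) * h w).re)
      (c := z) (R := ρ)
    have e2 := Real.circleAverage_fun_smul (a := ‖h z‖ ^ 2 / s0 ^ 2)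
      (f := fun w => M + subharmonicDefect U p w) (c := z) (R := ρ)
    simp only [smul_eq_mul] at e1 e2
    rw [e1, e2, circleAverage_re_of_differentiable (hh.const_mul _), re_conj_mul_self,
      circleAverage_const_add_subharmonicDefect, ← hD, ← hs0]
    field_simp
    ring

end Defect

section Hankel

variable {U p : Polynomial ℂ} {M N : ℝ}

theorem circleAverage_le_of_norm_le {E : Type*} [NormedAddCommGroup E] {f : ℂ → E} {z : ℂ}
    {ρ L : ℝ} {n : ℕ} (hf : Continuous f) (hL : ∀ w ∈ sphere z |ρ|, ‖f w‖ ≤ L) :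
    Real.circleAverage (fun w => ‖f w‖ ^ n) z ρ ≤ L ^ n :=
  Real.circleAverage_mono_on_of_le_circle (hf.norm.pow n).circleIntegrable' fun w hw =>
    pow_le_pow_left₀ (norm_nonneg _) (hL w hw) n

theorem circleAverage_const_mul (c : ℝ) (f : ℂ → ℝ) (z : ℂ) (ρ : ℝ) :
    Real.circleAverage (fun w => c * f w) z ρ = c * Real.circleAverage f z ρ := by
  simpa only [smul_eq_mul] using Real.circleAverage_fun_smul (a := c) (f := f) (c := z) (R := ρ)

/-- Here `|g|⁴ = |g²|²` with `g²` analytic, and the increment of `g²` is `(g w - g z) (2 g z + (g w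
- g z))`. On small circles `L` is of order `ρ`, so `2 L⁴` is negligible against `ρ³`. -/
theorem circleAverage_norm_pow_four_le {g : ℂ → ℂ} (hg : Differentiable ℂ g) {z : ℂ} {ρ L : ℝ}
    (hL : ∀ w ∈ sphere z |ρ|, ‖g w - g z‖ ≤ L) :
    Real.circleAverage (fun w => ‖g w‖ ^ 4) z ρ ≤ ‖g z‖ ^ 4 +
      8 * ‖g z‖ ^ 2 * Real.circleAverage (fun w => ‖g w - g z‖ ^ 2) z ρ + 2 * L ^ 4 := by
  have hd : Continuous fun w => g w - g z := hg.continuous.sub continuous_const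
  have h1 := circleAverage_norm_sq (z := z) (ρ := ρ) (hg.pow 2)
  simp only [norm_pow, ← pow_mul, Nat.reduceMul, Pi.pow_apply] at h1
  have h2 : Real.circleAverage (fun w => ‖g w ^ 2 - g z ^ 2‖ ^ 2) z ρ ≤
      Real.circleAverage (fun w => 8 * ‖g z‖ ^ 2 * ‖g w - g z‖ ^ 2 + 2 * ‖g w - g z‖ ^ 4) z ρ := by
    refine Real.circleAverage_mono
      (Continuous.circleIntegrable' (((hg.continuous.pow 2).sub continuous_const).norm.pow 2))
      (Continuous.circleIntegrable' ((continuous_const.mul (hd.norm.pow 2)).add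
        (continuous_const.mul (hd.norm.pow 4)))) fun w _ => ?_
    have e : g w ^ 2 - g z ^ 2 = (g w - g z) * (2 * g z + (g w - g z)) := by ring
    have h3 : ‖2 * g z + (g w - g z)‖ ≤ 2 * ‖g z‖ + ‖g w - g z‖ := by
      refine (norm_add_le _ _).trans ?_
      rw [norm_mul, Complex.norm_ofNat]
    rw [e, norm_mul, mul_pow]
    have h4 := pow_le_pow_left₀ (norm_nonneg _) h3 2
    have h5 : (2 * ‖g z‖ + ‖g w - g z‖) ^ 2 ≤ 8 * ‖g z‖ ^ 2 + 2 * ‖g w - g z‖ ^ 2 := by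
      nlinarith [sq_nonneg (2 * ‖g z‖ - ‖g w - g z‖)]
    nlinarith [mul_le_mul_of_nonneg_left (h4.trans h5) (sq_nonneg ‖g w - g z‖)]
  have hi1 : CircleIntegrable (fun w => 8 * ‖g z‖ ^ 2 * ‖g w - g z‖ ^ 2) z ρ :=
    Continuous.circleIntegrable' (continuous_const.mul (hd.norm.pow 2))
  have hi2 : CircleIntegrable (fun w => 2 * ‖g w - g z‖ ^ 4) z ρ :=
    Continuous.circleIntegrable' (continuous_const.mul (hd.norm.pow 4))
  rw [Real.circleAverage_fun_add hi1 hi2, circleAverage_const_mul, circleAverage_const_mul] at h2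
  have h6 := circleAverage_le_of_norm_le (n := 4) hd hL
  linarith

/-- A reverse Hölder inequality in the role of John–Nirenberg. Since `32 M² / (4 M²) = 8`, the gain
of `32 M² |g|² / (M + G)` offsets the growth of `|g|⁴`, and their difference obeys `le_poissonMean`.
The difference vanishes at `lam`, where `g = 0`, and equals `32 M |g|² - |g|⁴` on the circle, where
`G = 0`. -/
theorem poissonMean_norm_pow_four_le (hM : 0 < M)
    (hU : ∀ ζ ∈ sphere (0 : ℂ) 1, (U.eval ζ).re = ‖p.eval ζ‖ ^ 2)
    (h1 : ∀ z ∈ closedBall (0 : ℂ) 1, subharmonicDefect U p z ≤ M) {lam : ℂ}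
    (hl : lam ∈ ball (0 : ℂ) 1) :
    poissonMean lam (fun ζ => ‖p.eval ζ - p.eval lam‖ ^ 4) ≤
      32 * M * poissonMean lam fun ζ => ‖p.eval ζ - p.eval lam‖ ^ 2 := by
  have h0 : ∀ z ∈ closedBall (0 : ℂ) 1, 0 ≤ subharmonicDefect U p z :=
    fun z hz => subharmonicDefect_nonneg hU hz
  obtain ⟨L, hL0, hL⟩ := p.exists_lipschitz_closedBall
  set g : ℂ → ℂ := fun w => p.eval w - p.eval lam with hg
  have hgd : Differentiable ℂ g := p.differentiable.sub_const _
  have hgg : ∀ w z, g w - g z = p.eval w - p.eval z := fun w z => by simp [hg]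
  have hc1 : ContinuousOn (fun w => 32 * M ^ 2 * (‖g w‖ ^ 2 / (M + subharmonicDefect U p w)))
      (closedBall 0 1) := continuousOn_const.mul (continuousOn_norm_sq_div hM h0 hgd.continuous)
  have hc2 : Continuous fun w => -1 * ‖g w‖ ^ 4 := continuous_const.mul (hgd.continuous.norm.pow 4)
  have key := le_poissonMean (v := fun w =>
    32 * M ^ 2 * (‖g w‖ ^ 2 / (M + subharmonicDefect U p w)) + -1 * ‖g w‖ ^ 4)
    (hc1.add hc2.continuousOn) ?_ hl
  · rw [poissonMean_add hl (hc1.mono sphere_subset_closedBall) hc2.continuousOn,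
      poissonMean_const_mul (-1)] at key
    have e : poissonMean lam (fun w => 32 * M ^ 2 * (‖g w‖ ^ 2 / (M + subharmonicDefect U p w))) =
        32 * M * poissonMean lam fun ζ => ‖g ζ‖ ^ 2 := by
      rw [← poissonMean_const_mul]
      refine poissonMean_congr fun ζ hζ => ?_
      rw [subharmonicDefect_of_mem_sphere hU hζ]
      field_simp
      ring
    have hgl : g lam = 0 := sub_self _
    rw [e, hgl] at key
    simp only [norm_zero] at key
    norm_num at key
    exact key
  · intro z hz
    have hr : 0 < 1 - ‖z‖ := by have := mem_ball_zero_iff.1 hz; linarith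
    refine ⟨2 * L ^ 4, min 1 (1 - ‖z‖), by positivity, fun ρ hρ0 hρ => ?_⟩
    have hsub := sphere_subset_closedBall_zero hρ0 (hρ.trans_le (min_le_right _ _))
    have hρ1 : ρ < 1 := hρ.trans_le (min_le_left _ _)
    have hz' := ball_subset_closedBall hz
    have k1 := add_le_circleAverage_norm_sq_div hM h0 h1 hgd hz' hsub
    have k2 := circleAverage_norm_pow_four_le hgd (z := z) (ρ := ρ) (L := L * ρ) fun w hw => by
      rw [hgg]
      refine (hL z hz' w (hsub hw)).trans_eq ?_
      rw [mem_sphere_iff_norm.1 hw, abs_of_pos hρ0]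
    simp only [hgg] at k2
    rw [Real.circleAverage_fun_add (ContinuousOn.circleIntegrable' (hc1.mono hsub))
      hc2.circleIntegrable', circleAverage_const_mul, circleAverage_const_mul]
    have k3 := mul_le_mul_of_nonneg_left k1 (show 0 ≤ 32 * M ^ 2 by positivity)
    have e : 32 * M ^ 2 * (‖g z‖ ^ 2 / (4 * M ^ 2) *
        Real.circleAverage (fun w => ‖p.eval w - p.eval z‖ ^ 2) z ρ) = 8 * ‖g z‖ ^ 2 *
        Real.circleAverage (fun w => ‖p.eval w - p.eval z‖ ^ 2) z ρ := by
      field_simp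
      ring
    rw [mul_add, e] at k3
    have h4 : 2 * (L * ρ) ^ 4 ≤ 2 * L ^ 4 * ρ ^ 3 := by
      have : ρ ^ 4 ≤ ρ ^ 3 := pow_le_pow_of_le_one hρ0.le hρ1.le (by norm_num)
      calc 2 * (L * ρ) ^ 4 = 2 * L ^ 4 * ρ ^ 4 := by ring
        _ ≤ _ := by gcongr
    linarith

/-- Use `t² ≤ 8 √M t + t⁴ / (64 M)`: the first term suffices for `t ≤ 8 √M`, the second otherwise.
By the fourth power bound the second term contributes at most half of the variance and is absorbed,
which doubles `8 √M N`. -/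
theorem subharmonicDefect_le_sqrt_mul (hM : 0 < M)
    (hU : ∀ ζ ∈ sphere (0 : ℂ) 1, (U.eval ζ).re = ‖p.eval ζ‖ ^ 2)
    (h1 : ∀ z ∈ closedBall (0 : ℂ) 1, subharmonicDefect U p z ≤ M) {lam : ℂ}
    (hl : lam ∈ ball (0 : ℂ) 1)
    (hN : poissonMean lam (fun ζ => ‖p.eval ζ - p.eval lam‖) ≤ N) :
    subharmonicDefect U p lam ≤ 16 * √M * N := by
  have hs : 0 < √M := Real.sqrt_pos.2 hM
  have hss : √M ^ 2 = M := Real.sq_sqrt hM.le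
  have k1 := poissonMean_norm_pow_four_le hM hU h1 hl
  rw [subharmonicDefect_eq_poissonMean hU hl]
  have hc : Continuous fun ζ => ‖p.eval ζ - p.eval lam‖ :=
    (p.continuous.sub continuous_const).norm
  have k2 : poissonMean lam (fun ζ => ‖p.eval ζ - p.eval lam‖ ^ 2) ≤
      poissonMean lam (fun ζ => 8 * √M * ‖p.eval ζ - p.eval lam‖ +
        1 / (64 * M) * ‖p.eval ζ - p.eval lam‖ ^ 4) := by
    refine poissonMean_mono hl (hc.pow 2).continuousOn ((continuous_const.mul hc).add
      (continuous_const.mul (hc.pow 4))).continuousOn fun ζ _ => ?_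
    set t := ‖p.eval ζ - p.eval lam‖ with ht
    have ht0 : 0 ≤ t := norm_nonneg _
    have e : 1 / (64 * M) * t ^ 4 = t ^ 2 * (t / (8 * √M)) ^ 2 := by
      rw [div_pow, mul_pow, hss]
      field_simp
      ring
    rw [e]
    rcases le_total t (8 * √M) with h | h
    · have : 0 ≤ t ^ 2 * (t / (8 * √M)) ^ 2 := by positivity
      nlinarith
    · have h2 : 1 ≤ t / (8 * √M) := by rwa [one_le_div (by positivity)]
      have h3 : 0 ≤ 8 * √M * t := by positivity
      nlinarith [sq_nonneg t, one_le_pow₀ h2 (n := 2)]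
  have hc1 : Continuous fun ζ => 8 * √M * ‖p.eval ζ - p.eval lam‖ := continuous_const.mul hc
  have hc2 : Continuous fun ζ => 1 / (64 * M) * ‖p.eval ζ - p.eval lam‖ ^ 4 :=
    continuous_const.mul (hc.pow 4)
  rw [poissonMean_add hl hc1.continuousOn hc2.continuousOn, poissonMean_const_mul,
    poissonMean_const_mul] at k2
  have k3 := mul_le_mul_of_nonneg_left k1 (show 0 ≤ 1 / (64 * M) by positivity)
  have e : 1 / (64 * M) * (32 * M * poissonMean lam fun ζ => ‖p.eval ζ - p.eval lam‖ ^ 2) =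
      1 / 2 * poissonMean lam fun ζ => ‖p.eval ζ - p.eval lam‖ ^ 2 := by
    field_simp
    ring
  have k4 := mul_le_mul_of_nonneg_left hN (show 0 ≤ 8 * √M by positivity)
  rw [e] at k3
  linarith

/-- Take `M` to be the maximum of the defect itself, attained in the open disk if positive. Then `M
≤ 16 √M N`, and `√M` can be divided out. -/
theorem subharmonicDefect_le_of_poissonMean_le
    (hU : ∀ ζ ∈ sphere (0 : ℂ) 1, (U.eval ζ).re = ‖p.eval ζ‖ ^ 2)
    (hN : ∀ lam ∈ ball (0 : ℂ) 1, poissonMean lam (fun ζ => ‖p.eval ζ - p.eval lam‖) ≤ N)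
    {z : ℂ} (hz : z ∈ closedBall (0 : ℂ) 1) : subharmonicDefect U p z ≤ 256 * N ^ 2 := by
  obtain ⟨z0, hz0, hmax⟩ := (isCompact_closedBall (0 : ℂ) 1).exists_isMaxOn ⟨0, by simp⟩
    (continuous_subharmonicDefect (U := U) (p := p)).continuousOn
  refine (hmax hz).trans ?_
  rcases le_or_gt (subharmonicDefect U p z0) 0 with h | h
  · exact h.trans (by positivity)
  · have hb : z0 ∈ ball (0 : ℂ) 1 := by
      rw [← ball_union_sphere] at hz0
      refine hz0.resolve_right fun hs => ?_
      rw [subharmonicDefect_of_mem_sphere hU hs] at h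
      exact lt_irrefl _ h
    have k := subharmonicDefect_le_sqrt_mul h hU (fun w hw => hmax hw) hb (hN z0 hb)
    set M := subharmonicDefect U p z0
    have hs : 0 < √M := Real.sqrt_pos.2 h
    have hss : √M ^ 2 = M := Real.sq_sqrt h.le
    have : √M ≤ 16 * N := by nlinarith
    nlinarith

theorem poissonMean_zero {v : ℂ → ℝ} : poissonMean 0 v = Real.circleAverage v 0 1 :=
  Real.circleAverage_congr_sphere fun ζ hζ => by
    have h1 : ‖ζ‖ = 1 := by simpa using hζ
    simp [poissonKernel, h1]

theorem norm_conj_mul_sub_le {x g0 h0 dg dh : ℂ} {α : ℝ} (hα : 0 < α) :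
    -(conj x * ((g0 + dg) * (h0 + dh) - g0 * h0)).re ≤
      α / 2 * (‖dg‖ ^ 2 + ‖dh‖ ^ 2) + 1 / (2 * α) * ((‖g0‖ ^ 2 + ‖h0‖ ^ 2) * ‖x‖ ^ 2) +
        ‖x‖ * ‖dg‖ * ‖dh‖ := by
  have e : (g0 + dg) * (h0 + dh) - g0 * h0 = g0 * dh + h0 * dg + dg * dh := by ring
  have h1 : -(conj x * (g0 * dh + h0 * dg + dg * dh)).re ≤
      ‖x‖ * (‖g0‖ * ‖dh‖ + ‖h0‖ * ‖dg‖ + ‖dg‖ * ‖dh‖) := by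
    refine (neg_le_abs _).trans ((Complex.abs_re_le_norm _).trans ?_)
    rw [norm_mul, RCLike.norm_conj]
    gcongr
    refine (norm_add₃_le).trans_eq ?_
    simp only [norm_mul]
  have h2 : ∀ s t : ℝ, s * t ≤ α / 2 * t ^ 2 + 1 / (2 * α) * s ^ 2 := fun s t => by
    have : 0 ≤ (α * t - s) ^ 2 / (2 * α) := by positivity
    have e : (α * t - s) ^ 2 / (2 * α) = α / 2 * t ^ 2 + 1 / (2 * α) * s ^ 2 - s * t := by
      field_simp
      ring
    linarith
  have h3 := h2 (‖x‖ * ‖g0‖) ‖dh‖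
  have h4 := h2 (‖x‖ * ‖h0‖) ‖dg‖
  rw [e]
  nlinarith

/-- The half of Fefferman duality needed here. The increment of `R` is controlled by Young's
inequality with `α = 2 √M`. Its terms `√M (|dg|² + |dh|²)` and `(|g|² + |h|²) |dp|² / (4 √M)` are
exactly the gains of the two summands of `W`, and the triple product of increments is `O(ρ³)`. Hence
`R + W g + W h` obeys the maximum principle, which is then applied at `0`, where `R = 0`. -/
theorem neg_circleAverage_re_conj_sub_mul_le (hM : 0 < M)
    (hU : ∀ ζ ∈ sphere (0 : ℂ) 1, (U.eval ζ).re = ‖p.eval ζ‖ ^ 2)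
    (h1 : ∀ z ∈ closedBall (0 : ℂ) 1, subharmonicDefect U p z ≤ M) (g h : Polynomial ℂ) :
    -Real.circleAverage (fun w => (conj (p.eval w - p.eval 0) * (g.eval w * h.eval w)).re) 0 1 ≤
      2 * √M * (Real.circleAverage (fun w => ‖g.eval w‖ ^ 2) 0 1 +
        Real.circleAverage (fun w => ‖h.eval w‖ ^ 2) 0 1) := by
  have h0 : ∀ z ∈ closedBall (0 : ℂ) 1, 0 ≤ subharmonicDefect U p z :=
    fun z hz => subharmonicDefect_nonneg hU hz
  have hs : 0 < √M := Real.sqrt_pos.2 hM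
  have hss : √M ^ 2 = M := Real.sq_sqrt hM.le
  obtain ⟨L, hL0, hL⟩ := p.exists_lipschitz_closedBall
  obtain ⟨Lg, hLg0, hLg⟩ := g.exists_lipschitz_closedBall
  obtain ⟨Lh, hLh0, hLh⟩ := h.exists_lipschitz_closedBall
  have hPd : Differentiable ℂ fun w => p.eval w - p.eval 0 := p.differentiable.sub_const _
  have hFd : Differentiable ℂ fun w => g.eval w * h.eval w := g.differentiable.mul h.differentiable
  set R : ℂ → ℝ := fun w => (conj (p.eval w - p.eval 0) * (g.eval w * h.eval w)).re with hR
  have hRc : Continuous R := Complex.continuous_re.comp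
    ((Complex.continuous_conj.comp hPd.continuous).mul hFd.continuous)
  have hquad : ∀ q : Polynomial ℂ, Continuous fun w => √M * ‖q.eval w‖ ^ 2 :=
    fun q => continuous_const.mul (q.continuous.norm.pow 2)
  have hdiv : ∀ q : Polynomial ℂ, ContinuousOn
      (fun w => M * √M * (‖q.eval w‖ ^ 2 / (M + subharmonicDefect U p w))) (closedBall 0 1) :=
    fun q => continuousOn_const.mul (continuousOn_norm_sq_div hM h0 q.continuous)
  set W : Polynomial ℂ → ℂ → ℝ := fun q w =>
    √M * ‖q.eval w‖ ^ 2 + M * √M * (‖q.eval w‖ ^ 2 / (M + subharmonicDefect U p w)) with hW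
  have hWc : ∀ q, ContinuousOn (W q) (closedBall 0 1) := fun q =>
    (hquad q).continuousOn.add (hdiv q)
  have hWWc : ContinuousOn (fun w => W g w + W h w) (closedBall 0 1) := (hWc g).add (hWc h)
  have hW0 : ∀ q, 0 ≤ W q 0 := fun q => by
    have := h0 0 (by simp)
    simp only [hW]
    positivity
  have hWs : ∀ q, Real.circleAverage (W q) 0 1 =
      2 * √M * Real.circleAverage (fun w => ‖q.eval w‖ ^ 2) 0 1 := fun q => by
    rw [← circleAverage_const_mul]
    refine Real.circleAverage_congr_sphere fun ζ hζ => ?_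
    simp only [hW]
    rw [subharmonicDefect_of_mem_sphere hU (by simpa using hζ)]
    field_simp
    ring
  have hWloc : ∀ q : Polynomial ℂ, ∀ z ∈ closedBall (0 : ℂ) 1, ∀ ρ : ℝ,
      sphere z |ρ| ⊆ closedBall (0 : ℂ) 1 →
      W q z + √M * Real.circleAverage (fun w => ‖q.eval w - q.eval z‖ ^ 2) z ρ +
        1 / (4 * √M) * ‖q.eval z‖ ^ 2 *
          Real.circleAverage (fun w => ‖p.eval w - p.eval z‖ ^ 2) z ρ ≤
      Real.circleAverage (W q) z ρ := fun q z hz ρ hsub => by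
    have k1 := add_le_circleAverage_norm_sq_div hM h0 h1 q.differentiable hz hsub
    have k2 := circleAverage_norm_sq (z := z) (ρ := ρ) q.differentiable
    simp only [hW]
    rw [Real.circleAverage_fun_add (hquad q).circleIntegrable'
      (ContinuousOn.circleIntegrable' ((hdiv q).mono hsub)), circleAverage_const_mul,
      circleAverage_const_mul, k2]
    have k3 := mul_le_mul_of_nonneg_left k1 (show 0 ≤ M * √M by positivity)
    have e : M * √M * (‖q.eval z‖ ^ 2 / (4 * M ^ 2) *
        Real.circleAverage (fun w => ‖p.eval w - p.eval z‖ ^ 2) z ρ) =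
        1 / (4 * √M) * ‖q.eval z‖ ^ 2 *
        Real.circleAverage (fun w => ‖p.eval w - p.eval z‖ ^ 2) z ρ := by
      field_simp
      rw [hss]
    rw [mul_add, e] at k3
    linarith
  have key := le_poissonMean (v := fun w => R w + (W g w + W h w)) (hRc.continuousOn.add hWWc) ?_
    (mem_ball_self one_pos)
  · have hsub : sphere (0 : ℂ) |1| ⊆ closedBall 0 1 := by
      rw [abs_one]; exact sphere_subset_closedBall
    rw [poissonMean_zero, Real.circleAverage_fun_add hRc.circleIntegrable'
      (ContinuousOn.circleIntegrable' (hWWc.mono hsub)), Real.circleAverage_fun_add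
      (ContinuousOn.circleIntegrable' ((hWc g).mono hsub))
      (ContinuousOn.circleIntegrable' ((hWc h).mono hsub)), hWs, hWs] at key
    have hR0 : R 0 = 0 := by simp [hR]
    have := hW0 g
    have := hW0 h
    linarith
  · intro z hz
    have hr : 0 < 1 - ‖z‖ := by have := mem_ball_zero_iff.1 hz; linarith
    refine ⟨L * Lg * Lh, 1 - ‖z‖, hr, fun ρ hρ0 hρ => ?_⟩
    have hsub := sphere_subset_closedBall_zero hρ0 hρ
    have hz' := ball_subset_closedBall hz
    have kR := circleAverage_re_conj_mul (z := z) (ρ := ρ) hPd hFd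
    simp only [sub_sub_sub_cancel_right] at kR
    rw [Real.circleAverage_fun_add hRc.circleIntegrable'
      (ContinuousOn.circleIntegrable' (hWWc.mono hsub)), Real.circleAverage_fun_add
      (ContinuousOn.circleIntegrable' ((hWc g).mono hsub))
      (ContinuousOn.circleIntegrable' ((hWc h).mono hsub))]
    have kg := hWloc g z hz' ρ hsub
    have kh := hWloc h z hz' ρ hsub
    have hdc : ∀ q : Polynomial ℂ, Continuous fun w => ‖q.eval w - q.eval z‖ ^ 2 :=
      fun q => (q.continuous.sub continuous_const).norm.pow 2
    set E : ℂ → ℝ := fun w => √M * ‖g.eval w - g.eval z‖ ^ 2 + (√M * ‖h.eval w - h.eval z‖ ^ 2 +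
      (1 / (4 * √M) * (‖g.eval z‖ ^ 2 + ‖h.eval z‖ ^ 2) * ‖p.eval w - p.eval z‖ ^ 2 +
        L * Lg * Lh * ρ ^ 3)) with hE
    have c1 : Continuous fun w => √M * ‖g.eval w - g.eval z‖ ^ 2 := continuous_const.mul (hdc g)
    have c2 : Continuous fun w => √M * ‖h.eval w - h.eval z‖ ^ 2 := continuous_const.mul (hdc h)
    have c3 : Continuous fun w => 1 / (4 * √M) * (‖g.eval z‖ ^ 2 + ‖h.eval z‖ ^ 2) *
        ‖p.eval w - p.eval z‖ ^ 2 := continuous_const.mul (hdc p)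
    have c4 : Continuous fun _ : ℂ => L * Lg * Lh * ρ ^ 3 := continuous_const
    have c34 : Continuous fun w => 1 / (4 * √M) * (‖g.eval z‖ ^ 2 + ‖h.eval z‖ ^ 2) *
        ‖p.eval w - p.eval z‖ ^ 2 + L * Lg * Lh * ρ ^ 3 := c3.add c4
    have c234 : Continuous fun w => √M * ‖h.eval w - h.eval z‖ ^ 2 +
        (1 / (4 * √M) * (‖g.eval z‖ ^ 2 + ‖h.eval z‖ ^ 2) * ‖p.eval w - p.eval z‖ ^ 2 +
          L * Lg * Lh * ρ ^ 3) := c2.add c34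
    have hcross : Real.circleAverage (fun w => -1 * (conj (p.eval w - p.eval z) *
        (g.eval w * h.eval w - g.eval z * h.eval z)).re) z ρ ≤ Real.circleAverage E z ρ := by
      refine Real.circleAverage_mono (Continuous.circleIntegrable' (continuous_const.mul
        (Complex.continuous_re.comp ((Complex.continuous_conj.comp
          (p.continuous.sub continuous_const)).mul (hFd.continuous.sub continuous_const)))))
        (c1.add c234).circleIntegrable' fun w hw => ?_
      have hwz : ‖w - z‖ = ρ := by rw [mem_sphere_iff_norm.1 hw, abs_of_pos hρ0]
      have b1 := hL z hz' w (hsub hw)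
      have b2 := hLg z hz' w (hsub hw)
      have b3 := hLh z hz' w (hsub hw)
      rw [hwz] at b1 b2 b3
      have k := norm_conj_mul_sub_le (x := p.eval w - p.eval z) (g0 := g.eval z) (h0 := h.eval z)
        (dg := g.eval w - g.eval z) (dh := h.eval w - h.eval z) (α := 2 * √M) (by positivity)
      rw [add_sub_cancel, add_sub_cancel] at k
      have b : ‖p.eval w - p.eval z‖ * ‖g.eval w - g.eval z‖ * ‖h.eval w - h.eval z‖ ≤
          L * ρ * (Lg * ρ) * (Lh * ρ) := by gcongr
      have e2 : 1 / (2 * (2 * √M)) = 1 / (4 * √M) := by ring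
      rw [e2] at k
      simp only [hE]
      linarith
    rw [circleAverage_const_mul, Real.circleAverage_fun_add c1.circleIntegrable'
      c234.circleIntegrable', Real.circleAverage_fun_add c2.circleIntegrable'
      c34.circleIntegrable', Real.circleAverage_fun_add c3.circleIntegrable'
      c4.circleIntegrable', circleAverage_const_mul, circleAverage_const_mul,
      circleAverage_const_mul, Real.circleAverage_const] at hcross
    simp only [hR]
    rw [kR]
    linarith

/-- A polynomial whose mean oscillation with respect to every Poisson kernel is at most `N` defines
a bounded Hankel form. -/
theorem hankelBound_of_poissonMean_le (hN0 : 0 < N)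
    (hN : ∀ lam ∈ ball (0 : ℂ) 1, poissonMean lam (fun ζ => ‖p.eval ζ - p.eval lam‖) ≤ N) :
    HankelBound p (64 * N + ‖p.eval 0‖) := by
  obtain ⟨U, hU⟩ := exists_polynomial_re_eq_norm_sq p
  have hM : 0 < 256 * N ^ 2 := by positivity
  have hsq : √(256 * N ^ 2) = 16 * N := by
    rw [show 256 * N ^ 2 = (16 * N) ^ 2 by ring, Real.sqrt_sq (by positivity)]
  have h1 := fun z (hz : z ∈ closedBall (0 : ℂ) 1) => subharmonicDefect_le_of_poissonMean_le hU hN hz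
  have key : ∀ g h : Polynomial ℂ,
      -(Real.circleAverage (fun w => conj (p.eval w - p.eval 0) * (g.eval w * h.eval w)) 0 1).re ≤
        32 * N * (‖polyVec g‖ ^ 2 + ‖polyVec h‖ ^ 2) := fun g h => by
    have k := neg_circleAverage_re_conj_sub_mul_le hM hU h1 g h
    have hc : Continuous fun w => conj (p.eval w - p.eval 0) * (g.eval w * h.eval w) :=
      (Complex.continuous_conj.comp (p.continuous.sub continuous_const)).mul
        (g.continuous.mul h.continuous)
    rw [circleAverage_re hc.circleIntegrable', hsq, ← norm_polyVec_sq, ← norm_polyVec_sq] at k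
    linarith
  intro g h
  set B := Real.circleAverage (fun w => conj (p.eval w - p.eval 0) * (g.eval w * h.eval w)) 0 1
    with hB
  have hBle : ‖B‖ ≤ 64 * N * ‖polyVec g‖ * ‖polyVec h‖ := by
    rcases eq_or_ne B 0 with h0 | h0
    · rw [h0, norm_zero]; positivity
    have hBp : 0 < ‖B‖ := norm_pos_iff.2 h0
    -- Substituting `-t conj(B) g` for `g` makes the left side of `key` equal to `t ‖B‖²`. The
    -- discriminant in `t` converts the bound by a sum of squares into one by a product.
    have hquad : ∀ t : ℝ, 0 ≤ 32 * N * (‖B‖ ^ 2 * ‖polyVec g‖ ^ 2) * (t * t) + -‖B‖ ^ 2 * t +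
        32 * N * ‖polyVec h‖ ^ 2 := fun t => by
      have k := key ((-(t : ℂ) * conj B) • g) h
      have e : Real.circleAverage (fun w => conj (p.eval w - p.eval 0) *
          (((-(t : ℂ) * conj B) • g).eval w * h.eval w)) 0 1 = (-(t : ℂ) * conj B) * B := by
        rw [hB, ← smul_eq_mul _ (Real.circleAverage _ 0 1), ← Real.circleAverage_fun_smul]
        congr 1
        ext w
        simp only [Polynomial.eval_smul, smul_eq_mul]
        ring
      rw [e, mul_assoc, ← Complex.ofReal_neg, Complex.re_ofReal_mul, re_conj_mul_self, polyVec_smul,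
        norm_smul, norm_mul, RCLike.norm_conj, Complex.norm_real, norm_neg, mul_pow, mul_pow,
        Real.norm_eq_abs, sq_abs] at k
      nlinarith
    have hd := discrim_le_zero hquad
    rw [discrim] at hd
    have h2 : ‖B‖ ^ 2 ≤ (64 * N * ‖polyVec g‖ * ‖polyVec h‖) ^ 2 := by
      have h3 : 0 < ‖B‖ ^ 2 := by positivity
      refine le_of_mul_le_mul_left ?_ h3
      nlinarith
    exact le_of_sq_le_sq h2 (by positivity)
  have hgh : Differentiable ℂ fun w => conj (p.eval 0) * (g.eval w * h.eval w) :=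
    (g.differentiable.mul h.differentiable).const_mul _
  have hA : inner ℂ (polyVec p) (polyVec (g * h)) =
      B + conj (p.eval 0) * (g.eval 0 * h.eval 0) := by
    rw [inner_polyVec, hB, ← circleAverage_of_differentiable (z := 0) (ρ := 1) hgh,
      ← Real.circleAverage_fun_add]
    · congr 1
      ext w
      rw [Polynomial.eval_mul, map_sub]
      ring
    · exact Continuous.circleIntegrable' ((Complex.continuous_conj.comp
        (p.continuous.sub continuous_const)).mul (g.continuous.mul h.continuous))
    · exact hgh.continuous.circleIntegrable'
  have hev : ∀ q : Polynomial ℂ, ‖q.eval 0‖ ≤ ‖polyVec q‖ := fun q => by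
    rw [← Polynomial.coeff_zero_eq_eval_zero, ← polyVec_apply]
    exact lp.norm_apply_le_norm (by norm_num) _ 0
  rw [hA]
  refine (norm_add_le _ _).trans ?_
  rw [norm_mul, norm_mul, RCLike.norm_conj]
  have := mul_le_mul (hev g) (hev h) (norm_nonneg _) (norm_nonneg _)
  have := mul_le_mul_of_nonneg_left this (norm_nonneg (p.eval 0))
  linarith

end Hankel

/-! ### Mean oscillation over arcs controls mean oscillation for Poisson kernels -/

section Arcs

/-- The mean of a function over the interval `[-h, h]`. -/
noncomputable def symmMean (h : ℝ) (w : ℝ → ℝ) : ℝ := (2 * h)⁻¹ * ∫ s in -h..h, w s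

variable {v w : ℝ → ℝ} {h : ℝ}

theorem symmMean_mono (hh : 0 < h) (hv : Continuous v) (hw : Continuous w) (hvw : ∀ s, v s ≤ w s) :
    symmMean h v ≤ symmMean h w :=
  mul_le_mul_of_nonneg_left (intervalIntegral.integral_mono (by linarith)
    (hv.intervalIntegrable _ _) (hw.intervalIntegrable _ _) hvw) (by positivity)

theorem symmMean_add_const (hh : 0 < h) (hv : Continuous v) (c : ℝ) :
    symmMean h (fun s => v s + c) = symmMean h v + c := by
  rw [symmMean, symmMean, intervalIntegral.integral_add (hv.intervalIntegrable _ _)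
    (by simp), intervalIntegral.integral_const, smul_eq_mul]
  field_simp
  ring

theorem symmMean_half_le (hh : 0 < h) (hv : Continuous v) (h0 : ∀ s, 0 ≤ v s) :
    symmMean (h / 2) v ≤ 2 * symmMean h v := by
  have : ∫ s in -(h / 2)..h / 2, v s ≤ ∫ s in -h..h, v s :=
    intervalIntegral.integral_mono_interval (by linarith) (by linarith) (by linarith)
      (Eventually.of_forall h0) (hv.intervalIntegrable _ _)
  rw [symmMean, symmMean, ← mul_assoc, show 2 * (2 * h)⁻¹ = (2 * (h / 2))⁻¹ by field_simp]
  gcongr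

/-- The combination `∑ 2 ^ (k - n) A_k` of the means `A_k` over the intervals of radius
`π 2 ^ (-k)`, for `k ≤ n`. -/
noncomputable def dyadicMean (w : ℝ → ℝ) : ℕ → ℝ
  | 0 => symmMean Real.pi w
  | n + 1 => symmMean (Real.pi / 2 ^ (n + 1)) w + dyadicMean w n / 2

theorem dyadicMean_mono (hv : Continuous v) (hw : Continuous w) (hvw : ∀ s, v s ≤ w s) (n : ℕ) :
    dyadicMean v n ≤ dyadicMean w n := by
  induction n with
  | zero => exact symmMean_mono Real.pi_pos hv hw hvw
  | succ n ih =>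
    have := symmMean_mono (h := Real.pi / 2 ^ (n + 1)) (by positivity) hv hw hvw
    simp only [dyadicMean]
    linarith

theorem dyadicMean_add_const_le (hv : Continuous v) {c : ℝ} (hc : 0 ≤ c) (n : ℕ) :
    dyadicMean (fun s => v s + c) n ≤ dyadicMean v n + 2 * c := by
  induction n with
  | zero =>
    simp only [dyadicMean]
    rw [symmMean_add_const Real.pi_pos hv]
    linarith
  | succ n ih =>
    simp only [dyadicMean]
    rw [symmMean_add_const (by positivity) hv]
    linarith

/-- The density of `dyadicMean` with respect to normalized Lebesgue measure on `[-π, π]`. -/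
noncomputable def dyadicKernel (s : ℝ) : ℕ → ℝ
  | 0 => 1
  | n + 1 => (Set.Ioc (-(Real.pi / 2 ^ (n + 1))) (Real.pi / 2 ^ (n + 1))).indicator
      (fun _ => 2 ^ (n + 1)) s + dyadicKernel s n / 2

theorem dyadicKernel_nonneg (s : ℝ) (n : ℕ) : 0 ≤ dyadicKernel s n := by
  induction n with
  | zero => exact zero_le_one
  | succ n ih =>
    have : 0 ≤ (Set.Ioc (-(Real.pi / 2 ^ (n + 1))) (Real.pi / 2 ^ (n + 1))).indicator
      (fun _ => (2 : ℝ) ^ (n + 1)) s := Set.indicator_nonneg (fun _ _ => by positivity) _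
    simp only [dyadicKernel]
    linarith

/-- The two regimes of a Poisson kernel at distance about `2 ^ (-n)` from the circle: height `2 ^ n`
at the peak and decay `2 ^ (-n) / s²` away from it. The second holds when `s` first leaves the
intervals, because then `|s| ≥ π / 2 ^ (n + 1)`; afterwards both of its sides are halved at each
step. -/
theorem dyadicKernel_lower_bound (s : ℝ) (n : ℕ) :
    2 ^ n ≤ dyadicKernel s n ∨ Real.pi ^ 2 / 2 ^ n ≤ 4 * s ^ 2 * dyadicKernel s n := by
  induction n with
  | zero => left; simp [dyadicKernel]
  | succ n ih =>
    simp only [dyadicKernel]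
    by_cases hs : s ∈ Set.Ioc (-(Real.pi / 2 ^ (n + 1))) (Real.pi / 2 ^ (n + 1))
    · left
      rw [Set.indicator_of_mem hs]
      have := dyadicKernel_nonneg s n
      linarith
    · right
      rw [Set.indicator_of_notMem hs, zero_add]
      rcases ih with ih | ih
      · have h1 : Real.pi / 2 ^ (n + 1) ≤ |s| := by
          by_contra hlt
          rw [not_le, abs_lt] at hlt
          exact hs ⟨hlt.1, hlt.2.le⟩
        have h2 : (Real.pi / 2 ^ (n + 1)) ^ 2 ≤ s ^ 2 := by
          rw [← sq_abs s]
          gcongr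
        calc Real.pi ^ 2 / 2 ^ (n + 1) = 4 * (Real.pi / 2 ^ (n + 1)) ^ 2 * (2 ^ n / 2) := by
              rw [div_pow, pow_succ]
              field_simp
              ring
          _ ≤ _ := by gcongr
      · rw [pow_succ 2 n, ← div_div]
        linarith

theorem integrableOn_dyadicKernel_mul (hw : Continuous w) (n : ℕ) :
    IntegrableOn (fun s => dyadicKernel s n * w s) (Set.Ioc (-Real.pi) Real.pi) := by
  have hwi : IntegrableOn w (Set.Ioc (-Real.pi) Real.pi) :=
    (hw.integrableOn_Icc).mono_set Set.Ioc_subset_Icc_self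
  induction n with
  | zero => simpa [dyadicKernel] using hwi
  | succ n ih =>
    have e : (fun s => dyadicKernel s (n + 1) * w s) = fun s =>
        (Set.Ioc (-(Real.pi / 2 ^ (n + 1))) (Real.pi / 2 ^ (n + 1))).indicator
          (fun s => 2 ^ (n + 1) * w s) s + 2⁻¹ * (dyadicKernel s n * w s) := by
      ext s
      simp only [dyadicKernel, Set.indicator_apply]
      split_ifs <;> ring
    rw [e]
    exact ((hwi.const_mul _).indicator measurableSet_Ioc).add (ih.const_mul _)

theorem integral_dyadicKernel_mul (hw : Continuous w) (n : ℕ) :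
    (2 * Real.pi)⁻¹ * ∫ s in -Real.pi..Real.pi, dyadicKernel s n * w s = dyadicMean w n := by
  induction n with
  | zero => simp [dyadicKernel, dyadicMean, symmMean]
  | succ n ih =>
    have hwi : IntegrableOn w (Set.Ioc (-Real.pi) Real.pi) :=
      (hw.integrableOn_Icc).mono_set Set.Ioc_subset_Icc_self
    have e : (fun s => dyadicKernel s (n + 1) * w s) = fun s =>
        (Set.Ioc (-(Real.pi / 2 ^ (n + 1))) (Real.pi / 2 ^ (n + 1))).indicator
          (fun s => 2 ^ (n + 1) * w s) s + 2⁻¹ * (dyadicKernel s n * w s) := by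
      ext s
      simp only [dyadicKernel, Set.indicator_apply]
      split_ifs <;> ring
    have hp : (0 : ℝ) < 2 ^ (n + 1) := by positivity
    have hle : Real.pi / 2 ^ (n + 1) ≤ Real.pi :=
      div_le_self Real.pi_pos.le (one_le_pow₀ one_le_two)
    have hsub : Set.Ioc (-(Real.pi / 2 ^ (n + 1))) (Real.pi / 2 ^ (n + 1)) ⊆
        Set.Ioc (-Real.pi) Real.pi := Set.Ioc_subset_Ioc (by linarith) hle
    rw [intervalIntegral.integral_of_le (by linarith [Real.pi_pos])] at ih ⊢
    rw [e, integral_add ((hwi.const_mul _).indicator measurableSet_Ioc)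
      ((integrableOn_dyadicKernel_mul hw n).const_mul _), setIntegral_indicator measurableSet_Ioc,
      Set.inter_eq_right.2 hsub, integral_const_mul, integral_const_mul, dyadicMean, ← ih, symmMean,
      intervalIntegral.integral_of_le (by have : 0 < Real.pi / 2 ^ (n + 1) := by positivity
                                          linarith)]
    field_simp

end Arcs

/-- The distance `d` is at least `1 - r`, and also at least `|s| / π`, because `2 |s| / π ≤ |exp(is)
- 1| ≤ d + (1 - r) ≤ 2 d`. Each bound serves one regime of `dyadicKernel_lower_bound`. -/
theorem poissonKernel_le_dyadicKernel {r θ s : ℝ} (hr0 : 0 ≤ r) {n : ℕ}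
    (hn1 : 1 / 2 ^ (n + 1) < 1 - r) (hn2 : 1 - r ≤ 1 / 2 ^ n) (hs : |s| ≤ Real.pi) :
    poissonKernel 0 (circleMap 0 r θ) (circleMap 0 1 (s + θ)) ≤ 8 * dyadicKernel s n := by
  have hδ : 0 < 1 - r := lt_trans (by positivity) hn1
  set d := ‖circleMap 0 1 (s + θ) - circleMap 0 r θ‖ with hd
  have hP : poissonKernel 0 (circleMap 0 r θ) (circleMap 0 1 (s + θ)) = (1 - r ^ 2) / d ^ 2 := by
    rw [poissonKernel]
    simp [hd]
  have hd1 : 1 - r ≤ d := by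
    have := norm_sub_norm_le (circleMap 0 1 (s + θ)) (circleMap 0 r θ)
    simpa [abs_of_nonneg hr0] using this
  have hd2 : |s| / Real.pi ≤ d := by
    have h1 : ‖circleMap 0 1 (s + θ) - circleMap 0 1 θ‖ ≤ d + (1 - r) := by
      refine (norm_sub_le_norm_sub_add_norm_sub _ (circleMap 0 r θ) _).trans ?_
      have e : circleMap 0 r θ - circleMap 0 1 θ = ((r - 1 : ℝ) : ℂ) * circleMap 0 1 θ := by
        simp [circleMap]
        ring
      rw [e, norm_mul, Complex.norm_real, Real.norm_eq_abs, abs_sub_comm, abs_of_pos hδ]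
      simp [hd]
    have h2 : ‖circleMap 0 1 (s + θ) - circleMap 0 1 θ‖ = ‖Complex.exp (Complex.I * s) - 1‖ := by
      have e : circleMap 0 1 (s + θ) - circleMap 0 1 θ =
          (Complex.exp (Complex.I * s) - 1) * circleMap 0 1 θ := by
        simp only [circleMap, zero_add, Complex.ofReal_one, one_mul, Complex.ofReal_add]
        rw [add_mul, Complex.exp_add, mul_comm Complex.I]
        ring
      rw [e, norm_mul]
      simp
    have h3 := Complex.norm_exp_I_mul_ofReal_sub_one s
    have h4 : |s| / Real.pi ≤ |Real.sin (s / 2)| := by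
      have k := Real.mul_abs_le_abs_sin (x := s / 2) (by rw [abs_div, abs_two]; linarith)
      rw [abs_div, abs_two] at k
      refine le_of_eq_of_le ?_ k
      ring
    rw [h2, h3, norm_mul, Real.norm_eq_abs, Real.norm_eq_abs, abs_two] at h1
    linarith
  have hd0 : 0 < d := hδ.trans_le hd1
  have hr2 : 1 - r ^ 2 ≤ 2 * (1 - r) := by nlinarith
  rw [hP, div_le_iff₀ (by positivity)]
  have hK := dyadicKernel_nonneg s n
  rcases dyadicKernel_lower_bound s n with h | h
  · have h1 : 1 < (1 - r) * 2 ^ (n + 1) := by rwa [div_lt_iff₀ (by positivity)] at hn1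
    rw [pow_succ] at h1
    calc 1 - r ^ 2 ≤ 2 * (1 - r) * 1 := by linarith
      _ ≤ 2 * (1 - r) * ((1 - r) * (2 ^ n * 2)) := by gcongr
      _ = 4 * 2 ^ n * (1 - r) ^ 2 := by ring
      _ ≤ 8 * dyadicKernel s n * d ^ 2 := by gcongr; norm_num
  · have h1 : Real.pi ^ 2 * (1 - r) ≤ 4 * s ^ 2 * dyadicKernel s n := by
      refine le_trans ?_ h
      rw [div_eq_mul_one_div]
      gcongr
    have h2 : s ^ 2 ≤ Real.pi ^ 2 * d ^ 2 := by
      rw [← sq_abs, ← mul_pow]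
      rw [div_le_iff₀ Real.pi_pos, mul_comm] at hd2
      gcongr
    have h3 : Real.pi ^ 2 * (1 - r) ≤ Real.pi ^ 2 * (4 * dyadicKernel s n * d ^ 2) := by
      refine h1.trans ?_
      nlinarith [mul_le_mul_of_nonneg_left h2 hK]
    have h4 := le_of_mul_le_mul_left h3 (by positivity)
    linarith

theorem poissonMean_le_dyadicMean {w : ℂ → ℝ} (hw : Continuous w) (hw0 : ∀ z, 0 ≤ w z) {r θ : ℝ}
    (hr0 : 0 ≤ r) {n : ℕ} (hn1 : 1 / 2 ^ (n + 1) < 1 - r) (hn2 : 1 - r ≤ 1 / 2 ^ n) :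
    poissonMean (circleMap 0 r θ) w ≤ 8 * dyadicMean (fun s => w (circleMap 0 1 (s + θ))) n := by
  have hr1 : r < 1 := by
    have : 0 < 1 - r := lt_trans (by positivity) hn1
    linarith
  have hl : circleMap 0 r θ ∈ ball (0 : ℂ) 1 := by simpa [abs_of_nonneg hr0] using hr1
  have hcm : Continuous fun s : ℝ => circleMap 0 1 (s + θ) :=
    (continuous_circleMap 0 1).comp (continuous_id.add continuous_const)
  set F : ℝ → ℝ := fun s => poissonKernel 0 (circleMap 0 r θ) (circleMap 0 1 (s + θ)) *
    w (circleMap 0 1 (s + θ)) with hF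
  have hFc : Continuous F := by
    refine Continuous.mul ?_ (hw.comp hcm)
    exact (continuousOn_poissonKernel_sphere hl).comp_continuous hcm fun s => by simp
  have hper : Function.Periodic F (2 * Real.pi) := fun s => by
    simp only [hF]
    rw [add_right_comm, periodic_circleMap 0 1 (s + θ)]
  have hpi := hper.intervalIntegral_add_eq 0 (-Real.pi)
  rw [zero_add, show -Real.pi + 2 * Real.pi = Real.pi by ring] at hpi
  have hwc : Continuous fun s => w (circleMap 0 1 (s + θ)) := hw.comp hcm
  rw [poissonMean, Real.circleAverage_eq_integral_add θ, smul_eq_mul, hpi,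
    ← integral_dyadicKernel_mul hwc, mul_left_comm]
  refine mul_le_mul_of_nonneg_left ?_ (by positivity)
  rw [← intervalIntegral.integral_const_mul]
  have hle : -Real.pi ≤ Real.pi := by linarith [Real.pi_pos]
  refine intervalIntegral.integral_mono_on hle (hFc.intervalIntegrable _ _) ?_ fun s hs => ?_
  · exact ((intervalIntegrable_iff_integrableOn_Ioc_of_le hle).2
      (integrableOn_dyadicKernel_mul hwc n)).const_mul 8
  · rw [← mul_assoc]
    exact mul_le_mul_of_nonneg_right (poissonKernel_le_dyadicKernel hr0 hn1 hn2 (abs_le.2 hs))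
      (hw0 _)

/-- Halving an interval moves the mean by at most `2 N`, so recentring costs at most `4 N` in
`dyadicMean`. The constant `6` is the fixed point of `(6 N + 4 N) / 2 + N = 6 N`; the geometric
weights prevent growth with `n`. -/
theorem dyadicMean_norm_sub_le {v : ℝ → ℂ} (hv : Continuous v) {N : ℝ}
    (hN : ∀ h, 0 < h → h ≤ Real.pi → meanOscillation v (-h) h ≤ N) (n : ℕ) :
    dyadicMean (fun s => ‖v s - ⨍ t in -(Real.pi / 2 ^ n)..Real.pi / 2 ^ n, v t‖) n ≤ 6 * N := by
  set c : ℕ → ℂ := fun n => ⨍ t in -(Real.pi / 2 ^ n)..Real.pi / 2 ^ n, v t with hc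
  have hosc : ∀ n : ℕ, symmMean (Real.pi / 2 ^ n) (fun s => ‖v s - c n‖) ≤ N := fun n => by
    refine le_of_eq_of_le ?_ (hN (Real.pi / 2 ^ n) (by positivity)
      (div_le_self Real.pi_pos.le (one_le_pow₀ one_le_two)))
    rw [meanOscillation, interval_average_eq, symmMean, smul_eq_mul]
    congr 2
    ring
  have hcont : ∀ d : ℂ, Continuous fun s => ‖v s - d‖ := fun d => (hv.sub continuous_const).norm
  have hN0 : 0 ≤ N := by
    refine le_trans ?_ (hosc 0)
    exact mul_nonneg (by positivity) (intervalIntegral.integral_nonneg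
      (by rw [pow_zero, div_one]; linarith [Real.pi_pos]) fun _ _ => norm_nonneg _)
  have hstep : ∀ n, ‖c n - c (n + 1)‖ ≤ 2 * N := fun n => by
    have hh : 0 < Real.pi / 2 ^ (n + 1) := by positivity
    have h1 : ‖c n - c (n + 1)‖ ≤ symmMean (Real.pi / 2 ^ (n + 1)) fun s => ‖v s - c n‖ := by
      have e : c n - c (n + 1) = ((2 * (Real.pi / 2 ^ (n + 1)))⁻¹ : ℝ) •
          ∫ s in -(Real.pi / 2 ^ (n + 1))..Real.pi / 2 ^ (n + 1), (c n - v s) := by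
        rw [intervalIntegral.integral_sub (by simp) (hv.intervalIntegrable _ _), smul_sub,
          intervalIntegral.integral_const, smul_smul]
        simp only [hc]
        rw [interval_average_eq v (-(Real.pi / 2 ^ (n + 1))), sub_neg_eq_add, ← two_mul,
          inv_mul_cancel₀ (by positivity), one_smul]
      rw [e, norm_smul, Real.norm_of_nonneg (by positivity), symmMean]
      refine mul_le_mul_of_nonneg_left ?_ (by positivity)
      refine (intervalIntegral.norm_integral_le_integral_norm (by linarith)).trans_eq ?_
      simp only [norm_sub_rev]
    have h2 := symmMean_half_le (h := Real.pi / 2 ^ n) (by positivity) (hcont (c n))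
      fun _ => norm_nonneg _
    rw [div_div, ← pow_succ] at h2
    have := hosc n
    linarith
  induction n with
  | zero =>
    have := hosc 0
    rw [pow_zero, div_one] at this
    change symmMean Real.pi (fun s => ‖v s - c 0‖) ≤ 6 * N
    linarith
  | succ n ih =>
    change dyadicMean (fun s => ‖v s - c (n + 1)‖) (n + 1) ≤ 6 * N
    change dyadicMean (fun s => ‖v s - c n‖) n ≤ 6 * N at ih
    simp only [dyadicMean]
    have h1 : dyadicMean (fun s => ‖v s - c (n + 1)‖) n ≤ dyadicMean (fun s => ‖v s - c n‖) n +
        2 * (2 * N) := by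
      refine le_trans ?_ (dyadicMean_add_const_le (hcont (c n)) (by linarith) n)
      refine dyadicMean_mono (hcont _) ((hcont _).add continuous_const) (fun s => ?_) n
      have := norm_sub_le_norm_sub_add_norm_sub (v s) (c n) (c (n + 1))
      change ‖v s - c (n + 1)‖ ≤ ‖v s - c n‖ + 2 * N
      linarith [hstep n]
    have h2 := hosc (n + 1)
    linarith

theorem meanOscillation_comp_add_right (u : ℝ → ℂ) (θ α β : ℝ) :
    meanOscillation (fun s => u (s + θ)) α β = meanOscillation u (α + θ) (β + θ) := by
  have e : β + θ - (α + θ) = β - α := by ring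
  simp only [meanOscillation, interval_average_eq, e]
  rw [intervalIntegral.integral_comp_add_right u θ]
  rw [intervalIntegral.integral_comp_add_right
    (fun s => ‖u s - (β - α)⁻¹ • ∫ t in α + θ..β + θ, u t‖) θ]

theorem norm_eval_sub_le_poissonMean (p : Polynomial ℂ) {lam : ℂ} (hl : lam ∈ ball (0 : ℂ) 1)
    (c : ℂ) : ‖p.eval lam - c‖ ≤ poissonMean lam fun ζ => ‖p.eval ζ - c‖ := by
  set d := p.eval lam - c with hd
  have hF : Differentiable ℂ fun z => conj d * (p.eval z - c) :=
    (p.differentiable.sub_const c).const_mul _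
  have h1 := poissonMean_re hl hF
  rw [← hd, re_conj_mul_self] at h1
  have h2 : poissonMean lam (fun z => (conj d * (p.eval z - c)).re) ≤
      poissonMean lam fun z => ‖d‖ * ‖p.eval z - c‖ := by
    refine poissonMean_mono hl (Complex.continuous_re.comp hF.continuous).continuousOn
      (continuous_const.mul (p.continuous.sub continuous_const).norm).continuousOn fun ζ _ => ?_
    refine (Complex.re_le_norm _).trans_eq ?_
    rw [norm_mul, RCLike.norm_conj]
  rw [h1, poissonMean_const_mul] at h2
  have h3 : 0 ≤ poissonMean lam fun z => ‖p.eval z - c‖ :=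
    poissonMean_nonneg hl fun _ _ => norm_nonneg _
  rcases (norm_nonneg d).eq_or_lt with h | h
  · rwa [← h]
  · nlinarith

/-- The constant is `96 = 2 * 8 * 6`: a factor `8` compares the kernels, `6` comes from the dyadic
means, and `2` is the price of replacing the arc mean `c` by `p(lam)`. -/
theorem poissonMean_norm_sub_le {p : Polynomial ℂ} {N : ℝ}
    (hN : ∀ α β : ℝ, α < β → β ≤ α + 2 * Real.pi →
      meanOscillation (fun t => p.eval (circleMap 0 1 t)) α β ≤ N)
    {lam : ℂ} (hl : lam ∈ ball (0 : ℂ) 1) :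
    poissonMean lam (fun ζ => ‖p.eval ζ - p.eval lam‖) ≤ 96 * N := by
  obtain ⟨r, θ, hr0, hr1, rfl⟩ : ∃ r θ : ℝ, 0 ≤ r ∧ r < 1 ∧ lam = circleMap 0 r θ :=
    ⟨‖lam‖, lam.arg, norm_nonneg _, mem_ball_zero_iff.1 hl, by simp [circleMap]⟩
  obtain ⟨n, hn1, hn2⟩ := exists_nat_pow_near_of_lt_one (show 0 < 1 - r by linarith)
    (show 1 - r ≤ 1 by linarith) (show (0 : ℝ) < 1 / 2 by norm_num) (by norm_num)
  rw [one_div_pow] at hn1 hn2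
  have hcm : Continuous fun s : ℝ => p.eval (circleMap 0 1 (s + θ)) :=
    p.continuous.comp ((continuous_circleMap 0 1).comp (continuous_id.add continuous_const))
  have hosc := dyadicMean_norm_sub_le hcm (N := N) (fun h h0 hπ => by
    rw [meanOscillation_comp_add_right (fun t => p.eval (circleMap 0 1 t))]
    exact hN _ _ (by linarith) (by linarith)) n
  set c := ⨍ t in -(Real.pi / 2 ^ n)..Real.pi / 2 ^ n, p.eval (circleMap 0 1 (t + θ))
  have h1 := poissonMean_le_dyadicMean (θ := θ) (w := fun z => ‖p.eval z - c‖)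
    (p.continuous.sub continuous_const).norm (fun _ => norm_nonneg _) hr0 hn1 hn2
  have h2 := norm_eval_sub_le_poissonMean p hl c
  have h3 : poissonMean (circleMap 0 r θ) (fun ζ => ‖p.eval ζ - p.eval (circleMap 0 r θ)‖) ≤
      poissonMean (circleMap 0 r θ) fun ζ => ‖p.eval ζ - c‖ + ‖p.eval (circleMap 0 r θ) - c‖ := by
    refine poissonMean_mono hl (p.continuous.sub continuous_const).norm.continuousOn
      ((p.continuous.sub continuous_const).norm.add continuous_const).continuousOn fun ζ _ => ?_
    rw [norm_sub_rev (p.eval (circleMap 0 r θ)) c]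
    exact norm_sub_le_norm_sub_add_norm_sub _ _ _
  have hpc : Continuous fun z => ‖p.eval z - c‖ := (p.continuous.sub continuous_const).norm
  rw [poissonMean_add hl hpc.continuousOn continuousOn_const, poissonMean_const hl] at h3
  linarith

theorem hankelBound_of_meanOscillation_le {p : Polynomial ℂ} {N : ℝ} (hN0 : 0 < N)
    (hN : ∀ α β : ℝ, α < β → β ≤ α + 2 * Real.pi →
      meanOscillation (fun t => p.eval (circleMap 0 1 t)) α β ≤ N) :
    HankelBound p (64 * (96 * N) + ‖p.eval 0‖) :=
  hankelBound_of_poissonMean_le (by positivity) fun _ hl => poissonMean_norm_sub_le hN hl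

/-! ### Mean oscillation of dilates -/

section Oscillation

theorem intervalIntegral_swap_of_continuous {E : Type*} [NormedAddCommGroup E] [NormedSpace ℝ E]
    [CompleteSpace E] {F : ℝ → ℝ → E} (hF : Continuous F.uncurry) (a b c d : ℝ) :
    ∫ x in a..b, ∫ y in c..d, F x y = ∫ y in c..d, ∫ x in a..b, F x y := by
  refine intervalIntegral_intervalIntegral_swap ?_
  have : IntegrableOn F.uncurry (Set.uIcc a b ×ˢ Set.uIcc c d) :=
    hF.continuousOn.integrableOn_compact (isCompact_uIcc.prod isCompact_uIcc)
  exact this.mono_set (Set.prod_mono Set.uIoc_subset_uIcc Set.uIoc_subset_uIcc)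

/-- Averaging the translates of a function does not increase its mean oscillation. -/
theorem meanOscillation_average_le {K : ℝ → ℝ} {v : ℝ → ℂ} {α β T N : ℝ} (hT : 0 ≤ T)
    (hK : Continuous K) (hK0 : ∀ s, 0 ≤ K s) (hK1 : ∫ s in (0 : ℝ)..T, K s = 1) (hv : Continuous v)
    (hαβ : α < β) (hN : ∀ s, meanOscillation v (α + s) (β + s) ≤ N) :
    meanOscillation (fun θ => ∫ s in (0 : ℝ)..T, K s • v (θ + s)) α β ≤ N := by
  have hℓ : 0 < β - α := by linarith
  set m : ℝ → ℂ := fun s => ⨍ t in α..β, v (t + s) with hm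
  have hvs : Continuous fun x : ℝ × ℝ => v (x.1 + x.2) := hv.comp continuous_add
  have hmc : Continuous m := by
    simp only [hm, interval_average_eq]
    exact continuous_const.smul (intervalIntegral.continuous_parametric_intervalIntegral_of_continuous'
      (f := fun s t => v (t + s)) (hvs.comp continuous_swap) _ _)
  -- By Fubini, the mean of the averaged function is the average of the means `m s` of the
  -- translates, so each translate can be compared with its own mean.
  have hmean : (⨍ t in α..β, ∫ s in (0 : ℝ)..T, K s • v (t + s)) =
      ∫ s in (0 : ℝ)..T, K s • m s := by
    rw [interval_average_eq, intervalIntegral_swap_of_continuous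
      (F := fun t s => K s • v (t + s)) ((hK.comp continuous_snd).smul hvs),
      ← intervalIntegral.integral_smul]
    refine intervalIntegral.integral_congr fun s _ => ?_
    simp only [hm, interval_average_eq]
    rw [intervalIntegral.integral_smul, smul_comm]
  have hosc : ∀ s, (β - α)⁻¹ * ∫ t in α..β, ‖v (t + s) - m s‖ ≤ N := fun s => by
    have := hN s
    rw [← meanOscillation_comp_add_right, meanOscillation, interval_average_eq, smul_eq_mul] at this
    exact this
  have hFc : Continuous (Function.uncurry fun t s => K s * ‖v (t + s) - m s‖) :=
    (hK.comp continuous_snd).mul (hvs.sub (hmc.comp continuous_snd)).norm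
  have hsc : ∀ t, Continuous fun s => v (t + s) := fun t =>
    hv.comp (continuous_const.add continuous_id)
  have hpt : ∀ t, ‖(∫ s in (0 : ℝ)..T, K s • v (t + s)) - ∫ s in (0 : ℝ)..T, K s • m s‖ ≤
      ∫ s in (0 : ℝ)..T, K s * ‖v (t + s) - m s‖ := fun t => by
    have hc1 : Continuous fun s => K s • v (t + s) := hK.smul (hsc t)
    have hc2 : Continuous fun s => K s • m s := hK.smul hmc
    rw [← intervalIntegral.integral_sub (hc1.intervalIntegrable _ _) (hc2.intervalIntegrable _ _)]
    refine (intervalIntegral.norm_integral_le_integral_norm hT).trans_eq ?_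
    refine intervalIntegral.integral_congr fun s _ => ?_
    rw [← smul_sub, norm_smul, Real.norm_of_nonneg (hK0 s)]
  have hvc : Continuous fun t => ∫ s in (0 : ℝ)..T, K s • v (t + s) :=
    intervalIntegral.continuous_parametric_intervalIntegral_of_continuous'
      (f := fun t s => K s • v (t + s)) ((hK.comp continuous_snd).smul hvs) _ _
  rw [meanOscillation, hmean, interval_average_eq, smul_eq_mul]
  calc (β - α)⁻¹ * ∫ t in α..β, ‖(∫ s in (0 : ℝ)..T, K s • v (t + s)) -
        ∫ s in (0 : ℝ)..T, K s • m s‖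
      ≤ (β - α)⁻¹ * ∫ t in α..β, ∫ s in (0 : ℝ)..T, K s * ‖v (t + s) - m s‖ := by
        refine mul_le_mul_of_nonneg_left ?_ (by positivity)
        refine intervalIntegral.integral_mono hαβ.le
          ((hvc.sub continuous_const).norm.intervalIntegrable _ _) ?_ hpt
        exact (intervalIntegral.continuous_parametric_intervalIntegral_of_continuous' hFc
          _ _).intervalIntegrable _ _
    _ = ∫ s in (0 : ℝ)..T, K s * ((β - α)⁻¹ * ∫ t in α..β, ‖v (t + s) - m s‖) := by
        rw [intervalIntegral_swap_of_continuous hFc, ← intervalIntegral.integral_const_mul]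
        refine intervalIntegral.integral_congr fun s _ => ?_
        rw [intervalIntegral.integral_const_mul, mul_left_comm]
    _ ≤ ∫ s in (0 : ℝ)..T, K s * N := by
        refine intervalIntegral.integral_mono hT (Continuous.intervalIntegrable ?_ _ _)
          ((hK.mul continuous_const).intervalIntegrable _ _)
          fun s => mul_le_mul_of_nonneg_left (hosc s) (hK0 s)
        refine hK.mul (continuous_const.mul ?_)
        exact intervalIntegral.continuous_parametric_intervalIntegral_of_continuous'
          (f := fun s t => ‖v (t + s) - m s‖)
          ((hvs.comp continuous_swap).sub (hmc.comp continuous_fst)).norm _ _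
    _ = N := by rw [intervalIntegral.integral_mul_const, hK1, one_mul]

/-- The `L¹` perturbation counts twice: once in the function and once in its mean. -/
theorem meanOscillation_le_add {u v : ℝ → ℂ} {α β : ℝ} (hαβ : α < β)
    (hu : IntervalIntegrable u volume α β) (hv : IntervalIntegrable v volume α β) :
    meanOscillation v α β ≤
      meanOscillation u α β + 2 * ((β - α)⁻¹ * ∫ t in α..β, ‖v t - u t‖) := by
  have hℓ : 0 < β - α := by linarith
  set D := (β - α)⁻¹ * ∫ t in α..β, ‖v t - u t‖ with hD
  have hmean : ‖(⨍ t in α..β, u t) - ⨍ t in α..β, v t‖ ≤ D := by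
    rw [interval_average_eq, interval_average_eq, ← smul_sub,
      ← intervalIntegral.integral_sub hu hv, norm_smul, Real.norm_of_nonneg (by positivity)]
    refine mul_le_mul_of_nonneg_left ?_ (by positivity)
    refine (intervalIntegral.norm_integral_le_integral_norm hαβ.le).trans_eq ?_
    simp only [norm_sub_rev]
  have hd : IntervalIntegrable (fun t => ‖v t - u t‖) volume α β := (hv.sub hu).norm
  have hud : IntervalIntegrable (fun t => ‖u t - ⨍ t in α..β, u t‖) volume α β :=
    (hu.sub intervalIntegrable_const).norm
  have hvd : IntervalIntegrable (fun t => ‖v t - ⨍ t in α..β, v t‖) volume α β :=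
    (hv.sub intervalIntegrable_const).norm
  have hle : ∫ t in α..β, ‖v t - ⨍ t in α..β, v t‖ ≤
      ∫ t in α..β, (‖v t - u t‖ + ‖u t - ⨍ t in α..β, u t‖ + D) := by
    refine intervalIntegral.integral_mono hαβ.le hvd ((hd.add hud).add intervalIntegrable_const)
      fun t => ?_
    have h1 := norm_sub_le_norm_sub_add_norm_sub (v t) (u t) (⨍ t in α..β, v t)
    have h2 := norm_sub_le_norm_sub_add_norm_sub (u t) (⨍ t in α..β, u t) (⨍ t in α..β, v t)
    simp only
    linarith
  rw [intervalIntegral.integral_add (hd.add hud) intervalIntegrable_const,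
    intervalIntegral.integral_add hd hud, intervalIntegral.integral_const, smul_eq_mul] at hle
  have h3 := mul_le_mul_of_nonneg_left hle (inv_nonneg.2 hℓ.le)
  rw [mul_add, mul_add, ← hD, inv_mul_cancel_left₀ hℓ.ne'] at h3
  rw [meanOscillation, meanOscillation, interval_average_eq, interval_average_eq (fun t => ‖u t - _‖),
    smul_eq_mul, smul_eq_mul]
  linarith

theorem meanOscillation_le_of_norm_sub_le {v : ℝ → ℂ} (hv : Continuous v) {α β C : ℝ} {c : ℂ}
    (hαβ : α < β) (hC : ∀ t ∈ Set.Icc α β, ‖v t - c‖ ≤ C) : meanOscillation v α β ≤ 2 * C := by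
  have hℓ : 0 < β - α := by linarith
  have h := meanOscillation_le_add hαβ (u := fun _ => c) (by simp) (hv.intervalIntegrable α β)
  have h0 : meanOscillation (fun _ : ℝ => c) α β = 0 := by
    have : (⨍ _ in α..β, c) = c := by
      rw [interval_average_eq, intervalIntegral.integral_const, smul_smul, inv_mul_cancel₀ hℓ.ne',
        one_smul]
    rw [meanOscillation, this]
    simp
  have h1 : ∫ t in α..β, ‖v t - c‖ ≤ ∫ _ in α..β, C :=
    intervalIntegral.integral_mono_on hαβ.le
      ((hv.sub continuous_const).norm.intervalIntegrable _ _) intervalIntegrable_const hC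
  rw [intervalIntegral.integral_const, smul_eq_mul] at h1
  have h2 := mul_le_mul_of_nonneg_left h1 (inv_nonneg.2 hℓ.le)
  rw [inv_mul_cancel_left₀ hℓ.ne'] at h2
  linarith

end Oscillation

/-! ### Convergence of the dilates to the boundary function in `L¹`. -/

section Boundary

variable {f : ℂ → ℂ} {u : ℝ → ℂ}

theorem HasTaylor.dilate {c : ℕ → ℂ} (h : HasTaylor f c) {τ : ℝ} (h0 : 0 ≤ τ) (h1 : τ ≤ 1) :
    HasTaylor (fun z => f (τ * z)) fun n => c n * τ ^ n := fun z hz => by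
  have hz' : (τ : ℂ) * z ∈ ball (0 : ℂ) 1 := by
    rw [mem_ball_zero_iff] at hz ⊢
    rw [norm_mul, Complex.norm_real, Real.norm_of_nonneg h0]
    nlinarith [norm_nonneg z]
  refine (h _ hz').of_eq fun n => ?_
  rw [mul_pow, mul_assoc]

/-- The bound is independent of `r`, because `1 - (ρ / r)^n ≤ 1 - ρ^n`; thus `r` can tend to `1`
with `ρ` fixed. -/
theorem HasTaylor.circleAverage_norm_sub_dilate_sq_le {c : ℕ → ℂ} (h : HasTaylor f c)
    (hs : Summable fun n => ‖c n‖ ^ 2) {ρ r : ℝ} (hρ : 0 < ρ) (hρr : ρ < r) (hr : r < 1) :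
    Real.circleAverage (fun z => ‖f z - f ((ρ / r : ℝ) * z)‖ ^ 2) 0 r ≤
      ∑' n, ‖c n‖ ^ 2 * (1 - ρ ^ n) ^ 2 := by
  have hr0 : 0 < r := hρ.trans hρr
  have hτ0 : 0 ≤ ρ / r := by positivity
  have hτ1 : ρ / r ≤ 1 := (div_le_one hr0).2 hρr.le
  have hτ : ρ ≤ ρ / r := le_div_self hρ.le hr0 hr.le
  have key := (h.sub (h.dilate hτ0 hτ1)).hasSum_circleAverage_norm_sq hr0 hr
  have hb : ∀ n, 0 ≤ (1 - ρ ^ n) ^ 2 ∧ (1 - ρ ^ n) ^ 2 ≤ 1 := fun n =>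
    ⟨sq_nonneg _, pow_le_one₀ (sub_nonneg.2 (pow_le_one₀ hρ.le (hρr.trans hr).le))
      (sub_le_self _ (by positivity))⟩
  have hsum : Summable fun n => ‖c n‖ ^ 2 * (1 - ρ ^ n) ^ 2 :=
    hs.of_nonneg_of_le (fun n => mul_nonneg (by positivity) (hb n).1)
      fun n => mul_le_of_le_one_right (by positivity) (hb n).2
  rw [← key.tsum_eq]
  refine key.summable.tsum_le_tsum (fun n => ?_) hsum
  have e : c n - c n * ((ρ / r : ℝ) : ℂ) ^ n = c n * ((1 - (ρ / r) ^ n : ℝ) : ℂ) := by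
    push_cast
    ring
  rw [e, norm_mul, Complex.norm_real, mul_pow, Real.norm_eq_abs, sq_abs]
  have h1 : (ρ / r) ^ n ≤ 1 := pow_le_one₀ hτ0 hτ1
  have h2 : ρ ^ n ≤ (ρ / r) ^ n := pow_le_pow_left₀ hρ.le hτ n
  have h3 : r ^ (2 * n) ≤ 1 := pow_le_one₀ hr0.le hr.le
  have h4 : (1 - (ρ / r) ^ n) ^ 2 ≤ (1 - ρ ^ n) ^ 2 := by
    apply pow_le_pow_left₀ <;> linarith
  calc ‖c n‖ ^ 2 * (1 - (ρ / r) ^ n) ^ 2 * r ^ (2 * n) ≤ ‖c n‖ ^ 2 * (1 - (ρ / r) ^ n) ^ 2 :=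
        mul_le_of_le_one_right (by positivity) h3
    _ ≤ _ := by gcongr

theorem tendsto_tsum_one_sub_pow_sq {c : ℕ → ℂ} (hs : Summable fun n => ‖c n‖ ^ 2) :
    Tendsto (fun ρ : ℝ => ∑' n, ‖c n‖ ^ 2 * (1 - ρ ^ n) ^ 2) (𝓝[<] 1) (𝓝 0) := by
  have h := tendsto_tsum_of_dominated_convergence (𝓕 := 𝓝[<] (1 : ℝ))
    (f := fun ρ n => ‖c n‖ ^ 2 * (1 - ρ ^ n) ^ 2) (g := fun _ => 0) hs (fun n => ?_) ?_
  · simpa using h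
  · have hc : Continuous fun ρ : ℝ => ‖c n‖ ^ 2 * (1 - ρ ^ n) ^ 2 := by fun_prop
    simpa using (hc.tendsto 1).mono_left (nhdsWithin_le_nhds (s := Set.Iio 1))
  · filter_upwards [Ioo_mem_nhdsLT (show (0 : ℝ) < 1 by norm_num)] with ρ hρ n
    rw [Real.norm_of_nonneg (by positivity)]
    refine mul_le_of_le_one_right (by positivity) (pow_le_one₀
      (sub_nonneg.2 (pow_le_one₀ hρ.1.le hρ.2.le)) (sub_le_self _ ?_))
    exact pow_nonneg hρ.1.le n

/-- Radial limits exist only almost everywhere, and Fatou's lemma is enough for a one-sided bound.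
-/
theorem integral_norm_sub_boundary_le (hf : ContinuousOn f (ball 0 1))
    (hu : HasBoundaryFunction f u) (hui : ∀ α β : ℝ, IntervalIntegrable u volume α β) {ρ η : ℝ}
    (hρ : ρ ∈ Set.Ioo (0 : ℝ) 1) {a b : ℝ} (hab : a ≤ b) (hη : 0 ≤ η)
    (h : ∀ r, ρ < r → r < 1 → ∫ t in a..b, ‖f (circleMap 0 r t) - f (circleMap 0 ρ t)‖ ≤ η) :
    ∫ t in a..b, ‖f (circleMap 0 ρ t) - u t‖ ≤ η := by
  obtain ⟨r, hrmono, hr, hrt⟩ := exists_seq_strictMono_tendsto' hρ.2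
  have hcr : ∀ n, Continuous fun t => f (circleMap 0 (r n) t) := fun n =>
    continuous_comp_circleMap hf ⟨hρ.1.trans (hr n).1, (hr n).2⟩
  have hcρ : Continuous fun t => f (circleMap 0 ρ t) := continuous_comp_circleMap hf hρ
  have hrt' : Tendsto r atTop (𝓝[<] 1) :=
    tendsto_nhdsWithin_iff.2 ⟨hrt, Eventually.of_forall fun n => (hr n).2⟩
  have hfatou := lintegral_enorm_le_liminf_of_tendsto (μ := volume.restrict (Set.Ioc a b))
    (G := fun n t => ‖f (circleMap 0 (r n) t) - f (circleMap 0 ρ t)‖)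
    (f := fun t => ‖f (circleMap 0 ρ t) - u t‖) ?_ ?_
  · have hi : Integrable (fun t => ‖f (circleMap 0 ρ t) - u t‖) (volume.restrict (Set.Ioc a b)) :=
      (intervalIntegrable_iff_integrableOn_Ioc_of_le hab).1
        ((hcρ.intervalIntegrable _ _).sub (hui a b)).norm
    have hle : (∫⁻ t in Set.Ioc a b, ‖‖f (circleMap 0 ρ t) - u t‖‖ₑ) ≤ ENNReal.ofReal η := by
      refine hfatou.trans (liminf_le_of_frequently_le' (Frequently.of_forall fun n => ?_))
      have hin : Integrable (fun t => ‖f (circleMap 0 (r n) t) - f (circleMap 0 ρ t)‖)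
          (volume.restrict (Set.Ioc a b)) :=
        (intervalIntegrable_iff_integrableOn_Ioc_of_le hab).1
          (((hcr n).sub hcρ).norm.intervalIntegrable _ _)
      rw [← ofReal_integral_norm_eq_lintegral_enorm hin]
      refine ENNReal.ofReal_le_ofReal ?_
      simp only [norm_norm]
      rw [← intervalIntegral.integral_of_le hab]
      exact h _ (hr n).1 (hr n).2
    rw [← ofReal_integral_norm_eq_lintegral_enorm hi, ENNReal.ofReal_le_ofReal_iff hη] at hle
    simp only [norm_norm] at hle
    rwa [intervalIntegral.integral_of_le hab]
  · filter_upwards [ae_restrict_of_ae hu] with t ht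
    have := ((ht.comp hrt').sub_const (f (circleMap 0 ρ t))).norm
    rw [norm_sub_rev (u t)] at this
    exact this
  · exact fun n => ((hcr n).sub hcρ).norm.aemeasurable.enorm

theorem tendsto_dilate_boundary (hf : f ∈ hardyTwo) (hu : HasBoundaryFunction f u)
    (hui : ∀ α β : ℝ, IntervalIntegrable u volume α β) {η : ℝ} (hη : 0 < η) :
    ∀ᶠ ρ in 𝓝[<] (1 : ℝ), ∀ a : ℝ, ∫ t in a..a + 2 * Real.pi, ‖f (circleMap 0 ρ t) - u t‖ ≤ η := by
  obtain ⟨c, hc⟩ := exists_hasTaylor hf.1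
  have hs := hc.mem_hardyTwo_iff.1 hf
  obtain ⟨δ, hδ, rfl⟩ : ∃ δ, 0 < δ ∧ η = 2 * Real.pi * (δ + δ) :=
    ⟨η / (4 * Real.pi), by positivity, by field_simp; ring⟩
  filter_upwards [(tendsto_tsum_one_sub_pow_sq hs).eventually (gt_mem_nhds (show 0 < δ ^ 2 by
    positivity)), Ioo_mem_nhdsLT (show (0 : ℝ) < 1 by norm_num)] with ρ hE hρ a
  refine integral_norm_sub_boundary_le hf.1.continuousOn hu hui hρ (by linarith [Real.pi_pos])
    hη.le fun r hr hr1 => ?_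
  have hr0 : 0 < r := hρ.1.trans hr
  have hmem : ∀ t, circleMap 0 r t ∈ ball (0 : ℂ) 1 := fun t => circleMap_mem_ball ⟨hr0, hr1⟩
  have hsub : sphere (0 : ℂ) |r| ⊆ ball 0 1 := fun z hz => by
    rw [mem_sphere_zero_iff_norm, abs_of_pos hr0] at hz
    rw [mem_ball_zero_iff, hz]
    exact hr1
  have hdil := hc.dilate (τ := ρ / r) (by have := hρ.1; positivity) ((div_le_one hr0).2 hr.le)
  have hcont : ContinuousOn (fun z => f z - f ((ρ / r : ℝ) * z)) (sphere 0 |r|) :=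
    (hc.sub hdil).differentiableOn.continuousOn.mono hsub
  have e : ∀ t, f (circleMap 0 r t) - f (circleMap 0 ρ t) =
      f (circleMap 0 r t) - f ((ρ / r : ℝ) * circleMap 0 r t) := fun t => by
    congr 2
    simp only [circleMap, zero_add]
    rw [← mul_assoc, ← Complex.ofReal_mul, div_mul_cancel₀ _ hr0.ne']
  have hper : Function.Periodic (fun t => ‖f (circleMap 0 r t) - f (circleMap 0 ρ t)‖)
      (2 * Real.pi) := fun t => by
    simp only
    rw [periodic_circleMap 0 r t, periodic_circleMap 0 ρ t]
  have h1 : Real.circleAverage (fun z => ‖f z - f ((ρ / r : ℝ) * z)‖) 0 r ≤ δ + δ := by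
    -- From mean square to mean by `x ≤ δ + x² / δ`, the mean square being at most `δ²`.
    have h2 : Real.circleAverage (fun z => ‖f z - f ((ρ / r : ℝ) * z)‖) 0 r ≤
        Real.circleAverage (fun z => δ + δ⁻¹ * ‖f z - f ((ρ / r : ℝ) * z)‖ ^ 2) 0 r := by
      refine Real.circleAverage_mono (ContinuousOn.circleIntegrable' hcont.norm)
        (ContinuousOn.circleIntegrable' (continuousOn_const.add
          (continuousOn_const.mul (hcont.norm.pow 2)))) fun z _ => ?_
      set x := ‖f z - f ((ρ / r : ℝ) * z)‖
      have h3 : 0 ≤ δ⁻¹ * (x - δ) ^ 2 := by positivity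
      have h4 : δ⁻¹ * (x - δ) ^ 2 = δ⁻¹ * x ^ 2 - 2 * x + δ := by field_simp; ring
      have h5 : 0 ≤ x := norm_nonneg _
      linarith
    have hi : CircleIntegrable (fun z => δ⁻¹ * ‖f z - f ((ρ / r : ℝ) * z)‖ ^ 2) 0 r :=
      ContinuousOn.circleIntegrable' (continuousOn_const.mul (hcont.norm.pow 2))
    rw [Real.circleAverage_fun_add (circleIntegrable_const _ _ _) hi, Real.circleAverage_const,
      circleAverage_const_mul] at h2
    have h6 := (hc.circleAverage_norm_sub_dilate_sq_le hs hρ.1 hr hr1).trans hE.le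
    have h7 := mul_le_mul_of_nonneg_left h6 (inv_nonneg.2 hδ.le)
    have h8 : δ⁻¹ * δ ^ 2 = δ := by field_simp
    linarith
  rw [hper.intervalIntegral_add_eq a 0, zero_add]
  simp only [e]
  rw [Real.circleAverage, smul_eq_mul, inv_mul_le_iff₀ (by positivity)] at h1
  exact h1

end Boundary

theorem poissonKernel_circleMap_add (r s θ : ℝ) :
    poissonKernel 0 (circleMap 0 r θ) (circleMap 0 1 (s + θ)) =
      poissonKernel 0 (r : ℂ) (circleMap 0 1 s) := by
  have e1 : circleMap 0 1 (s + θ) - circleMap 0 r θ =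
      (circleMap 0 1 s - r) * circleMap 0 1 θ := by
    simp only [circleMap, zero_add, Complex.ofReal_one, one_mul, Complex.ofReal_add, add_mul,
      Complex.exp_add]
    ring
  simp only [poissonKernel, sub_zero, e1, norm_mul]
  simp

theorem eval_dilate_eq_integral {f : ℂ → ℂ} (hf : DifferentiableOn ℂ f (ball 0 1)) {r ρ : ℝ}
    (hr : r ∈ Set.Ioo (0 : ℝ) 1) (hρ : ρ ∈ Set.Ioo (0 : ℝ) 1) (θ : ℝ) :
    f (circleMap 0 (r * ρ) θ) = ∫ s in (0 : ℝ)..(2 * Real.pi),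
      ((2 * Real.pi)⁻¹ * poissonKernel 0 (r : ℂ) (circleMap 0 1 s)) •
        f (circleMap 0 ρ (θ + s)) := by
  have hmaps : Set.MapsTo (fun z : ℂ => (ρ : ℂ) * z) (closedBall 0 1) (ball 0 1) := fun z hz => by
    rw [mem_closedBall_zero_iff] at hz
    rw [mem_ball_zero_iff, norm_mul, Complex.norm_real, Real.norm_of_nonneg hρ.1.le]
    nlinarith [hρ.1, hρ.2]
  have hd : Differentiable ℂ fun z : ℂ => (ρ : ℂ) * z := differentiable_fun_id.const_mul _
  have hG : DiffContOnCl ℂ (fun z => f (ρ * z)) (ball 0 1) := by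
    refine ⟨hf.comp hd.differentiableOn (hmaps.mono_left ball_subset_closedBall), ?_⟩
    rw [closure_ball _ one_ne_zero]
    exact hf.continuousOn.comp hd.continuous.continuousOn hmaps
  have h := hG.circleAverage_poissonKernel_smul (circleMap_mem_ball (θ := θ) hr)
  have e : ∀ (x t : ℝ), (ρ : ℂ) * circleMap 0 x t = circleMap 0 (x * ρ) t := fun x t => by
    simp only [circleMap, zero_add, Complex.ofReal_mul]
    ring
  rw [Real.circleAverage_eq_integral_add θ, ← intervalIntegral.integral_smul] at h
  rw [← e, ← h]
  refine intervalIntegral.integral_congr fun s _ => ?_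
  simp only [Pi.smul_apply']
  rw [poissonKernel_circleMap_add, e, one_mul, smul_smul, add_comm s θ]

/-- If the boundary function has mean oscillation at most `N`, so do the dilates. -/
theorem meanOscillation_dilate_le {f : ℂ → ℂ} {u : ℝ → ℂ} (hf : f ∈ hardyTwo)
    (hu : HasBoundaryFunction f u) (hui : ∀ α β : ℝ, IntervalIntegrable u volume α β) {N : ℝ}
    (hN : ∀ α β : ℝ, α < β → β ≤ α + 2 * Real.pi → meanOscillation u α β ≤ N) {R : ℝ}
    (hR : R ∈ Set.Ioo (0 : ℝ) 1) {α β : ℝ} (hαβ : α < β) (hβ : β ≤ α + 2 * Real.pi) :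
    meanOscillation (fun θ => f (circleMap 0 R θ)) α β ≤ N := by
  have hℓ : 0 < β - α := by linarith
  refine le_of_forall_pos_le_add fun ε hε => ?_
  -- No Poisson formula for `u` is needed: the dilate at `R` is a Poisson average of translates of
  -- the dilate at some `ρ` in `(R, 1)` that is `L¹`-close to `u`. The tolerance is scaled by the
  -- arc length, so the error, counted twice, is `ε`.
  obtain ⟨ρ, hρη, hρ⟩ := ((tendsto_dilate_boundary hf hu hui
    (show 0 < ε * (β - α) / 2 by positivity)).and (Ioo_mem_nhdsLT hR.2)).exists
  have hρ0 : 0 < ρ := hR.1.trans hρ.1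
  have hρ' : ρ ∈ Set.Ioo (0 : ℝ) 1 := ⟨hρ0, hρ.2⟩
  have hr : R / ρ ∈ Set.Ioo (0 : ℝ) 1 := ⟨div_pos hR.1 hρ0, (div_lt_one hρ0).2 hρ.1⟩
  have hv : Continuous fun t => f (circleMap 0 ρ t) :=
    continuous_comp_circleMap hf.1.continuousOn hρ'
  have hrb : ((R / ρ : ℝ) : ℂ) ∈ ball (0 : ℂ) 1 := by
    rw [mem_ball_zero_iff, Complex.norm_real, Real.norm_of_nonneg hr.1.le]
    exact hr.2
  have e : (fun θ => f (circleMap 0 R θ)) = fun θ => ∫ s in (0 : ℝ)..(2 * Real.pi),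
      ((2 * Real.pi)⁻¹ * poissonKernel 0 ((R / ρ : ℝ) : ℂ) (circleMap 0 1 s)) •
        f (circleMap 0 ρ (θ + s)) := by
    ext θ
    rw [← eval_dilate_eq_integral hf.1 hr hρ', div_mul_cancel₀ _ hρ0.ne']
  rw [e]
  refine meanOscillation_average_le (v := fun t => f (circleMap 0 ρ t)) Real.two_pi_pos.le
    (continuous_const.mul (continuous_poissonKernel hrb))
    (fun s => mul_nonneg (by positivity)
      (poissonKernel_nonneg_of_mem_sphere hrb (by simp))) ?_ hv hαβ fun s => ?_
  · rw [intervalIntegral.integral_const_mul]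
    exact integral_poissonKernel hrb
  · have hs : α + s < β + s := by linarith
    refine (meanOscillation_le_add hs (hui _ _) (hv.intervalIntegrable _ _)).trans ?_
    have h1 := hN (α + s) (β + s) hs (by linarith)
    have h2 : ∫ t in (α + s)..(β + s), ‖f (circleMap 0 ρ t) - u t‖ ≤ ε * (β - α) / 2 := by
      refine le_trans ?_ (hρη (α + s))
      exact intervalIntegral.integral_mono_interval le_rfl hs.le (by linarith)
        (Eventually.of_forall fun _ => norm_nonneg _)
        ((hv.intervalIntegrable _ _).sub (hui _ _)).norm
    have h3 : β + s - (α + s) = β - α := by ring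
    have h4 := mul_le_mul_of_nonneg_left h2 (inv_nonneg.2 hℓ.le)
    have h5 : (β - α)⁻¹ * (ε * (β - α) / 2) = ε / 2 := by field_simp
    rw [h3]
    linarith

/-! ### From bounded mean oscillation to membership in `H(b)`. -/

theorem HasTaylor.exists_polynomial_near_dilate {f : ℂ → ℂ} {c : ℕ → ℂ} (h : HasTaylor f c)
    {r : ℝ} (hr : r ∈ Set.Ioo (0 : ℝ) 1) {ε : ℝ} (hε : 0 < ε) :
    ∃ p : Polynomial ℂ, ∀ z ∈ closedBall (0 : ℂ) 1, ‖p.eval z - f (r * z)‖ ≤ ε := by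
  have hu := tendstoUniformlyOn_tsum_nat (f := fun n (z : ℂ) => c n * (r * z) ^ n)
    (s := closedBall 0 1) (h.summable_norm hr.1.le hr.2) fun n z hz => by
      rw [mem_closedBall_zero_iff] at hz
      rw [norm_mul, norm_pow, norm_mul, Complex.norm_real, Real.norm_of_nonneg hr.1.le]
      have := hr.1
      gcongr
      exact mul_le_of_le_one_right hr.1.le hz
  obtain ⟨m, hm⟩ := (Metric.tendstoUniformlyOn_iff.1 hu ε hε).exists
  refine ⟨∑ n ∈ Finset.range m, Polynomial.monomial n (c n * r ^ n), fun z hz => ?_⟩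
  have hz' : (r : ℂ) * z ∈ ball (0 : ℂ) 1 := by
    rw [mem_closedBall_zero_iff] at hz
    rw [mem_ball_zero_iff, norm_mul, Complex.norm_real, Real.norm_of_nonneg hr.1.le]
    nlinarith [hr.1, hr.2]
  have h1 := hm z hz
  rw [(h _ hz').tsum_eq, dist_eq_norm, norm_sub_rev] at h1
  refine le_of_eq_of_le ?_ h1.le
  simp only [Polynomial.eval_finsetSum, Polynomial.eval_monomial, mul_pow, mul_assoc]

theorem HankelBound.mono {p : Polynomial ℂ} {C D : ℝ} (h : HankelBound p C) (hCD : C ≤ D) :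
    HankelBound p D := fun g k => (h g k).trans (by gcongr)

/-- If the dilates of `f` have uniformly bounded mean oscillation and `b / a` is in `H²`, then `f`
lies in `H(b)`. -/
theorem IsOuterPair.mem_of_meanOscillation_dilate_le {a b f : ℂ → ℂ} (h : IsOuterPair a b)
    (hφ : (fun z => b z / a z) ∈ hardyTwo) (hf : DifferentiableOn ℂ f (ball 0 1)) {N : ℝ}
    (hN0 : 0 ≤ N) (hN : ∀ r ∈ Set.Ioo (0 : ℝ) 1, ∀ α β : ℝ, α < β → β ≤ α + 2 * Real.pi →
      meanOscillation (fun θ => f (circleMap 0 r θ)) α β ≤ N) : f ∈ deBrangesRovnyak b := by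
  obtain ⟨c, hc⟩ := exists_hasTaylor hf
  obtain ⟨r, -, hr, hrt⟩ := exists_seq_strictMono_tendsto' (show (0 : ℝ) < 1 by norm_num)
  choose p hp using fun n : ℕ => hc.exists_polynomial_near_dilate (hr n)
    (show (0 : ℝ) < 1 / ((n : ℝ) + 1) by positivity)
  have h1 : ∀ n : ℕ, 1 / ((n : ℝ) + 1) ≤ 1 := fun n =>
    div_le_one_of_le₀ (by have : (0 : ℝ) ≤ n := n.cast_nonneg
                          linarith) (by positivity)
  -- Each polynomial is within `1` of a dilate, which adds at most `2` to the mean oscillation and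
  -- `1` to the modulus at the origin.
  refine h.mem_of_hankelBound hφ (p := p) (C := 64 * (96 * (N + 2)) + (‖f 0‖ + 1)) (fun n => ?_)
    fun z hz => ?_
  · refine (hankelBound_of_meanOscillation_le (N := N + 2) (by linarith)
      fun α β hαβ hβ => ?_).mono ?_
    · have hℓ : 0 < β - α := by linarith
      have hfc : Continuous fun θ => f (circleMap 0 (r n) θ) :=
        continuous_comp_circleMap hf.continuousOn (hr n)
      have hpc : Continuous fun θ => (p n).eval (circleMap 0 1 θ) :=
        (p n).continuous.comp (continuous_circleMap 0 1)
      refine (meanOscillation_le_add hαβ (hfc.intervalIntegrable _ _)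
        (hpc.intervalIntegrable _ _)).trans ?_
      have h2 := hN _ (hr n) α β hαβ hβ
      have h3 : ∫ t in α..β, ‖(p n).eval (circleMap 0 1 t) - f (circleMap 0 (r n) t)‖ ≤
          ∫ _ in α..β, (1 : ℝ) := by
        refine intervalIntegral.integral_mono hαβ.le ((hpc.sub hfc).norm.intervalIntegrable _ _)
          intervalIntegrable_const fun t => ?_
        have h4 := (hp n (circleMap 0 1 t) (by simp)).trans (h1 n)
        have e : ((r n : ℝ) : ℂ) * circleMap 0 1 t = circleMap 0 (r n) t := by simp [circleMap]
        rwa [e] at h4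
      rw [intervalIntegral.integral_const, smul_eq_mul, mul_one] at h3
      have h5 := mul_le_mul_of_nonneg_left h3 (inv_nonneg.2 hℓ.le)
      rw [inv_mul_cancel₀ hℓ.ne'] at h5
      linarith
    · have h2 := (hp n 0 (by simp)).trans (h1 n)
      rw [mul_zero] at h2
      have h3 := norm_le_norm_add_norm_sub' ((p n).eval 0) (f 0)
      linarith
  · have hz1 : ‖z‖ < 1 := by simpa using hz
    have h2 : Tendsto (fun n => f (r n * z)) atTop (𝓝 (f z)) := by
      have hca : ContinuousAt f z := hf.continuousOn.continuousAt (isOpen_ball.mem_nhds hz)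
      refine hca.tendsto.comp ?_
      have := ((Complex.continuous_ofReal.tendsto (1 : ℝ)).comp hrt).mul_const z
      simpa using this
    have h3 : Tendsto (fun n => (p n).eval z - f (r n * z)) atTop (𝓝 0) :=
      squeeze_zero_norm (fun n => hp n z (ball_subset_closedBall hz))
        tendsto_one_div_add_atTop_nhds_zero_nat
    simpa using h3.add h2

/-- The dilates are bounded by `C`, so their oscillation is at most `2 C`; working with dilates
avoids Fatou's theorem on radial limits. -/
theorem IsOuterPair.hardyInfty_subset {a b : ℂ → ℂ} (h : IsOuterPair a b)
    (hφ : (fun z => b z / a z) ∈ hardyTwo) : hardyInfty ⊆ deBrangesRovnyak b := by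
  rintro f ⟨hf, C, hC⟩
  refine h.mem_of_meanOscillation_dilate_le hφ hf (N := 2 * C)
    (mul_nonneg zero_le_two ((norm_nonneg _).trans (hC 0 (by simp)))) fun r hr α β hαβ _ => ?_
  refine meanOscillation_le_of_norm_sub_le (c := 0)
    (continuous_comp_circleMap hf.continuousOn hr) hαβ fun t _ => ?_
  rw [sub_zero]
  exact hC _ (circleMap_mem_ball hr)

theorem IsOuterPair.BMOA_subset {a b : ℂ → ℂ} (h : IsOuterPair a b)
    (hφ : (fun z => b z / a z) ∈ hardyTwo) : BMOA ⊆ deBrangesRovnyak b := by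
  rintro f ⟨hf, u, hu, hui, C, hC⟩
  exact h.mem_of_meanOscillation_dilate_le hφ hf.1 (le_max_right C 0) fun r hr α β hαβ hβ =>
    meanOscillation_dilate_le hf hu hui
      (fun α β hαβ hβ => (hC α β hαβ hβ).trans (le_max_left _ _)) hr hαβ hβ

/-! ### Inclusions between the spaces -/

theorem diskAlgebra_subset_hardyInfty : diskAlgebra ⊆ hardyInfty := by
  rintro f ⟨hf, g, hg, hgf⟩
  obtain ⟨C, hC⟩ := (isCompact_closedBall (0 : ℂ) 1).exists_bound_of_continuousOn hg
  exact ⟨hf, C, fun z hz => hgf hz ▸ hC z (ball_subset_closedBall hz)⟩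

theorem VMOA_subset_BMOA : VMOA ⊆ BMOA := fun _ ⟨hf, u, hu, hv⟩ => ⟨hf, u, hu, hv.1⟩

theorem diskAlgebra_subset_VMOA : diskAlgebra ⊆ VMOA := by
  intro f hfA
  refine ⟨hardyInfty_subset_hardyTwo (diskAlgebra_subset_hardyInfty hfA), ?_⟩
  obtain ⟨hf, g, hg, hgf⟩ := hfA
  have hcm : ∀ θ, circleMap 0 1 θ ∈ closedBall (0 : ℂ) 1 := fun θ => by simp
  have huc : Continuous fun θ => g (circleMap 0 1 θ) :=
    hg.comp_continuous (continuous_circleMap 0 1) hcm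
  obtain ⟨C, hC⟩ := (isCompact_closedBall (0 : ℂ) 1).exists_bound_of_continuousOn hg
  refine ⟨fun θ => g (circleMap 0 1 θ), .of_forall fun θ => ?_,
    ⟨fun α β => huc.intervalIntegrable _ _, 2 * C, fun α β hαβ _ =>
      meanOscillation_le_of_norm_sub_le (c := 0) huc hαβ fun t _ => by
        rw [sub_zero]; exact hC _ (hcm t)⟩, fun ε hε => ?_⟩
  · have h1 : Tendsto (fun r : ℝ => circleMap 0 r θ) (𝓝[<] 1)
        (𝓝[closedBall 0 1] (circleMap 0 1 θ)) := by
      refine tendsto_nhdsWithin_iff.2 ⟨?_, ?_⟩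
      · have hc : Continuous fun r : ℝ => circleMap 0 r θ := by
          unfold circleMap
          fun_prop
        exact (hc.tendsto 1).mono_left nhdsWithin_le_nhds
      · filter_upwards [Ioo_mem_nhdsLT (show (0 : ℝ) < 1 by norm_num)] with r hr
        exact ball_subset_closedBall (circleMap_mem_ball hr)
    refine ((hg _ (hcm θ)).tendsto.comp h1).congr' ?_
    filter_upwards [Ioo_mem_nhdsLT (show (0 : ℝ) < 1 by norm_num)] with r hr
    exact hgf (circleMap_mem_ball hr)
  · obtain ⟨δ, hδ, hδε⟩ := Metric.uniformContinuousOn_iff.1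
      ((isCompact_closedBall (0 : ℂ) 1).uniformContinuousOn_of_continuous hg) (ε / 3)
      (by positivity)
    refine ⟨δ, hδ, fun α β hαβ _ hlt => ?_⟩
    refine (meanOscillation_le_of_norm_sub_le (c := g (circleMap 0 1 α)) (C := ε / 3) huc hαβ
      fun t ht => ?_).trans_lt (by linarith)
    rw [← dist_eq_norm]
    refine (hδε _ (hcm t) _ (hcm α) ?_).le
    have h2 := (lipschitzWith_circleMap 0 1).dist_le_mul t α
    refine h2.trans_lt ?_
    rw [Real.dist_eq, abs_of_nonneg (by linarith [ht.1])]
    simp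
    linarith [ht.2]

theorem mainTheorem2 (a b : ℂ → ℂ)
    (hb : DifferentiableOn ℂ b (Metric.ball 0 1))
    (hbD : Set.MapsTo b (Metric.ball 0 1) (Metric.ball 0 1))
    (hab : IsPythagoreanMate a b) :
    List.TFAE [
      (fun z => b z / a z) ∈ hardyTwo,
      hardyInfty ⊆ deBrangesRovnyak b,
      diskAlgebra ⊆ deBrangesRovnyak b,
      VMOA ⊆ deBrangesRovnyak b,
      BMOA ⊆ deBrangesRovnyak b] := by
  have h := hab.isOuterPair hb hbD
  tfae_have 1 → 5 := h.BMOA_subset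
  tfae_have 5 → 4 := VMOA_subset_BMOA.trans
  tfae_have 4 → 3 := diskAlgebra_subset_VMOA.trans
  tfae_have 3 → 1 := h.mem_hardyTwo_of_diskAlgebra_subset
  tfae_have 1 → 2 := h.hardyInfty_subset
  tfae_have 2 → 3 := diskAlgebra_subset_hardyInfty.trans
  tfae_finish
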